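/- **Setting.** Let $\Bbbk$ be a field with $2\neq 0$ in $\Bbbk$, and let $N=|\mathbf x|$ be the number of punctures. Let $\mathcal C$ be the $\Bbbk$-linear category with objects $T_0,\dots,T_N$, morphism spaces $\mathrm{Hom}(T_i,T_j)=\bigoplus_{\alpha\ge 0}\Bbbk\,a_{ji}s^\alpha$ in degree $0$, and composition $$a_{kj}s^\beta\cdot a_{ji}s^\alpha=a_{ki}s^{\alpha+\beta+\delta(i,j,k)},\qquad \delta(i,j,k)=\begin{cases}0,&(i-j)(j-k)\ge 0,\\ \min(|i-j|,|j-k|),&(i-j)(j-k)<0.\end{cases}$$ Regard $\mathcal C$ as an $A_\infty$-category with $\mu^d=0$ for $d\ne2$. Let $\mathrm{Tw}^b(\mathcal C)$ be the category of bounded twisted complexes over $\mathcal C$, with $\mu^1(f)=(-1)^{|f|}\delta\cdot f-f\cdot\delta$ and $\mu^2(f_2,f_1)=(-1)^{|f_1|}f_2\cdot f_1$, where the dot is the composition without signs. Write $s_i^\alpha=a_{ii}s^\alpha$ and $e_i=s_i^0$. Let $1\le i\le N-1$. The negative braiding functor $\beta_{i^-}\colon\mathcal C\to\mathrm{Tw}^b(\mathcal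 C)$ is the $A_\infty$-functor with the following components. * $\beta_{i^-}T_j=T_j$ for $j\ne i$, and $\beta_{i^-}T_i=\bigl(T_i\xrightarrow{\delta=[a_{i-1,i},\,-a_{i+1,i}]}T_{i-1}\oplus T_{i+1}\bigr)$ in degrees $-1$ and $0$. * $\beta^1_{i^-}(a_{kj}s^\alpha)=a_{kj}s^\alpha$ for $j,k\neq i$; $\beta^1_{i^-}(a_{ij}s^\alpha)=a_{i+\mathrm{sgn}(j-i),j}s^\alpha$ for $j\ne i$; $\beta^1_{i^-}(a_{ki}s^\alpha)$ has the components $a_{k,i-1}s^{\alpha}$, $a_{k,i+1}s^{\alpha+1}$ if $k>i$, and $a_{k,i-1}s^{\alpha+1}$, $a_{k,i+1}s^{\alpha}$ if $k<i$; $\beta^1_{i^-}(s_i^\alpha)$ is $s^\alpha$ on each of the three summands. * $\beta^2_{i^-}(a_{ik}s^\beta,a_{kj}s^\alpha)=\mathrm{sgn}(i-k)\,a_{ij}s^{\alpha+\beta+|i-k|-1}$ into the summand of degree $-1$, if $(i-j)(i-k)<0$; $\beta^2_{i^-}(a_{ik}s^\beta,a_{ki}s^\alpha)=\mathrm{sgn}(i-k)\,a_{i,i+\mathrm{sgn}(i-k)}s^{\alpha+\beta+|i-k|-1}$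 from the summand $T_{i+\mathrm{sgn}(i-k)}$ to the summand of degree $-1$, if $k\ne i$; all other $\beta^2_{i^-}$ vanish, and $\beta^d_{i^-}=0$ for $d\ge3$. Let $\mathrm{id}\colon\mathcal C\to\mathrm{Tw}^b(\mathcal C)$ be the inclusion. A pre-natural transformation $\eta\colon\mathrm{id}\Rightarrow\beta_{i^-}$ of degree $g$ is a family of multilinear maps $\eta^d\colon\mathrm{Hom}(X_{d-1},X_d)\otimes\cdots\otimes\mathrm{Hom}(X_0,X_1)\to\mathrm{Hom}^{g-d}(X_0,\beta_{i^-}X_d)$, $d\ge 0$, for generators $X_0,\dots,X_d$. The differential is the standard one of the $A_\infty$-category of functors: $$\begin{aligned}\mu^1_{\mathrm{Fun}}(\eta)^d(a_d,\dots,a_1)={}&\mu^1(\eta^d(a_d,\dots,a_1))+\sum_{0\le s<d}\mu^2(\beta_{i^-}^{d-s}(a_d,\dots,a_{s+1}),\eta^s(a_s,\dots,a_1))\\&+(-1)^{g-1}\mu^2(\eta^{d-1}(a_d,\dots,a_2),a_1)-\sum_{0\le n\le d-2}(-1)^{-n+g-1}\eta^{d-1}(a_d,\dots,a_{n+2}\cdot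 a_{n+1},\dots,a_1),\end{aligned}$$ where the third term is present for $d\ge1$. Natural transformations are the cocycles, and $H^g\mathrm{Hom}(\mathrm{id},\beta_{i^-})$ is the cohomology. Let $\mathfrak B_{i^-}\subset\Delta$ be the sub-bimodule of the diagonal $\mathcal C$-bimodule spanned by all $a_{kj}s^\alpha$ except $e_i$. For $\vartheta=(\vartheta_j)_{1\le j\le N-1,\,j\ne i}$ put $\vartheta_0=\vartheta_i=\vartheta_N=0$. For a path $T_i\to T_j\to T_k$ (in this formula $i,j,k$ are arbitrary) let $$\mathfrak C(a_{kj}s^\beta,a_{ji}s^\alpha)=\begin{cases}-\beta\vartheta_j-\sum_{t=1}^{j-k}2(\beta+t)\vartheta_{j-t}-(\beta+j-k)\bigl(\vartheta_{k-1}+\sum_{i<v<k}(\vartheta_v+\vartheta_{v-1})\bigr),&i<k\le j,\\ \beta\vartheta_j+\sum_{t=1}^{k-j}2(\beta+t)\vartheta_{j+t}+(\beta+k-j)\bigl(\vartheta_{k+1}+\sum_{k<v<i}(\vartheta_v+\vartheta_{v+1})\bigr),&j\le k<i,\\ -\beta\vartheta_j-\sum_{t=1}^{j-i}2(\beta+t)\vartheta_{j-t}+(\beta+j-i)\vartheta_i,&k\le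 i<j,\\ \beta\vartheta_j+\sum_{t=1}^{i-j}2(\beta+t)\vartheta_{j+t}-(\beta+i-j)\vartheta_i,&j<i\le k,\\ -\beta\sum_{i<v\le j}(\vartheta_v+\vartheta_{v-1}),&i<j<k,\\ \beta\sum_{j\le v<i}(\vartheta_v+\vartheta_{v+1}),&k<j<i,\\ 0,&i=j.\end{cases}$$ **Theorem.** There are degree $2$ natural transformations $\eta_\vartheta\colon\mathrm{id}\Rightarrow\beta_{i^-}$, depending linearly on $\vartheta\in\Bbbk^{N-2}$, such that $\vartheta\mapsto[\eta_\vartheta]$ is an isomorphism from $\Bbbk^{N-2}$ onto $H^2\mathrm{Hom}(\mathrm{id},\beta_{i^-})$; moreover $\mathrm{HH}^2(\mathfrak B_{i^-})\cong\Bbbk^{N-2}$. Their components are as follows. 1. $\eta^d=0$ for $d\notin\{2,3\}$, and $$\eta^2(a_{lk}s^\beta,a_{kj}s^\alpha)=\begin{cases}\mathfrak C(a_{lk}s^\beta,a_{kj}s^\alpha)\,a_{lj}s^{\beta+\alpha+\delta(j,k,l)-1},&l\ne i,\\ \mathfrak C(a_{ik}s^\beta,a_{kj}s^\alpha)\,a_{i+\mathrm{sgn}(j-i),j}s^{\beta+\alpha+\delta(j,k,i)-1},&l=i\ne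 j,\\ \mathfrak C(a_{ik}s^\beta,a_{ki}s^\alpha)\bigl[\tfrac12a_{i-1,i}s^{\beta+\alpha+|i-k|-2},\ \tfrac12a_{i+1,i}s^{\beta+\alpha+|i-k|-2}\bigr],&l=j=i\end{cases}$$ (the coefficient $\mathfrak C$ vanishes whenever the exponent of $s$ is negative). 2. $\eta^3(a_3,a_2,a_1)=0$ unless $a_3$ ends at $T_i$. If $a_3$ ends at $T_i$, then $\eta^3(a_3,a_2,a_1)$ is the unique element of degree $-1$ with $$\delta\cdot\eta^3(a_3,a_2,a_1)=\beta^1_{i^-}(a_3)\cdot\eta^2(a_2,a_1)-\eta^2(a_3,a_2)\cdot a_1+\eta^2(a_3,a_2\cdot a_1)-\eta^2(a_3\cdot a_2,a_1).$$ 3. If $\vartheta\ne0$, then for every $l$ there are composable $a_1,a_2$ and $a_3\in\mathrm{Hom}(T_l,T_i)$ with $\eta_\vartheta^3(a_3,a_2,a_1)\neq0$. -/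

import Mathlib

open Polynomial

noncomputable section

namespace KLRW

/-! ### The category `C` of the generators `T_0, …, T_N`

Every morphism space `Hom(T_i, T_j)` has the basis `a_{ji} s^α` (`α ≥ 0`), all in degree `0`; it is
identified with `k[X]` by `a_{ji} s^α ↔ X ^ α`. Composites are read from right to left. -/

/-- The number `δ(i,j,k)` of dots created when `T_i → T_j` is followed by `T_j → T_k`. -/
def turn (i j k : ℕ) : ℕ :=
  if 0 ≤ ((i : ℤ) - j) * ((j : ℤ) - k) then 0
  else min ((i : ℤ) - j).natAbs ((j : ℤ) - k).natAbs

/-- `a_{kj} s^β · a_{ji} s^α = a_{ki} s^{β + α + δ(i,j,k)}`, extended bilinearly. -/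
def mul {k : Type*} [Field k] (v₀ v₁ v₂ : ℕ) (g f : k[X]) : k[X] :=
  X ^ turn v₀ v₁ v₂ * g * f

/-- The scalar `(-1)^z`. -/
def sign (k : Type*) [Field k] (z : ℤ) : k := ((z.negOnePow : ℤ) : k)

/-! ### Bounded twisted complexes over `C` -/

/-- A possible summand of a twisted complex: the `copy`-th copy of `T_vtx` in degree `deg`. -/
@[ext] structure Slot (N : ℕ) where
  deg : ℤ
  vtx : Fin (N + 1)
  copy : ℕ
deriving DecidableEq

/-- Matrices of morphisms of `C`; the entry `f b a` is a morphism from the summand `a` to the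
summand `b`. -/
abbrev Mat (k : Type*) [Field k] (N : ℕ) := Matrix (Slot N) (Slot N) k[X]

/-- A bounded twisted complex over `C`: a finite set of summands with a differential `δ` of degree
`1` and square zero (as `μ^d = 0` in `C` for `d ≠ 2`, this is the Maurer-Cartan equation). -/
structure Tw (k : Type*) [Field k] (N : ℕ) where
  supp : Finset (Slot N)
  diff : Mat k N
  diff_deg : ∀ b a, diff b a ≠ 0 → b ∈ supp ∧ a ∈ supp ∧ b.deg = a.deg + 1
  diff_sq : ∀ c a, ∑ b ∈ supp, mul a.vtx b.vtx c.vtx (diff c b) (diff b a) = 0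

section
variable {k : Type*} [Field k] {N : ℕ}

/-- `Hom^g(Y, Z)` in twisted complexes. -/
def Tw.hom (Y Z : Tw k N) (g : ℤ) : Submodule k (Mat k N) where
  carrier := {f | ∀ b a, f b a ≠ 0 → b ∈ Z.supp ∧ a ∈ Y.supp ∧ b.deg = a.deg + g}
  add_mem' := by
    intro f f' hf hf' b a h
    by_cases h0 : f b a = 0
    · refine hf' b a fun h1 => h ?_
      rw [Matrix.add_apply, h0, h1, add_zero]
    · exact hf b a h0
  zero_mem' := fun _ _ h => absurd rfl h
  smul_mem' := by
    intro c f hf b a h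
    refine hf b a fun h1 => h ?_
    rw [Matrix.smul_apply, h1, smul_zero]

/-- The composite `f₂ · f₁` without signs, through the middle object `Y`. -/
def Tw.dot (Y : Tw k N) (f₂ f₁ : Mat k N) : Mat k N :=
  fun c a => ∑ b ∈ Y.supp, mul a.vtx b.vtx c.vtx (f₂ c b) (f₁ b a)

/-- `μ¹(f) = (-1)^{|f|} δ · f - f · δ` for `f : Y → Z` of degree `g`. -/
def mu1 (Y Z : Tw k N) (g : ℤ) (f : Mat k N) : Mat k N :=
  sign k g • Z.dot Z.diff f - Y.dot f Y.diff

/-- `μ²(f₂, f₁) = (-1)^{|f₁|} f₂ · f₁` for `f₁` of degree `g₁`, with middle object `Y`. -/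
def mu2 (Y : Tw k N) (g₁ : ℤ) (f₂ f₁ : Mat k N) : Mat k N :=
  sign k g₁ • Y.dot f₂ f₁

end

/-! ### Families of operations on chains of morphisms of `C`

A chain `T_{v 0} → T_{v 1} → ⋯ → T_{v d}` is given by `v : Fin (d+1) → Fin (N+1)` and
`a : Fin d → k[X]`, where `a n : T_{v n} → T_{v (n+1)}`. So `a 0, a 1, …` are the morphisms which
are usually written `a_1, a_2, …`. -/

/-- Families of functions `η^d(a_d, …, a_1)` with values in `M`. -/
abbrev Ops (k : Type*) [Field k] (N : ℕ) (M : Type*) :=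
  ∀ d : ℕ, (Fin (d + 1) → Fin (N + 1)) → (Fin d → k[X]) → M

/-- Multilinearity over `k`. -/
def IsMultilin (k : Type*) [Field k] {M : Type*} [AddCommGroup M] [Module k M] {d : ℕ}
    (f : (Fin d → k[X]) → M) : Prop :=
  ∃ m : MultilinearMap k (fun _ : Fin d => k[X]) M, ⇑m = f

section
variable {k : Type*} [Field k] {N : ℕ}

/-- The first `s` entries of a tuple of length `d`. -/
def low {A : Type*} {d : ℕ} (s : ℕ) (h : s ≤ d) (a : Fin d → A) : Fin s → A :=
  fun n => a (n.castLE h)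

/-- The entries `s, s+1, …` of a tuple of length `d`, where `s + r = d`. -/
def upp {A : Type*} {d : ℕ} (s r : ℕ) (h : s + r ≤ d) (a : Fin d → A) : Fin r → A :=
  fun n => a ⟨s + n, by omega⟩

/-- The vertices of a chain after `a_{n+2}` and `a_{n+1}` have been composed. -/
def dropVtx {d : ℕ} (n : Fin d) (v : Fin (d + 2) → Fin (N + 1)) : Fin (d + 1) → Fin (N + 1) :=
  fun m => v (n.succ.castSucc.succAbove m)

/-- The morphisms of a chain after `a_{n+2}` and `a_{n+1}` have been composed. -/
def mulAt {d : ℕ} (n : Fin d) (v : Fin (d + 2) → Fin (N + 1)) (a : Fin (d + 1) → k[X]) :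
    Fin d → k[X] :=
  fun m =>
    if m < n then a m.castSucc
    else if m = n then
      mul (v n.castSucc.castSucc) (v n.castSucc.succ) (v n.succ.succ) (a n.succ) (a n.castSucc)
    else a m.succ

/-- `∑_n c(n) η^{d-1}(a_d, …, a_{n+3}, a_{n+2} · a_{n+1}, a_n, …, a_1)`. -/
def insertMul {M : Type*} [AddCommGroup M] [Module k M] (c : ℕ → k) (η : Ops k N M) : Ops k N M
  | 0, _, _ => 0
  | d + 1, v, a => ∑ n : Fin d, c n • η d (dropVtx n v) (mulAt n v a)

/-- The object map and the components `F^d` (`d ≥ 1`; the entry for `d = 0` is never used) of an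
`A_∞`-functor from `C` to twisted complexes. -/
structure AFunctor (k : Type*) [Field k] (N : ℕ) where
  obj : Fin (N + 1) → Tw k N
  map : Ops k N (Mat k N)

/-- Pre-natural transformations `F ⇒ G` of degree `g`: multilinear maps `η^d`, `d ≥ 0`, on chains of
length `d`, with values in `Hom^{g-d}(F X_0, G X_d)`. -/
def PreNat (F G : AFunctor k N) (g : ℤ) : Submodule k (Ops k N (Mat k N)) where
  carrier := {η | ∀ d v, IsMultilin k (η d v) ∧
    ∀ a, η d v a ∈ (F.obj (v 0)).hom (G.obj (v (Fin.last d))) (g - d)}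
  add_mem' := by
    intro η η' h h' d v
    obtain ⟨⟨m, hm⟩, h2⟩ := h d v
    obtain ⟨⟨m', hm'⟩, h2'⟩ := h' d v
    refine ⟨⟨m + m', ?_⟩, fun a => Submodule.add_mem _ (h2 a) (h2' a)⟩
    funext a
    change m a + m' a = η d v a + η' d v a
    rw [hm, hm']
  zero_mem' := fun d v => ⟨⟨0, rfl⟩, fun _ => Submodule.zero_mem _⟩
  smul_mem' := by
    intro c η h d v
    obtain ⟨⟨m, hm⟩, h2⟩ := h d v
    refine ⟨⟨c • m, ?_⟩, fun a => Submodule.smul_mem _ c (h2 a)⟩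
    funext a
    change c • m a = c • η d v a
    rw [hm]

/-- The differential `μ¹_{Fun}` on pre-natural transformations of degree `g`, as a formula. Twisted
complexes only have `μ¹` and `μ²`, `C` only has `μ²`, and all morphisms of `C` have degree `0`, so
that `μ¹_{Fun}(η)^d(a_d, …, a_1)` is the sum of
* `μ¹(η^d(a_d, …, a_1))`,
* `μ²(G^{d-s}(a_d, …, a_{s+1}), η^s(a_s, …, a_1))` for `0 ≤ s < d`,
* `(-1)^{(g-1)(-s)} μ²(η^{d-s}(a_d, …, a_{s+1}), F^s(a_s, …, a_1))` for `0 < s ≤ d`,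
* `-(-1)^{-n+g-1} η^{d-1}(a_d, …, a_{n+2} · a_{n+1}, …, a_1)` for `0 ≤ n ≤ d - 2`. -/
def natDiffFun (F G : AFunctor k N) (g : ℤ) (η : Ops k N (Mat k N)) : Ops k N (Mat k N) :=
  fun d v a =>
    mu1 (F.obj (v 0)) (G.obj (v (Fin.last d))) (g - d) (η d v a)
    + ∑ s : Fin d, mu2 (G.obj (v s.castSucc)) (g - s)
        (G.map (d - s) (upp s (d - s + 1) (by omega) v) (upp s (d - s) (by omega) a))
        (η s (low (s + 1) (by omega) v) (low s (by omega) a))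
    + ∑ s : Fin d, sign k ((g - 1) * (-(s + 1))) • mu2 (F.obj (v s.succ)) (1 - (s + 1))
        (η (d - (s + 1)) (upp (s + 1) (d - (s + 1) + 1) (by omega) v)
          (upp (s + 1) (d - (s + 1)) (by omega) a))
        (F.map (s + 1) (low (s + 1 + 1) (by omega) v) (low (s + 1) (by omega) a))
    - insertMul (fun n => sign k (-n + g - 1)) η d v a

lemma mul_add_right' (v₀ v₁ v₂ : ℕ) (g f f' : k[X]) :
    mul v₀ v₁ v₂ g (f + f') = mul v₀ v₁ v₂ g f + mul v₀ v₁ v₂ g f' := mul_add _ _ _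

lemma mul_add_left' (v₀ v₁ v₂ : ℕ) (g g' f : k[X]) :
    mul v₀ v₁ v₂ (g + g') f = mul v₀ v₁ v₂ g f + mul v₀ v₁ v₂ g' f := by
  unfold mul; ring

lemma mul_smul_right' (v₀ v₁ v₂ : ℕ) (c : k) (g f : k[X]) :
    mul v₀ v₁ v₂ g (c • f) = c • mul v₀ v₁ v₂ g f := by
  unfold mul; rw [mul_smul_comm]

lemma mul_smul_left' (v₀ v₁ v₂ : ℕ) (c : k) (g f : k[X]) :
    mul v₀ v₁ v₂ (c • g) f = c • mul v₀ v₁ v₂ g f := by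
  unfold mul; rw [mul_smul_comm, smul_mul_assoc]

lemma dot_add_right (Y : Tw k N) (g f f' : Mat k N) :
    Y.dot g (f + f') = Y.dot g f + Y.dot g f' := by
  funext c a
  simp only [Tw.dot, Matrix.add_apply, mul_add_right', Finset.sum_add_distrib]

lemma dot_add_left (Y : Tw k N) (g g' f : Mat k N) :
    Y.dot (g + g') f = Y.dot g f + Y.dot g' f := by
  funext c a
  simp only [Tw.dot, Matrix.add_apply, mul_add_left', Finset.sum_add_distrib]

lemma dot_smul_right (Y : Tw k N) (c : k) (g f : Mat k N) :
    Y.dot g (c • f) = c • Y.dot g f := by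
  funext b a
  simp only [Tw.dot, Matrix.smul_apply, mul_smul_right', Finset.smul_sum]

lemma dot_smul_left (Y : Tw k N) (c : k) (g f : Mat k N) :
    Y.dot (c • g) f = c • Y.dot g f := by
  funext b a
  simp only [Tw.dot, Matrix.smul_apply, mul_smul_left', Finset.smul_sum]

lemma insertMul_add {M : Type*} [AddCommGroup M] [Module k M] (c : ℕ → k) (η η' : Ops k N M) :
    insertMul c (η + η') = insertMul c η + insertMul c η' := by
  funext d v a
  cases d with
  | zero => simp [insertMul]
  | succ d => simp [insertMul, Finset.sum_add_distrib]

lemma insertMul_smul {M : Type*} [AddCommGroup M] [Module k M] (c : ℕ → k) (r : k)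
    (η : Ops k N M) : insertMul c (r • η) = r • insertMul c η := by
  funext d v a
  cases d with
  | zero => simp [insertMul]
  | succ d => simp [insertMul, Finset.smul_sum, smul_comm r]

/-- The differential `μ¹_{Fun}` in degree `g`, as a linear map. -/
def natDiff (F G : AFunctor k N) (g : ℤ) : Ops k N (Mat k N) →ₗ[k] Ops k N (Mat k N) where
  toFun := natDiffFun F G g
  map_add' := by
    intro η η'
    funext d v a
    simp only [natDiffFun, insertMul_add, Pi.add_apply, mu1, mu2, dot_add_left, dot_add_right,
      smul_add, Finset.sum_add_distrib]
    abel
  map_smul' := by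
    intro c η
    funext d v a
    simp only [natDiffFun, insertMul_smul, Pi.smul_apply, mu1, mu2, dot_smul_left, dot_smul_right,
      smul_comm _ c, RingHom.id_apply, ← Finset.smul_sum, ← smul_sub, ← smul_add]

/-- `A_∞`-natural transformations `F ⇒ G` of degree `g`: the cocycles of degree `g`. -/
def NatTrans (F G : AFunctor k N) (g : ℤ) : Submodule k (Ops k N (Mat k N)) :=
  PreNat F G g ⊓ LinearMap.ker (natDiff F G g)

/-- The coboundaries `μ¹_{Fun}(ζ)` of pre-natural transformations `ζ` of degree `g - 1`, as a
subspace of the natural transformations of degree `g`. -/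
def NatBoundary (F G : AFunctor k N) (g : ℤ) : Submodule k (NatTrans F G g) :=
  ((PreNat F G (g - 1)).map (natDiff F G (g - 1))).comap (NatTrans F G g).subtype

/-- `H^g Hom_{Fun}(F, G)`. -/
abbrev HNat (F G : AFunctor k N) (g : ℤ) := NatTrans F G g ⧸ NatBoundary F G g

/-- The class of a natural transformation in `H^g Hom_{Fun}(F, G)`. -/
def HNat.mk (F G : AFunctor k N) (g : ℤ) : NatTrans F G g →ₗ[k] HNat F G g :=
  (NatBoundary F G g).mkQ

end

/-! ### The identity and the negative braiding functor -/

/-- An index `1 ≤ i ≤ N - 1`; the functor `β_i⁻` exchanges the punctures `x_i` and `x_{i+1}`. -/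
structure Inner (N : ℕ) where
  val : ℕ
  pos : 0 < val
  lt : val < N

namespace Inner
variable {N : ℕ} (i : Inner N)

/-- The vertex `i`. -/
def mid : Fin (N + 1) := ⟨i.val, by have := i.lt; omega⟩
/-- The vertex `i - 1`. -/
def left : Fin (N + 1) := ⟨i.val - 1, by have := i.lt; omega⟩
/-- The vertex `i + 1`. -/
def right : Fin (N + 1) := ⟨i.val + 1, by have := i.lt; omega⟩
/-- The vertex `i + sgn(j - i)`, for `j ≠ i`. -/
def toward (j : Fin (N + 1)) : Fin (N + 1) := if i.mid < j then i.right else i.left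

lemma left_ne_right : i.left ≠ i.right := by
  intro h
  have h1 : i.val - 1 = i.val + 1 := congrArg Fin.val h
  omega

end Inner

/-- The summand `T_v` in degree `p`. -/
def slot {N : ℕ} (p : ℤ) (v : Fin (N + 1)) : Slot N := ⟨p, v, 0⟩

section
variable {k : Type*} [Field k] {N : ℕ}

/-- The matrix with the single entry `f`, from the summand `a` to the summand `b`. -/
def entry (b a : Slot N) (f : k[X]) : Mat k N := Matrix.single b a f

/-- `T_v` as a twisted complex. -/
def gen (v : Fin (N + 1)) : Tw k N where
  supp := {slot 0 v}
  diff := 0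
  diff_deg := fun _ _ h => absurd rfl h
  diff_sq := by intro c a; simp [mul]

/-- The inclusion of `C` into twisted complexes, that is, the identity functor on the generators:
`id^1(a) = a` and `id^d = 0` for `d ≠ 1`. -/
def idF : AFunctor k N where
  obj := gen
  map := fun d => match d with
    | 1 => fun v a => entry (slot 0 (v 1)) (slot 0 (v 0)) (a 0)
    | _ => fun _ _ => 0

/-- The differential `[a_{i-1,i}, -a_{i+1,i}] : T_i → T_{i-1} ⊕ T_{i+1}`. -/
def braidDelta (i : Inner N) : Mat k N :=
  entry (slot 0 i.left) (slot (-1) i.mid) 1 - entry (slot 0 i.right) (slot (-1) i.mid) 1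

lemma braidDelta_ne {i : Inner N} {b a : Slot N} (h : (braidDelta i : Mat k N) b a ≠ 0) :
    (b = slot 0 i.left ∨ b = slot 0 i.right) ∧ a = slot (-1) i.mid := by
  by_contra hc
  apply h
  have h1 : ¬ (slot 0 i.left = b ∧ slot (-1) i.mid = a) := fun ⟨x, y⟩ => hc ⟨Or.inl x.symm, y.symm⟩
  have h2 : ¬ (slot 0 i.right = b ∧ slot (-1) i.mid = a) :=
    fun ⟨x, y⟩ => hc ⟨Or.inr x.symm, y.symm⟩
  simp only [braidDelta, entry, Matrix.sub_apply, Matrix.single, Matrix.of_apply, if_neg h1,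
    if_neg h2, sub_zero]

/-- The twisted complex `β_i⁻ T_i = (T_i → T_{i-1} ⊕ T_{i+1})`, in degrees `-1` and `0`. -/
def braidObj (i : Inner N) : Tw k N where
  supp := {slot (-1) i.mid, slot 0 i.left, slot 0 i.right}
  diff := braidDelta i
  diff_deg := by
    intro b a h
    obtain ⟨hb, rfl⟩ := braidDelta_ne h
    rcases hb with rfl | rfl <;> simp [slot]
  diff_sq := by
    intro c a
    refine Finset.sum_eq_zero fun b _ => ?_
    by_cases h1 : (braidDelta i : Mat k N) c b = 0
    · simp [mul, h1]
    by_cases h2 : (braidDelta i : Mat k N) b a = 0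
    · simp [mul, h2]
    have e1 := (braidDelta_ne h1).2
    have e2 := (braidDelta_ne h2).1
    rw [e1] at e2
    rcases e2 with e2 | e2 <;> simp [slot] at e2

/-- `β_i⁻` on a morphism `a_{kj} f`, where `f` is a polynomial in the dot `s`. -/
def braid1 (i : Inner N) (j l : Fin (N + 1)) (f : k[X]) : Mat k N :=
  if j ≠ i.mid then
    if l ≠ i.mid then entry (slot 0 l) (slot 0 j) f
    else entry (slot 0 (i.toward j)) (slot 0 j) f
  else if i.mid < l then
    entry (slot 0 l) (slot 0 i.left) f + entry (slot 0 l) (slot 0 i.right) (X * f)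
  else if l < i.mid then
    entry (slot 0 l) (slot 0 i.left) (X * f) + entry (slot 0 l) (slot 0 i.right) f
  else
    entry (slot (-1) i.mid) (slot (-1) i.mid) f + entry (slot 0 i.left) (slot 0 i.left) f
      + entry (slot 0 i.right) (slot 0 i.right) f

/-- The second component of `β_i⁻` on `T_j → T_m → T_l` with morphisms `a_{mj} f` and `a_{lm} g`. -/
def braid2 (i : Inner N) (j m l : Fin (N + 1)) (g f : k[X]) : Mat k N :=
  let h : k[X] := ((((i.val : ℤ) - (m : ℕ)).sign : ℤ) : k[X]) *
    (X ^ (((i.val : ℤ) - (m : ℕ)).natAbs - 1) * g * f)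
  if l ≠ i.mid ∨ m = i.mid then 0
  else if j = i.mid then
    if m < i.mid then entry (slot (-1) i.mid) (slot 0 i.right) h
    else entry (slot (-1) i.mid) (slot 0 i.left) h
  else if ((i.val : ℤ) - (j : ℕ)) * ((i.val : ℤ) - (m : ℕ)) < 0 then
    entry (slot (-1) i.mid) (slot 0 j) h
  else 0

/-- The negative braiding functor `β_i⁻` on `C`. -/
def braidF (i : Inner N) : AFunctor k N where
  obj := fun v => if v = i.mid then braidObj i else gen v
  map := fun d => match d with
    | 1 => fun v a => braid1 i (v 0) (v 1) (a 0)
    | 2 => fun v a => braid2 i (v 0) (v 1) (v 2) (a 1) (a 0)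
    | _ => fun _ _ => 0

end

/-! ### The bimodule `𝔅_i⁻` and its Hochschild cohomology -/

section
variable {k : Type*} [Field k] {N : ℕ}

/-- The sub-bimodule `𝔅_i⁻` of the diagonal bimodule `Δ(T_v, T_w) = Hom(T_v, T_w)`: the kernel of
the projection of `Δ` onto the simple bimodule spanned by the class of `e_i`. -/
def bimod (i : Inner N) (v w : Fin (N + 1)) : Submodule k k[X] where
  carrier := {f | v = i.mid → w = i.mid → f.coeff 0 = 0}
  add_mem' := by intro f g hf hg h1 h2; simp [hf h1 h2, hg h1 h2]
  zero_mem' := by intro _ _; simp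
  smul_mem' := by intro c f hf h1 h2; simp [hf h1 h2]

/-- Hochschild cochains of degree `g` of `C` with coefficients in `𝔅_i⁻`. -/
def BimodCochain (k : Type*) [Field k] (i : Inner N) (g : ℕ) : Submodule k (Ops k N k[X]) where
  carrier := {φ | (∀ d, d ≠ g → φ d = 0) ∧ ∀ d v, IsMultilin k (φ d v) ∧
    ∀ a, φ d v a ∈ bimod i (v 0) (v (Fin.last d))}
  add_mem' := by
    rintro η η' ⟨h0, h⟩ ⟨h0', h'⟩
    refine ⟨fun d hd => by simp [h0 d hd, h0' d hd], fun d v => ?_⟩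
    obtain ⟨⟨m, hm⟩, h2⟩ := h d v
    obtain ⟨⟨m', hm'⟩, h2'⟩ := h' d v
    refine ⟨⟨m + m', ?_⟩, fun a => Submodule.add_mem _ (h2 a) (h2' a)⟩
    funext a
    change m a + m' a = η d v a + η' d v a
    rw [hm, hm']
  zero_mem' := ⟨fun _ _ => rfl, fun d v => ⟨⟨0, rfl⟩, fun _ => Submodule.zero_mem _⟩⟩
  smul_mem' := by
    rintro c η ⟨h0, h⟩
    refine ⟨fun d hd => by simp [h0 d hd], fun d v => ?_⟩
    obtain ⟨⟨m, hm⟩, h2⟩ := h d v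
    refine ⟨⟨c • m, ?_⟩, fun a => Submodule.smul_mem _ c (h2 a)⟩
    funext a
    change c • m a = c • η d v a
    rw [hm]

/-- The Hochschild differential: `(dφ)(a_{d+1}, …, a_1)` is
`φ(a_{d+1}, …, a_2) · a_1 + ∑_{r=1}^{d} (-1)^r φ(…, a_{r+1} · a_r, …)
+ (-1)^{d+1} a_{d+1} · φ(a_d, …, a_1)`. -/
def bimodDiffFun (φ : Ops k N k[X]) : Ops k N k[X]
  | 0, _, _ => 0
  | d + 1, v, a =>
    mul (v 0) (v 1) (v (Fin.last (d + 1))) (φ d (Fin.tail v) (Fin.tail a)) (a 0)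
    + insertMul (fun n => (-1) ^ (n + 1)) φ (d + 1) v a
    + (-1 : k) ^ (d + 1) • mul (v 0) (v (Fin.last d).castSucc) (v (Fin.last (d + 1)))
        (a (Fin.last d)) (φ d (Fin.init v) (Fin.init a))

/-- The Hochschild differential as a linear map. -/
def bimodDiff (k : Type*) [Field k] (N : ℕ) : Ops k N k[X] →ₗ[k] Ops k N k[X] where
  toFun := bimodDiffFun
  map_add' := by
    intro φ φ'
    funext d v a
    cases d with
    | zero => simp [bimodDiffFun]
    | succ d =>
      simp only [bimodDiffFun, insertMul_add, Pi.add_apply, mul_add_left', mul_add_right',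
        smul_add]
      abel
  map_smul' := by
    intro c φ
    funext d v a
    cases d with
    | zero => simp [bimodDiffFun]
    | succ d =>
      simp only [bimodDiffFun, insertMul_smul, Pi.smul_apply, mul_smul_left', mul_smul_right',
        smul_comm _ c, RingHom.id_apply, ← smul_add]

/-- Hochschild cocycles of degree `g` with coefficients in `𝔅_i⁻`. -/
def BimodCocycle (k : Type*) [Field k] (i : Inner N) (g : ℕ) : Submodule k (Ops k N k[X]) :=
  BimodCochain k i g ⊓ LinearMap.ker (bimodDiff k N)

/-- The Hochschild cohomology `HH^{g+1}(𝔅_i⁻)`. -/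
abbrev HHBimod (k : Type*) [Field k] (i : Inner N) (g : ℕ) :=
  BimodCocycle k i (g + 1) ⧸
    ((BimodCochain k i g).map (bimodDiff k N)).comap (BimodCocycle k i (g + 1)).subtype

end

/-! ### The natural transformations of degree two -/

section
variable {k : Type*} [Field k] {N : ℕ}

/-- The parameters `(ϑ_j)` with `1 ≤ j ≤ N - 1` and `j ≠ i`. -/
abbrev Param (k : Type*) [Field k] (i : Inner N) := {j : ℕ // 0 < j ∧ j < N ∧ j ≠ i.val} → k

/-- The sequence `ϑ_0, ϑ_1, …, ϑ_N`, where `ϑ_0 = ϑ_i = ϑ_N = 0`. -/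
def Param.ext {i : Inner N} (ϑ : Param k i) (j : ℕ) : k :=
  if h : 0 < j ∧ j < N ∧ j ≠ i.val then ϑ ⟨j, h⟩ else 0

/-- The coefficient `ℭ(a_{lj} s^β, a_{ji} s^α)` of the path `T_i → T_j → T_l`. -/
def coeffC (ϑ : ℕ → k) (β i j l : ℕ) : k :=
  if i < l ∧ l ≤ j then
    -β * ϑ j - ∑ t ∈ Finset.Icc 1 (j - l), 2 * ((β : k) + t) * ϑ (j - t)
      - ((β : k) + (j - l : ℕ)) * (ϑ (l - 1) + ∑ t ∈ Finset.Ioo i l, (ϑ t + ϑ (t - 1)))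
  else if j ≤ l ∧ l < i then
    β * ϑ j + ∑ t ∈ Finset.Icc 1 (l - j), 2 * ((β : k) + t) * ϑ (j + t)
      + ((β : k) + (l - j : ℕ)) * (ϑ (l + 1) + ∑ t ∈ Finset.Ioo l i, (ϑ t + ϑ (t + 1)))
  else if l ≤ i ∧ i < j then
    -β * ϑ j - ∑ t ∈ Finset.Icc 1 (j - i), 2 * ((β : k) + t) * ϑ (j - t)
      + ((β : k) + (j - i : ℕ)) * ϑ i
  else if j < i ∧ i ≤ l then
    β * ϑ j + ∑ t ∈ Finset.Icc 1 (i - j), 2 * ((β : k) + t) * ϑ (j + t)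
      - ((β : k) + (i - j : ℕ)) * ϑ i
  else if i < j ∧ j < l then
    -β * ∑ t ∈ Finset.Ioc i j, (ϑ t + ϑ (t - 1))
  else if l < j ∧ j < i then
    β * ∑ t ∈ Finset.Ico j i, (ϑ t + ϑ (t + 1))
  else 0

/-- The value `η²(a_{lm} s^β, a_{mj} s^α)`. The coefficient vanishes whenever the exponent of `s`
would be negative. -/
def eta2 (i : Inner N) (ϑ : Param k i) (j m l : Fin (N + 1)) (β α : ℕ) : Mat k N :=
  let c : k := coeffC ϑ.ext β j m l
  let e : ℕ := β + α + turn j m l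
  if l ≠ i.mid then entry (slot 0 l) (slot 0 j) (c • X ^ (e - 1))
  else if j ≠ i.mid then entry (slot 0 (i.toward j)) (slot 0 j) (c • X ^ (e - 1))
  else entry (slot 0 i.left) (slot 0 i.mid) ((c / 2) • X ^ (e - 2))
    + entry (slot 0 i.right) (slot 0 i.mid) ((c / 2) • X ^ (e - 2))

/-- `β_i⁻(a_3) · η²(a_2, a_1) - η²(a_3, a_2) · a_1 + η²(a_3, a_2 · a_1) - η²(a_3 · a_2, a_1)`. -/
def homotopyRHS (i : Inner N) (η : Ops k N (Mat k N)) (v : Fin 4 → Fin (N + 1))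
    (a : Fin 3 → k[X]) : Mat k N :=
  ((braidF i).obj (v 2)).dot (braid1 i (v 2) (v 3) (a 2)) (η 2 ![v 0, v 1, v 2] ![a 0, a 1])
  - (gen (v 1)).dot (η 2 ![v 1, v 2, v 3] ![a 1, a 2]) (entry (slot 0 (v 1)) (slot 0 (v 0)) (a 0))
  + η 2 ![v 0, v 2, v 3] ![mul (v 0) (v 1) (v 2) (a 1) (a 0), a 2]
  - η 2 ![v 0, v 1, v 3] ![a 0, mul (v 1) (v 2) (v 3) (a 2) (a 1)]

/-- The description of the components of `η_ϑ`. -/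
structure HasComponents (i : Inner N) (ϑ : Param k i) (η : Ops k N (Mat k N)) : Prop where
  eta_zero : ∀ d, d ≠ 2 → d ≠ 3 → η d = 0
  eta_two : ∀ v α β, η 2 v ![X ^ α, X ^ β] = eta2 i ϑ (v 0) (v 1) (v 2) β α
  eta_three_of_ne : ∀ v a, v 3 ≠ i.mid → η 3 v a = 0
  eta_three : ∀ v a, v 3 = i.mid →
    (braidObj i).dot (braidDelta i) (η 3 v a) = homotopyRHS i η v a

end

end KLRW

end

noncomputable section
namespace KLRW

/-! ### Composition -/

/-! The complex of morphisms from `T_p` to the braided `T_l` has two terms, in degrees -1 and 0. Its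
differential is injective, and composition with the closed morphism `counit` identifies its cokernel
with the bimodule 𝔅 (`proj`, `proj_projSection`, `delta_deltaInv`, `eq_zero_of_delta_eq_zero`). A
pre-natural transformation of degree `g` therefore has components only in lengths `g` and `g + 1`.
The first is a lift of a Hochschild `g`-cochain of 𝔅, and the second is a correction that δ
determines.

It follows that the degree two cohomology of transformations is HH² of 𝔅. Projecting is compatible
with the differentials in degree one (`underlying_natDiff`) and sends natural transformations to
cocycles (`underlying_cocycle`). Conversely, a lift of a Hochschild 2-cocycle extends by a unique η³
to a natural transformation (`extendOps_mem_natTrans`), which is a coboundary as soon as the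
2-cocycle is one (`exists_natDiff_eq`).

For the upper bound on HH², the category is generated by the arrows between neighbouring vertices,
and at each inner vertex the two loops through the neighbours coincide. A 2-cocycle is trivialized
by recursion along paths. The only obstruction is the constant term of the difference of its values
on the two loops at an inner vertex (`IsCocycle.eq_cobdry`). At `i` this obstruction vanishes,
because 𝔅 omits `e_i`, so N - 2 scalars remain, collected in `relClass`.

For the lower bound, the coefficients ℭ come from an explicit 1-cochain `lam`: its coboundary is
divisible by `X`, and the quotient `phi` is, up to sign, the cocycle with coefficients ℭ
(`coeffC_eq`, `phi_cocycle`). It is a cocycle because `X` is central and not a zero divisor. Its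
invariant `relClass` is -2ϑ (`relClass_etaTwo`), so for 2 ≠ 0 both isomorphisms follow.

Finally, if η³ vanishes on all triples whose last morphism runs from `T_l` to `T_i`, then the
right-hand side of the homotopy equation vanishes there. Reading off how its coefficients depend on
the number of dots forces `sig` to be constant away from `i`, hence ϑ = 0
(`eq_zero_of_homotopyRHS`). -/

lemma two_mul_turn (a b c : ℕ) :
    2 * turn a b c + ((a - c) + (c - a)) = (a - b) + (b - a) + ((b - c) + (c - b)) := by
  unfold turn
  rcases le_total a b with h1 | h1 <;> rcases le_total b c with h2 | h2
  · rw [if_pos (mul_nonneg_of_nonpos_of_nonpos (by omega) (by omega))]; omega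
  · split_ifs with h
    · rcases eq_or_ne a b with rfl | h3
      · omega
      rcases eq_or_ne b c with rfl | h4
      · omega
      exact absurd h (not_le.2 (mul_neg_of_neg_of_pos (by omega) (by omega)))
    · omega
  · split_ifs with h
    · rcases eq_or_ne a b with rfl | h3
      · omega
      rcases eq_or_ne b c with rfl | h4
      · omega
      exact absurd h (not_le.2 (mul_neg_of_pos_of_neg (by omega) (by omega)))
    · omega
  · rw [if_pos (mul_nonneg (by omega) (by omega))]; omega

lemma turn_eq_iff (a b c n : ℕ) : turn a b c = n ↔
    2 * n + ((a - c) + (c - a)) = (a - b) + (b - a) + ((b - c) + (c - b)) := by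
  have := two_mul_turn a b c
  omega

/-- By `two_mul_turn`, `turn` is half the defect in the triangle inequality, where `(a - c) + (c -
a)` with truncated subtraction is the distance. Both sides are half of |a-b| + |b-c| + |c-d| -
|a-d|. This is associativity of the composition. -/
lemma turn_assoc (a b c d : ℕ) : turn a b d + turn b c d = turn a c d + turn a b c := by
  have h1 := two_mul_turn a b d
  have h2 := two_mul_turn b c d
  have h3 := two_mul_turn a c d
  have h4 := two_mul_turn a b c
  omega

@[simp] lemma turn_self_left (a c : ℕ) : turn a a c = 0 := by simp [turn]

@[simp] lemma turn_self_right (a c : ℕ) : turn a c c = 0 := by simp [turn]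

section
variable {k : Type*} [Field k] {N : ℕ}

lemma mul_mul_assoc (a b c d : ℕ) (h g f : k[X]) :
    mul a b d (mul b c d h g) f = mul a c d h (mul a b c g f) := by
  have e := turn_assoc a b c d
  unfold mul
  calc X ^ turn a b d * (X ^ turn b c d * h * g) * f
      = X ^ (turn a b d + turn b c d) * h * g * f := by rw [pow_add]; ring
    _ = X ^ turn a c d * h * (X ^ turn a b c * g * f) := by rw [e, pow_add]; ring

@[simp] lemma mul_zero_right (a b c : ℕ) (g : k[X]) : mul a b c g 0 = 0 := by simp [mul]

@[simp] lemma mul_zero_left (a b c : ℕ) (f : k[X]) : mul a b c 0 f = 0 := by simp [mul]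

@[simp] lemma mul_one_left (a c : ℕ) (f : k[X]) : mul a c c 1 f = f := by simp [mul]

@[simp] lemma mul_one_right (a c : ℕ) (g : k[X]) : mul a a c g 1 = g := by simp [mul]

lemma mul_neg_right (a b c : ℕ) (g f : k[X]) : mul a b c g (-f) = -mul a b c g f := by simp [mul]

lemma mul_neg_left (a b c : ℕ) (g f : k[X]) : mul a b c (-g) f = -mul a b c g f := by simp [mul]

lemma mul_sub_right (a b c : ℕ) (g f f' : k[X]) :
    mul a b c g (f - f') = mul a b c g f - mul a b c g f' := by unfold mul; ring

lemma mul_sub_left (a b c : ℕ) (g g' f : k[X]) :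
    mul a b c (g - g') f = mul a b c g f - mul a b c g' f := by unfold mul; ring

lemma mul_sum_right {ι : Type*} (s : Finset ι) (a b c : ℕ) (g : k[X]) (f : ι → k[X]) :
    mul a b c g (∑ x ∈ s, f x) = ∑ x ∈ s, mul a b c g (f x) := Finset.mul_sum _ _ _

lemma mul_sum_left {ι : Type*} (s : Finset ι) (a b c : ℕ) (g : ι → k[X]) (f : k[X]) :
    mul a b c (∑ x ∈ s, g x) f = ∑ x ∈ s, mul a b c (g x) f := by
  simp only [mul, Finset.mul_sum, Finset.sum_mul]

lemma dot_assoc (Y Z : Tw k N) (h g f : Mat k N) :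
    Y.dot (Z.dot h g) f = Z.dot h (Y.dot g f) := by
  funext d a
  simp only [Tw.dot, mul_sum_left, mul_sum_right, mul_mul_assoc]
  exact Finset.sum_comm

@[simp] lemma dot_zero_right (Y : Tw k N) (g : Mat k N) : Y.dot g 0 = 0 := by
  funext c a; simp [Tw.dot]

@[simp] lemma dot_zero_left (Y : Tw k N) (f : Mat k N) : Y.dot 0 f = 0 := by
  funext c a; simp [Tw.dot]

lemma dot_neg_right (Y : Tw k N) (g f : Mat k N) : Y.dot g (-f) = -Y.dot g f := by
  funext c a; simp [Tw.dot, mul_neg_right]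

lemma dot_neg_left (Y : Tw k N) (g f : Mat k N) : Y.dot (-g) f = -Y.dot g f := by
  funext c a; simp [Tw.dot, mul_neg_left]

lemma dot_sub_right (Y : Tw k N) (g f f' : Mat k N) :
    Y.dot g (f - f') = Y.dot g f - Y.dot g f' := by
  rw [sub_eq_add_neg, dot_add_right, dot_neg_right, sub_eq_add_neg]

lemma dot_sub_left (Y : Tw k N) (g g' f : Mat k N) :
    Y.dot (g - g') f = Y.dot g f - Y.dot g' f := by
  rw [sub_eq_add_neg, dot_add_left, dot_neg_left, sub_eq_add_neg]

/-! ### Matrices with a single entry -/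

lemma entry_apply (b a b' a' : Slot N) (f : k[X]) :
    (entry b a f : Mat k N) b' a' = if b = b' ∧ a = a' then f else 0 := rfl

lemma entry_add (b a : Slot N) (f g : k[X]) :
    (entry b a (f + g) : Mat k N) = entry b a f + entry b a g := Matrix.single_add _ _ _ _

lemma entry_smul (b a : Slot N) (c : k) (f : k[X]) :
    (entry b a (c • f) : Mat k N) = c • entry b a f := (Matrix.smul_single c b a f).symm

@[simp] lemma entry_zero (b a : Slot N) : (entry b a 0 : Mat k N) = 0 := Matrix.single_zero _ _

lemma entry_neg (b a : Slot N) (f : k[X]) : (entry b a (-f) : Mat k N) = -entry b a f := by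
  rw [eq_neg_iff_add_eq_zero, ← entry_add]; simp

lemma dot_entry_entry (Y : Tw k N) (c b b' a : Slot N) (g f : k[X]) :
    Y.dot (entry c b g) (entry b' a f) =
      if b = b' ∧ b ∈ Y.supp then entry c a (mul a.vtx b.vtx c.vtx g f) else 0 := by
  funext c' a'
  by_cases h : b = b' ∧ b ∈ Y.supp
  · obtain ⟨rfl, h⟩ := h
    simp only [Tw.dot, h, and_self, if_true, entry_apply]
    rw [Finset.sum_eq_single_of_mem b h]
    · by_cases h1 : c = c'
      · by_cases h2 : a = a'
        · subst h1 h2; simp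
        · simp [h2]
      · simp [h1]
    · intro x _ hx
      simp [Ne.symm hx]
  · rw [if_neg h]
    refine Finset.sum_eq_zero fun x hx => ?_
    by_cases h1 : b = x
    · subst h1
      have : b' ≠ b := fun e => h ⟨e.symm, hx⟩
      simp [entry_apply, this]
    · simp [entry_apply, h1]

@[simp] lemma slot_vtx (p : ℤ) (v : Fin (N + 1)) : (slot p v).vtx = v := rfl

@[simp] lemma slot_deg (p : ℤ) (v : Fin (N + 1)) : (slot p v).deg = p := rfl

@[simp] lemma slot_inj {p q : ℤ} {v w : Fin (N + 1)} : slot p v = slot q w ↔ p = q ∧ v = w := by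
  simp [slot, Slot.ext_iff]

@[simp] lemma gen_supp (v : Fin (N + 1)) : (gen v : Tw k N).supp = {slot 0 v} := rfl

@[simp] lemma gen_diff (v : Fin (N + 1)) : (gen v : Tw k N).diff = 0 := rfl

@[simp] lemma braidObj_supp (i : Inner N) :
    (braidObj i : Tw k N).supp = {slot (-1) i.mid, slot 0 i.left, slot 0 i.right} := rfl

@[simp] lemma braidObj_diff (i : Inner N) : (braidObj i : Tw k N).diff = braidDelta i := rfl

end

namespace Inner
variable {N : ℕ} (i : Inner N)

@[simp] lemma mid_val : (i.mid : ℕ) = i.val := rfl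
@[simp] lemma left_val : (i.left : ℕ) = i.val - 1 := rfl
@[simp] lemma right_val : (i.right : ℕ) = i.val + 1 := rfl
@[simp] lemma left_eq_right : (i.left = i.right) ↔ False := iff_false_intro i.left_ne_right
@[simp] lemma right_eq_left : (i.right = i.left) ↔ False :=
  iff_false_intro i.left_ne_right.symm

lemma mid_lt {l : Fin (N + 1)} : i.mid < l ↔ i.val < l := Iff.rfl
lemma lt_mid {l : Fin (N + 1)} : l < i.mid ↔ (l : ℕ) < i.val := Iff.rfl
lemma eq_mid {l : Fin (N + 1)} : l = i.mid ↔ (l : ℕ) = i.val := Fin.ext_iff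

lemma trichotomy (l : Fin (N + 1)) :
    ((l : ℕ) < i.val ∧ l ≠ i.mid) ∨ l = i.mid ∨ (i.val < (l : ℕ) ∧ l ≠ i.mid) := by
  have := i.eq_mid (l := l)
  rcases lt_trichotomy (l : ℕ) i.val with h | h | h <;> simp_all <;> omega

lemma toward_of_lt {l : Fin (N + 1)} (h : (l : ℕ) < i.val) : i.toward l = i.left := by
  rw [toward, if_neg]; rw [mid_lt]; omega

lemma toward_of_gt {l : Fin (N + 1)} (h : i.val < (l : ℕ)) : i.toward l = i.right := by
  rw [toward, if_pos]; exact h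

end Inner

section
variable {k : Type*} [Field k] {N : ℕ}

/-! ### The braiding functor -/

@[simp] lemma braidF_obj_mid (i : Inner N) : (braidF (k := k) i).obj i.mid = braidObj i := by
  simp [braidF]

lemma braidF_obj_of_ne (i : Inner N) {l : Fin (N + 1)} (h : l ≠ i.mid) :
    (braidF (k := k) i).obj l = gen l := by
  simp [braidF, h]

lemma braid1_of_ne (i : Inner N) {j l : Fin (N + 1)} (hj : j ≠ i.mid) (hl : l ≠ i.mid)
    (f : k[X]) : braid1 i j l f = entry (slot 0 l) (slot 0 j) f := by
  simp [braid1, hj, hl]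

lemma braid1_to_mid (i : Inner N) {j : Fin (N + 1)} (hj : j ≠ i.mid) (f : k[X]) :
    braid1 i j i.mid f = entry (slot 0 (i.toward j)) (slot 0 j) f := by
  simp [braid1, hj]

lemma braid1_from_mid_of_gt (i : Inner N) {l : Fin (N + 1)} (hl : i.val < (l : ℕ)) (f : k[X]) :
    braid1 i i.mid l f =
      entry (slot 0 l) (slot 0 i.left) f + entry (slot 0 l) (slot 0 i.right) (X * f) := by
  simp [braid1, i.mid_lt.2 hl]

lemma braid1_from_mid_of_lt (i : Inner N) {l : Fin (N + 1)} (hl : (l : ℕ) < i.val) (f : k[X]) :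
    braid1 i i.mid l f =
      entry (slot 0 l) (slot 0 i.left) (X * f) + entry (slot 0 l) (slot 0 i.right) f := by
  have h : ¬ i.mid < l := by rw [i.mid_lt]; omega
  simp [braid1, h, i.lt_mid.2 hl]

lemma braid1_mid (i : Inner N) (f : k[X]) :
    braid1 i i.mid i.mid f = entry (slot (-1) i.mid) (slot (-1) i.mid) f
      + entry (slot 0 i.left) (slot 0 i.left) f + entry (slot 0 i.right) (slot 0 i.right) f := by
  simp [braid1]

lemma braid2_of_ne (i : Inner N) {j m l : Fin (N + 1)} (h : l ≠ i.mid ∨ m = i.mid)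
    (g f : k[X]) : braid2 i j m l g f = 0 := by
  simp only [braid2]; rw [if_pos h]

lemma braid1_add (i : Inner N) (j l : Fin (N + 1)) (f g : k[X]) :
    braid1 i j l (f + g) = braid1 i j l f + braid1 i j l g := by
  unfold braid1
  split_ifs <;> simp only [entry_add, mul_add] <;> abel

lemma braid1_smul (i : Inner N) (j l : Fin (N + 1)) (c : k) (f : k[X]) :
    braid1 i j l (c • f) = c • braid1 i j l f := by
  unfold braid1
  split_ifs <;> simp only [entry_smul, mul_smul_comm, smul_add]

/-- The morphism `[a_{i,i-1}, a_{i,i+1}] : β_i⁻ T_i → T_i`, and the identity of `T_l` for `l ≠ i`. -/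
def counit (k : Type*) [Field k] (i : Inner N) (l : Fin (N + 1)) : Mat k N :=
  if l = i.mid then entry (slot 0 i.mid) (slot 0 i.left) 1 + entry (slot 0 i.mid) (slot 0 i.right) 1
  else entry (slot 0 l) (slot 0 l) 1

lemma counit_mid (i : Inner N) : counit k i i.mid =
    entry (slot 0 i.mid) (slot 0 i.left) 1 + entry (slot 0 i.mid) (slot 0 i.right) 1 := by
  simp [counit]

lemma counit_of_ne (i : Inner N) {l : Fin (N + 1)} (h : l ≠ i.mid) :
    counit k i l = entry (slot 0 l) (slot 0 l) 1 := by
  simp [counit, h]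

/-- The counit is strictly natural. The dots that the braiding functor puts on the components of a
morphism out of `T_i` are exactly the dots created by the paths through `T_i` that start at
`T_{i-1}` and `T_{i+1}`. -/
lemma counit_dot_braid1 (i : Inner N) (m l : Fin (N + 1)) (g : k[X]) :
    ((braidF i).obj l).dot (counit k i l) (braid1 i m l g) =
      (gen m).dot (entry (slot 0 l) (slot 0 m) g) (counit k i m) := by
  have hp := i.pos
  rcases i.trichotomy m with ⟨hm, hm'⟩ | rfl | ⟨hm, hm'⟩ <;>
  rcases i.trichotomy l with ⟨hl, hl'⟩ | rfl | ⟨hl, hl'⟩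
  all_goals
    try rw [braid1_of_ne i hm' hl', braidF_obj_of_ne i hl', counit_of_ne i hl', counit_of_ne i hm']
    try simp [dot_entry_entry]
  · rw [counit_mid, counit_of_ne i hm', braid1_to_mid i hm', i.toward_of_lt hm]
    have t : turn m (i.val - 1) i.val = 0 := by rw [turn_eq_iff]; omega
    simp [dot_entry_entry, dot_add_left, mul, t]
  · rw [counit_mid, counit_of_ne i hl', braid1_from_mid_of_lt i hl, braidF_obj_of_ne i hl']
    have t : turn (i.val - 1) i.val l = 1 := by rw [turn_eq_iff]; omega
    have t' : turn (i.val + 1) i.val l = 0 := by rw [turn_eq_iff]; omega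
    simp [dot_entry_entry, dot_add_right, mul, t, t']
  · rw [counit_mid, braid1_mid]
    have t : turn (i.val - 1) (i.val - 1) i.val = 0 := by rw [turn_eq_iff]; omega
    simp [dot_entry_entry, dot_add_right, dot_add_left, mul]
  · rw [counit_mid, counit_of_ne i hl', braid1_from_mid_of_gt i hl, braidF_obj_of_ne i hl']
    have t : turn (i.val - 1) i.val l = 0 := by rw [turn_eq_iff]; omega
    have t' : turn (i.val + 1) i.val l = 1 := by rw [turn_eq_iff]; omega
    simp [dot_entry_entry, dot_add_right, mul, t, t']
  · rw [counit_mid, counit_of_ne i hm', braid1_to_mid i hm', i.toward_of_gt hm]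
    have t : turn m (i.val + 1) i.val = 0 := by rw [turn_eq_iff]; omega
    simp [dot_entry_entry, dot_add_left, mul, t]

/-- This is the first functor equation: images of morphisms are closed. For a morphism from `T_i` to
another vertex, the two components composed with δ each carry one dot and cancel because of the sign
in δ. A morphism into `T_i` from another vertex lands in degree 0, where δ is zero. -/
lemma braidDelta_dot_braid1 (i : Inner N) (m l : Fin (N + 1)) (g : k[X]) :
    ((braidF i).obj l).dot ((braidF i).obj l).diff (braid1 i m l g) =
      ((braidF i).obj m).dot (braid1 i m l g) ((braidF i).obj m).diff := by
  have hp := i.pos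
  rcases i.trichotomy m with ⟨hm, hm'⟩ | rfl | ⟨hm, hm'⟩ <;>
  rcases i.trichotomy l with ⟨hl, hl'⟩ | rfl | ⟨hl, hl'⟩
  all_goals
    try rw [braidF_obj_of_ne i hl']
    try rw [braidF_obj_of_ne i hm']
    try simp
  · rw [braid1_to_mid i hm', braidDelta]
    simp [dot_entry_entry, dot_sub_left]
  · rw [braid1_from_mid_of_lt i hl, braidDelta]
    have t : turn i.val (i.val - 1) l = 0 := by rw [turn_eq_iff]; omega
    have t' : turn i.val (i.val + 1) l = 1 := by rw [turn_eq_iff]; omega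
    simp [dot_entry_entry, dot_add_left, dot_sub_right, mul, t, t']
  · rw [braid1_mid, braidDelta]
    simp [dot_entry_entry, dot_add_left, dot_sub_right, dot_sub_left, dot_add_right, mul]
  · rw [braid1_from_mid_of_gt i hl, braidDelta]
    have t : turn i.val (i.val - 1) l = 1 := by rw [turn_eq_iff]; omega
    have t' : turn i.val (i.val + 1) l = 0 := by rw [turn_eq_iff]; omega
    simp [dot_entry_entry, dot_add_left, dot_sub_right, mul, t, t']
  · rw [braid1_to_mid i hm', braidDelta]
    simp [dot_entry_entry, dot_sub_left]

end

/-! ### Multiplicativity of the braiding functor up to its second component -/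

section
variable {k : Type*} [Field k] {N : ℕ}

lemma counit_dot_of_ne (i : Inner N) (q : Fin (N + 1)) {r : Fin (N + 1)} (hr : r ≠ i.mid)
    (g : k[X]) : (gen r).dot (counit k i r) (braid1 i q r g) = braid1 i q r g := by
  rcases i.trichotomy q with ⟨-, hq⟩ | rfl | ⟨-, hq⟩
  · simp [counit_of_ne i hr, braid1_of_ne i hq hr, dot_entry_entry]
  · rcases i.trichotomy r with ⟨h, -⟩ | rfl | ⟨h, -⟩
    · simp [counit_of_ne i hr, braid1_from_mid_of_lt i h, dot_entry_entry, dot_add_right]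
    · exact absurd rfl hr
    · simp [counit_of_ne i hr, braid1_from_mid_of_gt i h, dot_entry_entry, dot_add_right]
  · simp [counit_of_ne i hr, braid1_of_ne i hq hr, dot_entry_entry]

/-- At a vertex other than `i` the counit is the identity, so strict naturality of the counit
reduces the claim to composition in the original category. -/
lemma braid1_dot_of_ne (i : Inner N) (p q : Fin (N + 1)) {r : Fin (N + 1)} (hr : r ≠ i.mid)
    (g f : k[X]) :
    ((braidF i).obj q).dot (braid1 i q r g) (braid1 i p q f) = braid1 i p r (mul p q r g f) := by
  have h1 := counit_dot_braid1 i q r g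
  have h2 := counit_dot_braid1 i p r (mul p q r g f)
  rw [braidF_obj_of_ne i hr, counit_dot_of_ne i _ hr] at h1 h2
  rw [h1, h2, dot_assoc, counit_dot_braid1, ← dot_assoc, dot_entry_entry]
  simp

lemma braid1_mid_dot (i : Inner N) (p : Fin (N + 1)) (g f : k[X]) :
    (braidObj i).dot (braid1 i i.mid i.mid g) (braid1 i p i.mid f) =
      braid1 i p i.mid (mul p i.val i.val g f) := by
  rcases i.trichotomy p with ⟨hp1, hp'⟩ | rfl | ⟨hp1, hp'⟩
  · rw [braid1_mid, braid1_to_mid i hp', braid1_to_mid i hp', i.toward_of_lt hp1]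
    simp [dot_entry_entry, dot_add_left, mul]
  · rw [braid1_mid, braid1_mid, braid1_mid]
    simp [dot_entry_entry, dot_add_left, dot_add_right, mul]
  · rw [braid1_mid, braid1_to_mid i hp', braid1_to_mid i hp', i.toward_of_gt hp1]
    simp [dot_entry_entry, dot_add_left, mul]

lemma braid2_mid_lt (i : Inner N) {q : Fin (N + 1)} (hq : (q : ℕ) < i.val) (g f : k[X]) :
    braid2 i i.mid q i.mid g f =
      entry (slot (-1) i.mid) (slot 0 i.right) (X ^ (i.val - q - 1) * g * f) := by
  have h0 : q ≠ i.mid := by rw [Ne, i.eq_mid]; omega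
  have h1 : ((i.val : ℤ) - (q : ℕ)).sign = 1 := Int.sign_eq_one_of_pos (by omega)
  have h2 : ((i.val : ℤ) - (q : ℕ)).natAbs = i.val - q := by omega
  simp [braid2, h0, h1, h2, i.lt_mid.2 hq]

lemma braid2_mid_gt (i : Inner N) {q : Fin (N + 1)} (hq : i.val < (q : ℕ)) (g f : k[X]) :
    braid2 i i.mid q i.mid g f =
      entry (slot (-1) i.mid) (slot 0 i.left) (-(X ^ (q - i.val - 1) * g * f)) := by
  have h0 : q ≠ i.mid := by rw [Ne, i.eq_mid]; omega
  have h3 : ¬ q < i.mid := by rw [i.lt_mid]; omega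
  have h1 : ((i.val : ℤ) - (q : ℕ)).sign = -1 := Int.sign_eq_neg_one_of_neg (by omega)
  have h2 : ((i.val : ℤ) - (q : ℕ)).natAbs = q - i.val := by omega
  simp [braid2, h0, h1, h2, h3]

lemma braid2_gt_lt (i : Inner N) {p q : Fin (N + 1)} (hp : i.val < (p : ℕ))
    (hq : (q : ℕ) < i.val) (g f : k[X]) : braid2 i p q i.mid g f =
      entry (slot (-1) i.mid) (slot 0 p) (X ^ (i.val - q - 1) * g * f) := by
  have h0 : q ≠ i.mid := by rw [Ne, i.eq_mid]; omega
  have h4 : p ≠ i.mid := by rw [Ne, i.eq_mid]; omega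
  have h1 : ((i.val : ℤ) - (q : ℕ)).sign = 1 := Int.sign_eq_one_of_pos (by omega)
  have h2 : ((i.val : ℤ) - (q : ℕ)).natAbs = i.val - q := by omega
  have h3 : ((i.val : ℤ) - (p : ℕ)) * ((i.val : ℤ) - (q : ℕ)) < 0 :=
    mul_neg_of_neg_of_pos (by omega) (by omega)
  simp [braid2, h0, h1, h2, h3, h4]

lemma braid2_lt_gt (i : Inner N) {p q : Fin (N + 1)} (hp : (p : ℕ) < i.val)
    (hq : i.val < (q : ℕ)) (g f : k[X]) : braid2 i p q i.mid g f =
      entry (slot (-1) i.mid) (slot 0 p) (-(X ^ (q - i.val - 1) * g * f)) := by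
  have h0 : q ≠ i.mid := by rw [Ne, i.eq_mid]; omega
  have h4 : p ≠ i.mid := by rw [Ne, i.eq_mid]; omega
  have h1 : ((i.val : ℤ) - (q : ℕ)).sign = -1 := Int.sign_eq_neg_one_of_neg (by omega)
  have h2 : ((i.val : ℤ) - (q : ℕ)).natAbs = q - i.val := by omega
  have h3 : ((i.val : ℤ) - (p : ℕ)) * ((i.val : ℤ) - (q : ℕ)) < 0 :=
    mul_neg_of_pos_of_neg (by omega) (by omega)
  simp [braid2, h0, h1, h2, h3, h4]

lemma braid2_same_side (i : Inner N) {p q : Fin (N + 1)} (hp : p ≠ i.mid)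
    (h : 0 ≤ ((i.val : ℤ) - (p : ℕ)) * ((i.val : ℤ) - (q : ℕ))) (g f : k[X]) :
    braid2 i p q i.mid g f = 0 := by
  simp [braid2, hp, not_lt.2 h]

/-- If `p` and `q` lie on opposite sides of `i`, the two terms on the right end in different
summands `T_{i-1}` and `T_{i+1}`, and their difference is in the image of δ. If they lie on the same
side, both sides are zero. For `p = i` the source is itself a complex, which is where precomposition
with δ enters. -/
lemma braid2_delta_to_mid (i : Inner N) (p : Fin (N + 1)) {q : Fin (N + 1)} (hq : q ≠ i.mid)
    (g f : k[X]) :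
    (braidObj i).dot (braidDelta i) (braid2 i p q i.mid g f)
      + ((braidF i).obj p).dot (braid2 i p q i.mid g f) ((braidF i).obj p).diff =
    (gen q).dot (braid1 i q i.mid g) (braid1 i p q f)
      - braid1 i p i.mid (mul p q i.val g f) := by
  have hi := i.pos
  rcases i.trichotomy p with ⟨hp, hp'⟩ | rfl | ⟨hp, hp'⟩ <;>
  rcases i.trichotomy q with ⟨hq', -⟩ | rfl | ⟨hq', -⟩
  all_goals try exact absurd rfl hq
  · rw [braid1_to_mid i hq, braid1_to_mid i hp', braid1_of_ne i hp' hq, i.toward_of_lt hp,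
      i.toward_of_lt hq', braid2_same_side i hp' (mul_nonneg (by omega) (by omega))]
    have t : turn p q (i.val - 1) = turn p q i.val := by
      have := two_mul_turn p q i.val
      rw [turn_eq_iff]; omega
    simp [dot_entry_entry, mul, t]
  · rw [braid1_to_mid i hq, braid1_to_mid i hp', braid1_of_ne i hp' hq, i.toward_of_lt hp,
      i.toward_of_gt hq', braid2_lt_gt i hp hq', braidF_obj_of_ne i hp']
    have t : turn p q (i.val + 1) = q - i.val - 1 := by rw [turn_eq_iff]; omega
    have t1 : turn p q i.val = q - i.val - 1 + 1 := by rw [turn_eq_iff]; omega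
    have t2 : turn p i.val (i.val - 1) = 1 := by rw [turn_eq_iff]; omega
    have t3 : turn p i.val (i.val + 1) = 0 := by rw [turn_eq_iff]; omega
    simp [dot_entry_entry, dot_sub_left, dot_neg_right, mul, t, t1, t2, t3, braidDelta,
      entry_neg, pow_succ]
    ring_nf
  · rw [braid1_to_mid i hq, braid1_mid, braid1_from_mid_of_lt i hq', i.toward_of_lt hq',
      braid2_mid_lt i hq', braidF_obj_mid]
    have t : turn (i.val - 1) q (i.val - 1) = i.val - q - 1 := by rw [turn_eq_iff]; omega
    have t0 : turn (i.val + 1) q (i.val - 1) = i.val - q - 1 := by rw [turn_eq_iff]; omega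
    have t1 : turn i.val q i.val = i.val - q - 1 + 1 := by rw [turn_eq_iff]; omega
    have t2 : turn (i.val + 1) i.val (i.val - 1) = 0 := by rw [turn_eq_iff]; omega
    have t3 : turn (i.val + 1) i.val (i.val + 1) = 1 := by rw [turn_eq_iff]; omega
    have t4 : turn i.val (i.val + 1) i.val = 1 := by rw [turn_eq_iff]; omega
    simp [dot_entry_entry, dot_sub_left, dot_sub_right, dot_add_right, mul, t, t0, t1, t2, t3, t4,
      braidDelta, pow_succ]
    ring_nf
    abel
  · rw [braid1_to_mid i hq, braid1_mid, braid1_from_mid_of_gt i hq', i.toward_of_gt hq',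
      braid2_mid_gt i hq', braidF_obj_mid]
    have t : turn (i.val - 1) q (i.val + 1) = q - i.val - 1 := by rw [turn_eq_iff]; omega
    have t0 : turn (i.val + 1) q (i.val + 1) = q - i.val - 1 := by rw [turn_eq_iff]; omega
    have t1 : turn i.val q i.val = q - i.val - 1 + 1 := by rw [turn_eq_iff]; omega
    have t2 : turn (i.val - 1) i.val (i.val - 1) = 1 := by rw [turn_eq_iff]; omega
    have t3 : turn (i.val - 1) i.val (i.val + 1) = 0 := by rw [turn_eq_iff]; omega
    have t4 : turn i.val (i.val - 1) i.val = 1 := by rw [turn_eq_iff]; omega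
    simp [dot_entry_entry, dot_sub_left, dot_sub_right, dot_add_right, mul, t, t0, t1, t2, t3, t4,
      braidDelta, pow_succ, entry_neg, dot_neg_left, dot_neg_right]
    ring_nf
    abel
  · rw [braid1_to_mid i hq, braid1_to_mid i hp', braid1_of_ne i hp' hq, i.toward_of_gt hp,
      i.toward_of_lt hq', braid2_gt_lt i hp hq', braidF_obj_of_ne i hp']
    have t : turn p q (i.val - 1) = i.val - q - 1 := by rw [turn_eq_iff]; omega
    have t1 : turn p q i.val = i.val - q - 1 + 1 := by rw [turn_eq_iff]; omega
    have t2 : turn p i.val (i.val - 1) = 0 := by rw [turn_eq_iff]; omega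
    have t3 : turn p i.val (i.val + 1) = 1 := by rw [turn_eq_iff]; omega
    simp [dot_entry_entry, dot_sub_left, mul, t, t1, t2, t3, braidDelta, pow_succ]
    ring_nf
  · rw [braid1_to_mid i hq, braid1_to_mid i hp', braid1_of_ne i hp' hq, i.toward_of_gt hp,
      i.toward_of_gt hq', braid2_same_side i hp' (mul_nonneg_of_nonpos_of_nonpos
      (by omega) (by omega))]
    have t : turn p q (i.val + 1) = turn p q i.val := by
      have := two_mul_turn p q i.val
      rw [turn_eq_iff]; omega
    simp [dot_entry_entry, mul, t]

/-- The second `A_∞`-functor equation of `β_i⁻`. -/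
lemma braid2_delta (i : Inner N) (p q r : Fin (N + 1)) (g f : k[X]) :
    ((braidF i).obj r).dot ((braidF i).obj r).diff (braid2 i p q r g f)
      + ((braidF i).obj p).dot (braid2 i p q r g f) ((braidF i).obj p).diff =
    ((braidF i).obj q).dot (braid1 i q r g) (braid1 i p q f) - braid1 i p r (mul p q r g f) := by
  by_cases hr : r = i.mid
  · subst hr
    by_cases hq : q = i.mid
    · subst hq
      simp [braid2_of_ne, braid1_mid_dot]
    · simpa [braidF_obj_of_ne i hq] using braid2_delta_to_mid i p hq g f
  · rw [braid1_dot_of_ne i p q hr, braid2_of_ne i (Or.inl hr)]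
    simp

end

section
variable {k : Type*} [Field k] {N : ℕ}

/-! ### Graded pieces of morphism spaces -/

lemma entry_mem {Y Z : Tw k N} {g : ℤ} {b a : Slot N} (hb : b ∈ Z.supp) (ha : a ∈ Y.supp)
    (h : b.deg = a.deg + g) (f : k[X]) : entry b a f ∈ Y.hom Z g := by
  intro b' a' h'
  rw [entry_apply] at h'
  have := (ite_ne_right_iff.1 h').1
  rw [← this.1, ← this.2]
  exact ⟨hb, ha, h⟩

lemma dot_mem {W Y Z : Tw k N} {g g' : ℤ} {f₂ f₁ : Mat k N} (h₂ : f₂ ∈ Y.hom Z g')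
    (h₁ : f₁ ∈ W.hom Y g) : Y.dot f₂ f₁ ∈ W.hom Z (g + g') := by
  intro c a h
  obtain ⟨b, -, hb⟩ := Finset.exists_ne_zero_of_sum_ne_zero h
  have e1 : f₂ c b ≠ 0 := fun e => hb (by rw [e, mul_zero_left])
  have e2 : f₁ b a ≠ 0 := fun e => hb (by rw [e, mul_zero_right])
  have h3 := h₂ c b e1
  have h4 := h₁ b a e2
  exact ⟨h3.1, h4.2.1, by rw [h3.2.2, h4.2.2]; ring⟩

lemma diff_mem (Y : Tw k N) : Y.diff ∈ Y.hom Y 1 := fun b a h => Y.diff_deg b a h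

lemma braid1_mem (i : Inner N) (p q : Fin (N + 1)) (f : k[X]) :
    braid1 i p q f ∈ ((braidF i).obj p).hom ((braidF i).obj q) 0 := by
  rcases i.trichotomy p with ⟨hp, hp'⟩ | rfl | ⟨hp, hp'⟩ <;>
  rcases i.trichotomy q with ⟨hq, hq'⟩ | rfl | ⟨hq, hq'⟩
  all_goals
    try rw [braid1_of_ne i hp' hq']
    try rw [braid1_to_mid i hp']
    try rw [i.toward_of_lt hp]
    try rw [i.toward_of_gt hp]
    try rw [braid1_from_mid_of_lt i hq]
    try rw [braid1_from_mid_of_gt i hq]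
    try rw [braid1_mid]
  all_goals
    try rw [braidF_obj_of_ne i hp']
    try rw [braidF_obj_of_ne i hq']
    try rw [braidF_obj_mid]
    repeat' apply Submodule.add_mem
    all_goals apply entry_mem <;> simp

lemma braid2_mem (i : Inner N) (p q r : Fin (N + 1)) (g f : k[X]) :
    braid2 i p q r g f ∈ ((braidF i).obj p).hom ((braidF i).obj r) (-1) := by
  by_cases h : r ≠ i.mid ∨ q = i.mid
  · rw [braid2_of_ne i h]; exact Submodule.zero_mem _
  obtain ⟨rfl, hq⟩ : r = i.mid ∧ q ≠ i.mid := by simpa using h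
  by_cases hp : p = i.mid
  · subst hp
    rcases i.trichotomy q with ⟨hq', -⟩ | rfl | ⟨hq', -⟩
    · rw [braid2_mid_lt i hq']; apply entry_mem <;> simp
    · exact absurd rfl hq
    · rw [braid2_mid_gt i hq']; apply entry_mem <;> simp
  · rw [braidF_obj_mid, braidF_obj_of_ne i hp]
    simp only [braid2, h, hp, if_false]
    split_ifs
    · apply entry_mem <;> simp
    · exact Submodule.zero_mem _

/-- The morphisms `T_p → β_i⁻ T_l` of degree `g`. -/
abbrev BHom (k : Type*) [Field k] (i : Inner N) (p l : Fin (N + 1)) (g : ℤ) :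
    Submodule k (Mat k N) := (gen p).hom ((braidF i).obj l) g

/-- Morphisms live only in degree 0 and, when the target is the braided `T_i`, in degree -1. This is
why transformations of degree `g` have components only in lengths `g` and `g + 1`. -/
lemma eq_zero_of_degree {i : Inner N} {p l : Fin (N + 1)} {g : ℤ} {M : Mat k N}
    (hM : M ∈ BHom k i p l g) (h0 : g ≠ 0) (h1 : l = i.mid → g ≠ -1) : M = 0 := by
  funext b a
  by_contra hc
  obtain ⟨hb, ha, hd⟩ := hM b a hc
  simp only [gen_supp, Finset.mem_singleton] at ha
  subst ha
  by_cases hl : l = i.mid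
  · subst hl
    simp only [braidF_obj_mid, braidObj_supp, Finset.mem_insert, Finset.mem_singleton] at hb
    rcases hb with rfl | rfl | rfl <;> simp at hd
    · exact h1 rfl hd.symm
    · exact h0 hd.symm
    · exact h0 hd.symm
  · simp only [braidF_obj_of_ne i hl, gen_supp, Finset.mem_singleton] at hb
    subst hb
    simp at hd
    exact h0 hd.symm

lemma eq_entry_of_ne {i : Inner N} {p l : Fin (N + 1)} (hl : l ≠ i.mid) {M : Mat k N}
    (hM : M ∈ BHom k i p l 0) : M = entry (slot 0 l) (slot 0 p) (M (slot 0 l) (slot 0 p)) := by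
  funext b a
  rw [entry_apply]
  split_ifs with h
  · rw [← h.1, ← h.2]
  · by_contra hc
    obtain ⟨hb, ha, -⟩ := hM b a hc
    simp only [braidF_obj_of_ne i hl, gen_supp, Finset.mem_singleton] at hb ha
    exact h ⟨hb.symm, ha.symm⟩

lemma eq_entries_of_mid {i : Inner N} {p : Fin (N + 1)} {M : Mat k N}
    (hM : M ∈ BHom k i p i.mid 0) :
    M = entry (slot 0 i.left) (slot 0 p) (M (slot 0 i.left) (slot 0 p))
      + entry (slot 0 i.right) (slot 0 p) (M (slot 0 i.right) (slot 0 p)) := by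
  funext b a
  rw [Matrix.add_apply, entry_apply, entry_apply]
  by_cases hc : M b a = 0
  · split_ifs with h1 h2 h2
    · have := h1.1.trans h2.1.symm
      simp at this
    · rw [h1.1, h1.2, hc, add_zero]
    · rw [h2.1, h2.2, hc, zero_add]
    · rw [hc, add_zero]
  · obtain ⟨hb, ha, hd⟩ := hM b a hc
    simp only [braidF_obj_mid, braidObj_supp, gen_supp, Finset.mem_insert,
      Finset.mem_singleton] at hb ha
    subst ha
    rcases hb with rfl | rfl | rfl <;> simp at hd ⊢

lemma eq_entry_of_neg_one {i : Inner N} {p : Fin (N + 1)} {M : Mat k N}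
    (hM : M ∈ BHom k i p i.mid (-1)) :
    M = entry (slot (-1) i.mid) (slot 0 p) (M (slot (-1) i.mid) (slot 0 p)) := by
  funext b a
  rw [entry_apply]
  split_ifs with h
  · rw [← h.1, ← h.2]
  · by_contra hc
    obtain ⟨hb, ha, hd⟩ := hM b a hc
    simp only [braidF_obj_mid, braidObj_supp, gen_supp, Finset.mem_insert,
      Finset.mem_singleton] at hb ha
    subst ha
    rcases hb with rfl | rfl | rfl <;> simp at hd h

/-! ### The short exact sequence `0 → Hom⁻¹(T_p, β_i⁻ T_l) → Hom⁰(T_p, β_i⁻ T_l) → 𝔅_i⁻(p, l) → 0` -/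

lemma turn_left_of_le (i : Inner N) {p : ℕ} (h : p < i.val) : turn p (i.val - 1) i.val = 0 := by
  rw [turn_eq_iff]; omega

lemma turn_left_of_ge (i : Inner N) {p : ℕ} (h : i.val ≤ p) : turn p (i.val - 1) i.val = 1 := by
  have := i.pos
  rw [turn_eq_iff]; omega

lemma turn_right_of_le (i : Inner N) {p : ℕ} (h : p ≤ i.val) : turn p (i.val + 1) i.val = 1 := by
  rw [turn_eq_iff]; omega

lemma turn_right_of_ge (i : Inner N) {p : ℕ} (h : i.val < p) : turn p (i.val + 1) i.val = 0 := by
  rw [turn_eq_iff]; omega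

/-- Composition with `counit`, as a map from degree zero morphisms `T_p → β_i⁻ T_l` to the
diagonal bimodule. -/
def proj (i : Inner N) (p l : Fin (N + 1)) : Mat k N →ₗ[k] k[X] where
  toFun M := ((braidF i).obj l).dot (counit k i l) M (slot 0 l) (slot 0 p)
  map_add' M M' := by rw [dot_add_right, Matrix.add_apply]
  map_smul' c M := by rw [dot_smul_right, Matrix.smul_apply, RingHom.id_apply]

lemma proj_apply (i : Inner N) (p l : Fin (N + 1)) (M : Mat k N) :
    proj i p l M = ((braidF i).obj l).dot (counit k i l) M (slot 0 l) (slot 0 p) := rfl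

lemma counit_mem (i : Inner N) (l : Fin (N + 1)) :
    counit k i l ∈ ((braidF i).obj l).hom (gen l) 0 := by
  by_cases h : l = i.mid
  · subst h
    rw [counit_mid, braidF_obj_mid]
    apply Submodule.add_mem <;> apply entry_mem <;> simp
  · rw [counit_of_ne i h, braidF_obj_of_ne i h]
    apply entry_mem <;> simp

lemma counit_dot_eq {i : Inner N} {p l : Fin (N + 1)} {M : Mat k N} (hM : M ∈ BHom k i p l 0) :
    ((braidF i).obj l).dot (counit k i l) M = entry (slot 0 l) (slot 0 p) (proj i p l M) := by
  have h := dot_mem (counit_mem i l) hM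
  funext b a
  rw [entry_apply, proj_apply]
  split_ifs with hh
  · rw [← hh.1, ← hh.2]
  · by_contra hc
    obtain ⟨hb, ha, -⟩ := h b a hc
    simp only [gen_supp, Finset.mem_singleton] at hb ha
    exact hh ⟨hb.symm, ha.symm⟩

lemma proj_braid1 {i : Inner N} {p q : Fin (N + 1)} (r : Fin (N + 1)) (g : k[X]) {M : Mat k N}
    (hM : M ∈ BHom k i p q 0) :
    proj i p r (((braidF i).obj q).dot (braid1 i q r g) M) = mul p q r g (proj i p q M) := by
  rw [proj_apply, ← dot_assoc, counit_dot_braid1, dot_assoc, counit_dot_eq hM, dot_entry_entry]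
  simp [entry_apply]

lemma proj_comp {i : Inner N} (p : Fin (N + 1)) {q r : Fin (N + 1)} (f : k[X]) {M : Mat k N}
    (hM : M ∈ BHom k i q r 0) :
    proj i p r ((gen q).dot M (entry (slot 0 q) (slot 0 p) f)) = mul p q r (proj i q r M) f := by
  rw [proj_apply, ← dot_assoc, counit_dot_eq hM, dot_entry_entry]
  simp [entry_apply]

/-- Both loops at `T_i`, through `T_{i-1}` and `T_{i+1}`, equal `s_i`, and they enter with opposite
signs. -/
lemma counit_dot_delta (i : Inner N) (l : Fin (N + 1)) :
    ((braidF i).obj l).dot (counit k i l) ((braidF i).obj l).diff = 0 := by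
  by_cases h : l = i.mid
  · subst h
    have t : turn i.val (i.val - 1) i.val = 1 := turn_left_of_ge i le_rfl
    have t' : turn i.val (i.val + 1) i.val = 1 := turn_right_of_le i le_rfl
    simp [counit_mid, braidDelta, dot_entry_entry, dot_add_left, dot_sub_right, mul, t, t']
  · simp [braidF_obj_of_ne i h]

lemma proj_delta (i : Inner N) (p l : Fin (N + 1)) (M : Mat k N) :
    proj i p l (((braidF i).obj l).dot ((braidF i).obj l).diff M) = 0 := by
  rw [proj_apply, ← dot_assoc, counit_dot_delta, dot_zero_left]; rfl

lemma proj_of_ne {i : Inner N} (p : Fin (N + 1)) {l : Fin (N + 1)} (h : l ≠ i.mid) (f : k[X]) :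
    proj i p l (entry (slot 0 l) (slot 0 p) f) = f := by
  rw [proj_apply, counit_of_ne i h, braidF_obj_of_ne i h, dot_entry_entry]
  simp [entry_apply]

lemma proj_left (i : Inner N) (p : Fin (N + 1)) (f : k[X]) :
    proj i p i.mid (entry (slot 0 i.left) (slot 0 p) f) = X ^ turn p (i.val - 1) i.val * f := by
  rw [proj_apply, counit_mid, braidF_obj_mid, dot_add_left, dot_entry_entry, dot_entry_entry]
  simp [entry_apply, mul]

lemma proj_right (i : Inner N) (p : Fin (N + 1)) (f : k[X]) :
    proj i p i.mid (entry (slot 0 i.right) (slot 0 p) f) = X ^ turn p (i.val + 1) i.val * f := by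
  rw [proj_apply, counit_mid, braidF_obj_mid, dot_add_left, dot_entry_entry, dot_entry_entry]
  simp [entry_apply, mul]

lemma proj_mid_eq {i : Inner N} {p : Fin (N + 1)} {M : Mat k N} (hM : M ∈ BHom k i p i.mid 0) :
    proj i p i.mid M = X ^ turn p (i.val - 1) i.val * M (slot 0 i.left) (slot 0 p)
      + X ^ turn p (i.val + 1) i.val * M (slot 0 i.right) (slot 0 p) := by
  conv_lhs => rw [eq_entries_of_mid hM]
  rw [map_add, proj_left, proj_right]

/-- An endomorphism of `T_i` that factors through a neighbour carries at least one dot, so `e_i` is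
never reached. -/
lemma proj_mem_bimod {i : Inner N} {p l : Fin (N + 1)} {M : Mat k N} (hM : M ∈ BHom k i p l 0) :
    proj i p l M ∈ bimod (k := k) i p l := by
  rintro rfl rfl
  rw [proj_mid_eq hM, i.mid_val, turn_left_of_ge i le_rfl, turn_right_of_le i le_rfl]
  simp

lemma divX_smul' (c : k) (f : k[X]) : divX (c • f) = c • divX f := by
  ext; simp [coeff_divX]

/-- A linear right inverse of `proj` on `𝔅_i⁻`. -/
def projSection (k : Type*) [Field k] (i : Inner N) (p l : Fin (N + 1)) : k[X] →ₗ[k] Mat k N where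
  toFun f :=
    if l ≠ i.mid then entry (slot 0 l) (slot 0 p) f
    else if p ≠ i.mid then entry (slot 0 (i.toward p)) (slot 0 p) f
    -- The return from `T_{i-1}` to `T_i` supplies the dot removed by `divX`. The left summand is an
    -- arbitrary choice that avoids dividing by 2.
    else entry (slot 0 i.left) (slot 0 p) (divX f)
  map_add' f g := by
    split_ifs <;> simp only [entry_add, divX_add]
  map_smul' c f := by
    split_ifs <;> simp only [divX_smul', entry_smul, RingHom.id_apply]

lemma projSection_mem (i : Inner N) (p l : Fin (N + 1)) (f : k[X]) :
    projSection k i p l f ∈ BHom k i p l 0 := by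
  by_cases hl : l = i.mid
  · subst hl
    unfold BHom
    rw [braidF_obj_mid]
    rcases i.trichotomy p with ⟨hp, hp'⟩ | rfl | ⟨hp, hp'⟩
    · simp only [projSection, LinearMap.coe_mk, AddHom.coe_mk, ne_eq, not_true_eq_false, not_false_eq_true,
        if_true, if_false, hp', i.toward_of_lt hp]
      apply entry_mem <;> simp
    · simp only [projSection, LinearMap.coe_mk, AddHom.coe_mk, ne_eq, not_true_eq_false, if_false]
      apply entry_mem <;> simp
    · simp only [projSection, LinearMap.coe_mk, AddHom.coe_mk, ne_eq, not_true_eq_false, not_false_eq_true,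
        if_true, if_false, hp', i.toward_of_gt hp]
      apply entry_mem <;> simp
  · simp only [projSection, LinearMap.coe_mk, AddHom.coe_mk, hl, ne_eq, not_false_eq_true, if_true,
      BHom, braidF_obj_of_ne i hl]
    apply entry_mem <;> simp

lemma X_mul_divX_of_coeff_zero {f : k[X]} (h : f.coeff 0 = 0) : X * divX f = f := by
  have := X_mul_divX_add f
  rwa [h, C_0, add_zero] at this

lemma proj_projSection (i : Inner N) (p l : Fin (N + 1)) {f : k[X]}
    (hf : f ∈ bimod (k := k) i p l) : proj i p l (projSection k i p l f) = f := by
  by_cases hl : l = i.mid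
  · subst hl
    rcases i.trichotomy p with ⟨hp, hp'⟩ | rfl | ⟨hp, hp'⟩
    · simp [projSection, hp', i.toward_of_lt hp, proj_left, turn_left_of_le i hp]
    · simp [projSection, proj_left, turn_left_of_ge i le_rfl,
        X_mul_divX_of_coeff_zero (hf rfl rfl)]
    · simp [projSection, hp', i.toward_of_gt hp, proj_right, turn_right_of_ge i hp]
  · simp [projSection, hl, proj_of_ne]

/-- A linear inverse of `δ` on the kernel of `proj`. -/
def deltaInv (k : Type*) [Field k] (i : Inner N) (p l : Fin (N + 1)) :
    Mat k N →ₗ[k] Mat k N where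
  toFun M := if l ≠ i.mid then 0 else entry (slot (-1) i.mid) (slot 0 p)
    -- One reads off the component of δ along which the path through `T_i` makes no turn. There δ
    -- multiplies by a sign only, and no division by `X` is needed.
    (if p < i.mid then -M (slot 0 i.right) (slot 0 p) else M (slot 0 i.left) (slot 0 p))
  map_add' M M' := by
    split_ifs <;> simp only [Matrix.add_apply, neg_add, entry_add, add_zero]
  map_smul' c M := by
    split_ifs <;> simp only [Matrix.smul_apply, ← smul_neg, entry_smul, RingHom.id_apply, smul_zero]

lemma deltaInv_of_ne (i : Inner N) (p : Fin (N + 1)) {l : Fin (N + 1)} (h : l ≠ i.mid)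
    (M : Mat k N) : deltaInv k i p l M = 0 := by
  simp [deltaInv, h]

lemma deltaInv_mid (i : Inner N) (p : Fin (N + 1)) (M : Mat k N) :
    deltaInv k i p i.mid M = entry (slot (-1) i.mid) (slot 0 p)
      (if p < i.mid then -M (slot 0 i.right) (slot 0 p) else M (slot 0 i.left) (slot 0 p)) := by
  simp [deltaInv]

lemma deltaInv_mem (i : Inner N) (p l : Fin (N + 1)) (M : Mat k N) :
    deltaInv k i p l M ∈ BHom k i p l (-1) := by
  by_cases hl : l = i.mid
  · subst hl
    unfold BHom
    rw [deltaInv_mid, braidF_obj_mid]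
    apply entry_mem <;> simp
  · rw [deltaInv_of_ne i p hl]; exact Submodule.zero_mem _

lemma delta_dot_entry (i : Inner N) (p : Fin (N + 1)) (f : k[X]) :
    (braidObj i).dot (braidDelta i) (entry (slot (-1) i.mid) (slot 0 p) f) =
      entry (slot 0 i.left) (slot 0 p) (X ^ turn p i.val (i.val - 1) * f)
      - entry (slot 0 i.right) (slot 0 p) (X ^ turn p i.val (i.val + 1) * f) := by
  simp [braidDelta, dot_sub_left, dot_entry_entry, mul]

/-- This is exactness in the middle. With components `x` and `y`, vanishing of `proj` says `x + X y
= 0`, `X (x + y) = 0` or `X x + y = 0`, according to whether `p` lies below, at or above `i`. Each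
case exhibits the pair as a multiple of δ. -/
lemma delta_deltaInv {i : Inner N} {p l : Fin (N + 1)} {M : Mat k N} (hM : M ∈ BHom k i p l 0)
    (h : proj i p l M = 0) :
    ((braidF i).obj l).dot ((braidF i).obj l).diff (deltaInv k i p l M) = M := by
  have hi := i.pos
  by_cases hl : l = i.mid
  · subst hl
    rw [proj_mid_eq hM] at h
    conv_rhs => rw [eq_entries_of_mid hM]
    rw [deltaInv_mid, braidF_obj_mid, braidObj_diff, delta_dot_entry]
    generalize M (slot 0 i.left) (slot 0 p) = x at h ⊢
    generalize M (slot 0 i.right) (slot 0 p) = y at h ⊢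
    rcases i.trichotomy p with ⟨hp, hp'⟩ | rfl | ⟨hp, hp'⟩
    · have t : turn p i.val (i.val - 1) = 1 := by rw [turn_eq_iff]; omega
      have t' : turn p i.val (i.val + 1) = 0 := by rw [turn_eq_iff]; omega
      rw [turn_left_of_le i hp, turn_right_of_le i hp.le, pow_zero, pow_one, one_mul] at h
      rw [if_pos (i.lt_mid.2 hp), t, t', eq_neg_of_add_eq_zero_left h]
      simp [entry_neg]
    · rw [i.mid_val, turn_left_of_ge i le_rfl, turn_right_of_le i le_rfl, pow_one, ← mul_add] at h
      have h' := (mul_eq_zero.1 h).resolve_left X_ne_zero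
      rw [if_neg (lt_irrefl _), eq_neg_of_add_eq_zero_left h']
      simp [entry_neg]
    · have t : turn p i.val (i.val - 1) = 0 := by rw [turn_eq_iff]; omega
      have t' : turn p i.val (i.val + 1) = 1 := by rw [turn_eq_iff]; omega
      rw [turn_left_of_ge i hp.le, turn_right_of_ge i hp, pow_zero, pow_one, one_mul] at h
      rw [if_neg (by rw [i.lt_mid]; omega), t, t', eq_neg_of_add_eq_zero_right h]
      simp [entry_neg, sub_eq_add_neg]
  · rw [eq_entry_of_ne hl hM, proj_of_ne p hl] at h
    rw [eq_entry_of_ne hl hM, h]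
    simp [braidF_obj_of_ne i hl]

/-- The left component of δ is multiplication by a power of `X`, hence injective. This gives
uniqueness of η³ and allows identities in degree -1 to be checked after applying δ. -/
lemma eq_zero_of_delta_eq_zero {i : Inner N} {p l : Fin (N + 1)} {M : Mat k N}
    (hM : M ∈ BHom k i p l (-1))
    (h : ((braidF i).obj l).dot ((braidF i).obj l).diff M = 0) : M = 0 := by
  by_cases hl : l = i.mid
  · subst hl
    rw [eq_entry_of_neg_one hM] at h ⊢
    rw [braidF_obj_mid, braidObj_diff, delta_dot_entry] at h
    have := congrFun (congrFun h (slot 0 i.left)) (slot 0 p)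
    simp [entry_apply] at this
    rw [this, entry_zero]
  · exact eq_zero_of_degree hM (by decide) fun e => absurd e hl

lemma delta_dot_eq_zero {i : Inner N} {p l : Fin (N + 1)} {M : Mat k N} (hM : M ∈ BHom k i p l 0) :
    ((braidF i).obj l).dot ((braidF i).obj l).diff M = 0 :=
  eq_zero_of_degree (dot_mem (diff_mem _) hM) (by decide) fun _ => by decide

end

section
variable {k : Type*} [Field k] {N : ℕ}

/-! ### The differential on pre-natural transformations in low degrees -/

lemma sign_even {z : ℤ} (h : Even z) : sign k z = 1 := by simp [sign, Int.negOnePow_even z h]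

lemma sign_odd {z : ℤ} (h : Odd z) : sign k z = -1 := by simp [sign, Int.negOnePow_odd z h]

lemma mu1_gen (p : Fin (N + 1)) (Z : Tw k N) (g : ℤ) (f : Mat k N) :
    mu1 (gen p) Z g f = sign k g • Z.dot Z.diff f := by
  simp [mu1]

lemma braidF_map_mem (i : Inner N) (r : ℕ) (hr : r ≠ 0) (v : Fin (r + 1) → Fin (N + 1))
    (a : Fin r → k[X]) : (braidF i).map r v a ∈
      ((braidF i).obj (v 0)).hom ((braidF i).obj (v (Fin.last r))) (1 - r) := by
  match r, v, a with
  | 0, _, _ => exact absurd rfl hr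
  | 1, v, a => exact braid1_mem i _ _ _
  | 2, v, a => exact braid2_mem i _ _ _ _ _
  | r + 3, v, a => exact Submodule.zero_mem _

lemma idF_map_mem (r : ℕ) (hr : r ≠ 0) (v : Fin (r + 1) → Fin (N + 1))
    (a : Fin r → k[X]) : (idF (k := k)).map r v a ∈
      (gen (v 0)).hom (gen (v (Fin.last r))) (1 - r) := by
  match r, v, a with
  | 0, _, _ => exact absurd rfl hr
  | 1, v, a =>
    exact entry_mem (b := slot 0 (v 1)) (a := slot 0 (v 0)) (by simp [Fin.last]) (by simp)
      (by simp) (a 0)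
  | r + 2, v, a => exact Submodule.zero_mem _

lemma insertMul_mem {M : Type*} [AddCommGroup M] [Module k M] (c : ℕ → k) (η : Ops k N M)
    (S : ℕ → Fin (N + 1) → Fin (N + 1) → Submodule k M)
    (h : ∀ d v a, η d v a ∈ S d (v 0) (v (Fin.last d))) (d : ℕ) (v : Fin (d + 2) → Fin (N + 1))
    (a : Fin (d + 1) → k[X]) :
    insertMul c η (d + 1) v a ∈ S d (v 0) (v (Fin.last (d + 1))) := by
  refine Submodule.sum_mem _ fun n _ => Submodule.smul_mem _ _ ?_
  convert h d (dropVtx n v) (mulAt n v a) using 2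
  · unfold dropVtx
    congr 1
  · unfold dropVtx
    congr 1
    symm
    exact Fin.succAbove_ne_last_last (Fin.castSucc_lt_last _).ne

/-- Only degrees and end points are tracked here, not multilinearity: the vanishing arguments that
use this need nothing more. -/
lemma natDiff_mem_hom (i : Inner N) (g : ℤ) {η : Ops k N (Mat k N)}
    (h : ∀ (d : ℕ) v a, η d v a ∈ BHom k i (v 0) (v (Fin.last d)) (g - d)) (d : ℕ)
    (v : Fin (d + 1) → Fin (N + 1)) (a : Fin d → k[X]) :
    natDiff idF (braidF i) g η d v a ∈ BHom k i (v 0) (v (Fin.last d)) (g + 1 - d) := by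
  change natDiffFun idF (braidF i) g η d v a ∈ _
  unfold natDiffFun
  refine Submodule.sub_mem _ (Submodule.add_mem _ (Submodule.add_mem _ ?_ ?_) ?_) ?_
  · change mu1 (gen (v 0)) _ _ _ ∈ _
    rw [mu1_gen]
    have := Submodule.smul_mem _ (sign k (g - d)) (dot_mem (diff_mem _) (h d v a))
    rwa [show g - d + 1 = g + 1 - d by ring] at this
  · refine Submodule.sum_mem _ fun s _ => Submodule.smul_mem _ _ ?_
    have hs := s.isLt
    have h1 := braidF_map_mem (k := k) i (d - s) (by omega)
      (upp (d := d + 1) s (d - s + 1) (by omega) v) (upp s (d - s) (by omega) a)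
    have h2 := h s (low (d := d + 1) (s + 1) (by omega) v) (low s (by omega) a)
    have h3 := dot_mem h1 h2
    have e : g - (s : ℕ) + (1 - ((d - s : ℕ) : ℤ)) = g + 1 - d := by omega
    have e' : upp (d := d + 1) s (d - s + 1) (by omega) v (Fin.last _) = v (Fin.last d) := by
      unfold upp; congr 1; ext; simp; try omega
    rw [e, e'] at h3
    exact h3
  · refine Submodule.sum_mem _ fun s _ => Submodule.smul_mem _ _ (Submodule.smul_mem _ _ ?_)
    have hs := s.isLt
    have h1 := idF_map_mem (k := k) (s + 1) (by omega)
      (low (d := d + 1) (s + 1 + 1) (by omega) v) (low (s + 1) (by omega) a)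
    have h2 := h (d - (s + 1)) (upp (d := d + 1) (s + 1) (d - (s + 1) + 1) (by omega) v)
      (upp (s + 1) (d - (s + 1)) (by omega) a)
    have h3 := dot_mem h2 h1
    have e : (1 - ((s + 1 : ℕ) : ℤ)) + (g - ((d - (s + 1) : ℕ) : ℤ)) = g + 1 - d := by omega
    have e' : upp (d := d + 1) (s + 1) (d - (s + 1) + 1) (by omega) v (Fin.last _)
        = v (Fin.last d) := by
      unfold upp; congr 1; ext; simp; try omega
    rw [e, e'] at h3
    exact h3
  · match d, v, a with
    | 0, v, a => exact Submodule.zero_mem _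
    | d + 1, v, a =>
      have := insertMul_mem (fun n => sign k (-n + g - 1)) η (fun d p q => BHom k i p q (g - d))
        h d v a
      push_cast
      rwa [show g + 1 - ((d : ℤ) + 1) = g - d by ring]

lemma vec1 {A : Type*} (v : Fin 1 → A) : v = ![v 0] := by
  funext n; fin_cases n; rfl

lemma vec2 {A : Type*} (v : Fin 2 → A) : v = ![v 0, v 1] := by
  funext n; fin_cases n <;> rfl

lemma vec3 {A : Type*} (v : Fin 3 → A) : v = ![v 0, v 1, v 2] := by
  funext n; fin_cases n <;> rfl

lemma vec4 {A : Type*} (v : Fin 4 → A) : v = ![v 0, v 1, v 2, v 3] := by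
  funext n; fin_cases n <;> rfl

lemma insertMul_two {M : Type*} [AddCommGroup M] [Module k M] (c : ℕ → k) (η : Ops k N M)
    (v : Fin 3 → Fin (N + 1)) (a : Fin 2 → k[X]) :
    insertMul c η 2 v a = c 0 • η 1 ![v 0, v 2] ![mul (v 0) (v 1) (v 2) (a 1) (a 0)] := by
  change ∑ n : Fin 1, _ = _
  rw [Fin.sum_univ_one]
  congr 2
  · rw [vec2 (dropVtx _ _)]; rfl
  · funext n; fin_cases n; rfl

lemma insertMul_three {M : Type*} [AddCommGroup M] [Module k M] (c : ℕ → k) (η : Ops k N M)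
    (v : Fin 4 → Fin (N + 1)) (a : Fin 3 → k[X]) :
    insertMul c η 3 v a =
      c 0 • η 2 ![v 0, v 2, v 3] ![mul (v 0) (v 1) (v 2) (a 1) (a 0), a 2]
      + c 1 • η 2 ![v 0, v 1, v 3] ![a 0, mul (v 1) (v 2) (v 3) (a 2) (a 1)] := by
  change ∑ n : Fin 2, _ = _
  rw [Fin.sum_univ_two]
  congr 3
  · rw [vec3 (dropVtx _ _)]; rfl
  · rw [vec2 (mulAt _ _ _)]; rfl
  · rw [vec3 (dropVtx _ _)]; rfl
  · rw [vec2 (mulAt _ _ _)]; rfl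

lemma insertMul_four {M : Type*} [AddCommGroup M] [Module k M] (c : ℕ → k) (η : Ops k N M)
    (v : Fin 5 → Fin (N + 1)) (a : Fin 4 → k[X]) :
    insertMul c η 4 v a =
      c 0 • η 3 ![v 0, v 2, v 3, v 4] ![mul (v 0) (v 1) (v 2) (a 1) (a 0), a 2, a 3]
      + c 1 • η 3 ![v 0, v 1, v 3, v 4] ![a 0, mul (v 1) (v 2) (v 3) (a 2) (a 1), a 3]
      + c 2 • η 3 ![v 0, v 1, v 2, v 4] ![a 0, a 1, mul (v 2) (v 3) (v 4) (a 3) (a 2)] := by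
  change ∑ n : Fin 3, _ = _
  have d0 : dropVtx (0 : Fin 3) v = ![v 0, v 2, v 3, v 4] := by rw [vec4 (dropVtx _ _)]; rfl
  have d1 : dropVtx (1 : Fin 3) v = ![v 0, v 1, v 3, v 4] := by rw [vec4 (dropVtx _ _)]; rfl
  have d2 : dropVtx (2 : Fin 3) v = ![v 0, v 1, v 2, v 4] := by rw [vec4 (dropVtx _ _)]; rfl
  have m0 : mulAt (0 : Fin 3) v a = ![mul (v 0) (v 1) (v 2) (a 1) (a 0), a 2, a 3] := by
    rw [vec3 (mulAt _ _ _)]; rfl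
  have m1 : mulAt (1 : Fin 3) v a = ![a 0, mul (v 1) (v 2) (v 3) (a 2) (a 1), a 3] := by
    rw [vec3 (mulAt _ _ _)]; rfl
  have m2 : mulAt (2 : Fin 3) v a = ![a 0, a 1, mul (v 2) (v 3) (v 4) (a 3) (a 2)] := by
    rw [vec3 (mulAt _ _ _)]; rfl
  rw [Fin.sum_univ_three, d0, d1, d2, m0, m1, m2]
  rfl

lemma sign_zero : sign k 0 = 1 := sign_even (by decide)
lemma sign_one : sign k 1 = -1 := sign_odd (by decide)
lemma sign_neg_one : sign k (-1) = -1 := sign_odd (by decide)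
lemma natDiff_one_two (i : Inner N) {ζ : Ops k N (Mat k N)} (h0 : ζ 0 = 0)
    (v : Fin 3 → Fin (N + 1)) (a : Fin 2 → k[X]) :
    natDiff idF (braidF i) 1 ζ 2 v a =
      ((braidF i).obj (v 1)).dot (braid1 i (v 1) (v 2) (a 1)) (ζ 1 ![v 0, v 1] ![a 0])
      + (gen (v 1)).dot (ζ 1 ![v 1, v 2] ![a 1]) (entry (slot 0 (v 1)) (slot 0 (v 0)) (a 0))
      - ζ 1 ![v 0, v 2] ![mul (v 0) (v 1) (v 2) (a 1) (a 0)]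
      - ((braidF i).obj (v 2)).dot ((braidF i).obj (v 2)).diff (ζ 2 v a) := by
  have l1 : low 2 (by omega) v = ![v 0, v 1] := vec2 _
  have l2 : low 1 (by omega) a = ![a 0] := vec1 _
  have u1 : upp 1 2 (by omega) v = ![v 1, v 2] := vec2 _
  have u2 : upp 1 1 (by omega) a = ![a 1] := vec1 _
  change natDiffFun idF (braidF i) 1 ζ 2 v a = _
  unfold natDiffFun
  rw [Fin.sum_univ_two, Fin.sum_univ_two, insertMul_two]
  change mu1 (gen (v 0)) ((braidF i).obj (v 2)) (-1) (ζ 2 v a)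
    + (mu2 _ _ _ (ζ 0 _ _) + mu2 ((braidF i).obj (v 1)) 0
      (braid1 i (v 1) (v 2) (a 1)) (ζ 1 (low 2 _ v) (low 1 _ a)))
    + (sign k 0 • mu2 (gen (v 1)) 0 (ζ 1 (upp 1 2 _ v) (upp 1 1 _ a))
          (entry (slot 0 (v 1)) (slot 0 (v 0)) (a 0))
        + sign k 0 • mu2 _ _ (ζ 0 _ _) _) - sign k 0 • _ = _
  rw [h0, l1, l2, u1, u2]
  simp only [mu1_gen, mu2, Pi.zero_apply, dot_zero_right, dot_zero_left, smul_zero, add_zero,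
    zero_add, one_smul, neg_smul, sign_zero, sign_neg_one]
  abel

lemma natDiff_one_three (i : Inner N) {ζ : Ops k N (Mat k N)} (h0 : ζ 0 = 0) (h3 : ζ 3 = 0)
    (v : Fin 4 → Fin (N + 1)) (a : Fin 3 → k[X]) :
    natDiff idF (braidF i) 1 ζ 3 v a =
      ((braidF i).obj (v 1)).dot (braid2 i (v 1) (v 2) (v 3) (a 2) (a 1)) (ζ 1 ![v 0, v 1] ![a 0])
      - ((braidF i).obj (v 2)).dot (braid1 i (v 2) (v 3) (a 2)) (ζ 2 ![v 0, v 1, v 2] ![a 0, a 1])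
      + (gen (v 1)).dot (ζ 2 ![v 1, v 2, v 3] ![a 1, a 2])
          (entry (slot 0 (v 1)) (slot 0 (v 0)) (a 0))
      - ζ 2 ![v 0, v 2, v 3] ![mul (v 0) (v 1) (v 2) (a 1) (a 0), a 2]
      + ζ 2 ![v 0, v 1, v 3] ![a 0, mul (v 1) (v 2) (v 3) (a 2) (a 1)] := by
  have l1 : low 2 (by omega) v = ![v 0, v 1] := vec2 _
  have l2 : low 1 (by omega) a = ![a 0] := vec1 _
  have l3 : low 3 (by omega) v = ![v 0, v 1, v 2] := vec3 _
  have l4 : low 2 (by omega) a = ![a 0, a 1] := vec2 _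
  have u1 : upp 1 3 (by omega) v = ![v 1, v 2, v 3] := vec3 _
  have u2 : upp 1 2 (by omega) a = ![a 1, a 2] := vec2 _
  change natDiffFun idF (braidF i) 1 ζ 3 v a = _
  unfold natDiffFun
  rw [Fin.sum_univ_three, Fin.sum_univ_three, insertMul_three]
  -- The literal zeros are the components of the identity functor in lengths at least two. The
  -- remaining discarded terms contain the component of `ζ` in length zero or three.
  change mu1 (gen (v 0)) ((braidF i).obj (v 3)) (-2) (ζ 3 v a)
    + (mu2 _ _ _ (ζ 0 _ _) + mu2 ((braidF i).obj (v 1)) 0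
        (braid2 i (v 1) (v 2) (v 3) (a 2) (a 1)) (ζ 1 (low 2 _ v) (low 1 _ a))
      + mu2 ((braidF i).obj (v 2)) (-1)
        (braid1 i (v 2) (v 3) (a 2)) (ζ 2 (low 3 _ v) (low 2 _ a)))
    + (sign k 0 • mu2 (gen (v 1)) 0 (ζ 2 (upp 1 3 _ v) (upp 1 2 _ a))
          (entry (slot 0 (v 1)) (slot 0 (v 0)) (a 0))
        + _ • mu2 _ _ _ 0
        + _ • mu2 _ _ _ 0) - (sign k 0 • _ + sign k (-1) • _) = _
  rw [h0, h3, l1, l2, l3, l4, u1, u2]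
  simp only [mu1_gen, mu2, Pi.zero_apply, dot_zero_right, smul_zero, add_zero, zero_add,
    one_smul, neg_smul, sign_zero, sign_neg_one]
  abel

/-- Closedness in length three is thus the homotopy equation. At targets other than `T_i`, where δ
is zero, it becomes a condition on η² alone. -/
lemma natDiff_two_three (i : Inner N) {η : Ops k N (Mat k N)} (h0 : η 0 = 0) (h1 : η 1 = 0)
    (v : Fin 4 → Fin (N + 1)) (a : Fin 3 → k[X]) :
    natDiff idF (braidF i) 2 η 3 v a = homotopyRHS i η v a
      - ((braidF i).obj (v 3)).dot ((braidF i).obj (v 3)).diff (η 3 v a) := by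
  have l3 : low 3 (by omega) v = ![v 0, v 1, v 2] := vec3 _
  have l4 : low 2 (by omega) a = ![a 0, a 1] := vec2 _
  have u1 : upp 1 3 (by omega) v = ![v 1, v 2, v 3] := vec3 _
  have u2 : upp 1 2 (by omega) a = ![a 1, a 2] := vec2 _
  change natDiffFun idF (braidF i) 2 η 3 v a = _
  unfold natDiffFun
  rw [Fin.sum_univ_three, Fin.sum_univ_three, insertMul_three]
  change mu1 (gen (v 0)) ((braidF i).obj (v 3)) (-1) (η 3 v a)
    + (mu2 _ _ _ (η 0 _ _) + mu2 _ _ _ (η 1 _ _)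
      + mu2 ((braidF i).obj (v 2)) 0
        (braid1 i (v 2) (v 3) (a 2)) (η 2 (low 3 _ v) (low 2 _ a)))
    + (sign k (-1) • mu2 (gen (v 1)) 0 (η 2 (upp 1 3 _ v) (upp 1 2 _ a))
          (entry (slot 0 (v 1)) (slot 0 (v 0)) (a 0))
        + _ • mu2 _ _ _ 0
        + _ • mu2 _ _ _ 0) - (sign k 1 • _ + sign k 0 • _) = _
  rw [h0, h1, l3, l4, u1, u2]
  simp only [mu1_gen, mu2, Pi.zero_apply, dot_zero_right, smul_zero, add_zero, zero_add,
    one_smul, neg_smul, sign_zero, sign_neg_one, sign_one, homotopyRHS]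
  abel

lemma natDiff_two_four (i : Inner N) {η : Ops k N (Mat k N)} (h0 : η 0 = 0) (h1 : η 1 = 0)
    (h4 : η 4 = 0) (v : Fin 5 → Fin (N + 1)) (a : Fin 4 → k[X]) :
    natDiff idF (braidF i) 2 η 4 v a =
      ((braidF i).obj (v 2)).dot (braid2 i (v 2) (v 3) (v 4) (a 3) (a 2))
          (η 2 ![v 0, v 1, v 2] ![a 0, a 1])
      - ((braidF i).obj (v 3)).dot (braid1 i (v 3) (v 4) (a 3))
          (η 3 ![v 0, v 1, v 2, v 3] ![a 0, a 1, a 2])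
      - (gen (v 1)).dot (η 3 ![v 1, v 2, v 3, v 4] ![a 1, a 2, a 3])
          (entry (slot 0 (v 1)) (slot 0 (v 0)) (a 0))
      + η 3 ![v 0, v 2, v 3, v 4] ![mul (v 0) (v 1) (v 2) (a 1) (a 0), a 2, a 3]
      - η 3 ![v 0, v 1, v 3, v 4] ![a 0, mul (v 1) (v 2) (v 3) (a 2) (a 1), a 3]
      + η 3 ![v 0, v 1, v 2, v 4] ![a 0, a 1, mul (v 2) (v 3) (v 4) (a 3) (a 2)] := by
  have l3 : low 3 (by omega) v = ![v 0, v 1, v 2] := vec3 _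
  have l4 : low 2 (by omega) a = ![a 0, a 1] := vec2 _
  have l5 : low 4 (by omega) v = ![v 0, v 1, v 2, v 3] := vec4 _
  have l6 : low 3 (by omega) a = ![a 0, a 1, a 2] := vec3 _
  have u1 : upp 1 4 (by omega) v = ![v 1, v 2, v 3, v 4] := vec4 _
  have u2 : upp 1 3 (by omega) a = ![a 1, a 2, a 3] := vec3 _
  change natDiffFun idF (braidF i) 2 η 4 v a = _
  unfold natDiffFun
  rw [Fin.sum_univ_four, Fin.sum_univ_four, insertMul_four]
  change mu1 (gen (v 0)) ((braidF i).obj (v 4)) (-2) (η 4 v a)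
    + (mu2 _ _ _ (η 0 _ _) + mu2 _ _ _ (η 1 _ _)
      + mu2 ((braidF i).obj (v 2)) 0
        (braid2 i (v 2) (v 3) (v 4) (a 3) (a 2)) (η 2 (low 3 _ v) (low 2 _ a))
      + mu2 ((braidF i).obj (v 3)) (-1)
        (braid1 i (v 3) (v 4) (a 3)) (η 3 (low 4 _ v) (low 3 _ a)))
    + (sign k (-1) • mu2 (gen (v 1)) 0 (η 3 (upp 1 4 _ v) (upp 1 3 _ a))
          (entry (slot 0 (v 1)) (slot 0 (v 0)) (a 0))
        + _ • mu2 _ _ _ 0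
        + _ • mu2 _ _ _ 0 + _ • mu2 _ _ _ 0)
      - (sign k 1 • _ + sign k 0 • _ + sign k (-1) • _) = _
  rw [h0, h1, h4, l3, l4, l5, l6, u1, u2]
  simp only [mu1_gen, mu2, Pi.zero_apply, dot_zero_right, smul_zero, add_zero, zero_add,
    one_smul, neg_smul, sign_zero, sign_neg_one, sign_one]
  abel

end

/-! ### Consequences of the square-zero property in low lengths -/

section
variable {k : Type*} [Field k] {N : ℕ}

lemma hom_degree {Y Z : Tw k N} {g g' : ℤ} (h : g = g') {f : Mat k N} (hf : f ∈ Y.hom Z g) :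
    f ∈ Y.hom Z g' := h ▸ hf

lemma preNat_mem_hom {i : Inner N} {g : ℤ} {η : Ops k N (Mat k N)}
    (h : η ∈ PreNat idF (braidF i) g) (d : ℕ) (v : Fin (d + 1) → Fin (N + 1))
    (a : Fin d → k[X]) : η d v a ∈ BHom k i (v 0) (v (Fin.last d)) (g - d) :=
  (h d v).2 a

lemma preNat_eq_zero {i : Inner N} {g : ℤ} {η : Ops k N (Mat k N)}
    (h : η ∈ PreNat idF (braidF i) g) (d : ℕ) (h0 : (d : ℤ) ≠ g) (h1 : (d : ℤ) ≠ g + 1) :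
    η d = 0 := by
  funext v a
  exact eq_zero_of_degree (preNat_mem_hom h d v a) (by omega) fun _ => by omega

lemma natDiff_eq_zero {i : Inner N} {g : ℤ} {η : Ops k N (Mat k N)}
    (h : η ∈ PreNat idF (braidF i) g) (d : ℕ) (h0 : (d : ℤ) ≠ g + 1) (h1 : (d : ℤ) ≠ g + 2) :
    natDiff idF (braidF i) g η d = 0 := by
  funext v a
  exact eq_zero_of_degree (natDiff_mem_hom i g (preNat_mem_hom h) d v a) (by omega)
    fun _ => by omega

/-- A transformation of degree two is determined by the solution of the homotopy equation. -/
lemma natDiff_two_four_eq_zero {i : Inner N} {η : Ops k N (Mat k N)}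
    (h : η ∈ PreNat idF (braidF i) 2)
    (hδ : ∀ v a, ((braidF i).obj (v 3)).dot ((braidF i).obj (v 3)).diff (η 3 v a) =
      homotopyRHS i η v a) : natDiff idF (braidF i) 2 η 4 = 0 := by
  have h0 := preNat_eq_zero h 0 (by decide) (by decide)
  have h1 := preNat_eq_zero h 1 (by decide) (by decide)
  have h4 := preNat_eq_zero h 4 (by decide) (by decide)
  funext v a
  -- The value has degree -1, so it may be tested after applying δ. Every δ·η³ is then rewritten
  -- through the homotopy equation, and δ·β² through the second functor equation. The summand of the
  -- latter that still contains δ dies because δ·η² would have degree 1.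
  refine eq_zero_of_delta_eq_zero
    (hom_degree (by norm_num) (natDiff_mem_hom i 2 (preNat_mem_hom h) 4 v a)) ?_
  change ((braidF i).obj (v 4)).dot ((braidF i).obj (v 4)).diff _ = 0
  have d3 := fun p q r s f₀ f₁ f₂ => hδ ![p, q, r, s] ![f₀, f₁, f₂]
  have hm := preNat_mem_hom h 2 ![v 0, v 1, v 2] ![a 0, a 1]
  have hb := eq_sub_of_add_eq (braid2_delta i (v 2) (v 3) (v 4) (a 3) (a 2))
  have hz := delta_dot_eq_zero hm
  simp only [homotopyRHS, Matrix.cons_val] at d3 hz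
  rw [natDiff_two_four i h0 h1 h4]
  simp only [dot_sub_right, dot_add_right]
  rw [← dot_assoc _ _ _ (braid2 i _ _ _ _ _), hb, ← dot_assoc _ _ _ (braid1 i _ _ _),
    braidDelta_dot_braid1, dot_assoc _ _ _ _ (η 3 _ _), d3, ← dot_assoc _ _ _ (η 3 _ _), d3, d3,
    d3, d3]
  simp only [dot_sub_left, dot_add_left, dot_sub_right, dot_add_right, dot_assoc]
  rw [show ((braidF i).obj (v 2)).dot ((braidF i).obj (v 2)).diff (η 2 ![v 0, v 1, v 2] ![a 0, a 1])
    = 0 from hz]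
  simp only [dot_zero_right, dot_entry_entry, gen_supp, Finset.mem_singleton, and_self, if_true,
    slot_vtx, mul_mul_assoc]
  abel

/-- `μ¹_{Fun} ∘ μ¹_{Fun} = 0` on pre-natural transformations of degree one, in length three. -/
lemma homotopyRHS_natDiff {i : Inner N} {ζ : Ops k N (Mat k N)}
    (h : ζ ∈ PreNat idF (braidF i) 1) (v : Fin 4 → Fin (N + 1)) (a : Fin 3 → k[X]) :
    homotopyRHS i (natDiff idF (braidF i) 1 ζ) v a =
      ((braidF i).obj (v 3)).dot ((braidF i).obj (v 3)).diff
        (natDiff idF (braidF i) 1 ζ 3 v a) := by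
  have h0 := preNat_eq_zero h 0 (by decide) (by decide)
  have h3 := preNat_eq_zero h 3 (by decide) (by decide)
  have hm := preNat_mem_hom h 1 ![v 0, v 1] ![a 0]
  have hz := delta_dot_eq_zero hm
  have hb := eq_sub_of_add_eq (braid2_delta i (v 1) (v 2) (v 3) (a 2) (a 1))
  rw [natDiff_one_three i h0 h3]
  simp only [dot_sub_right, dot_add_right]
  -- The second functor equation trades δ·β² for β¹·β¹ - β¹(composite) - β²·δ. Its last summand
  -- vanishes after composition with ζ¹, because δ·ζ¹ would have degree 1.
  rw [← dot_assoc _ _ _ (braid2 i _ _ _ _ _), hb, ← dot_assoc _ _ _ (braid1 i _ _ _),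
    braidDelta_dot_braid1]
  simp only [homotopyRHS, natDiff_one_two i h0, Matrix.cons_val, dot_sub_left, dot_add_left,
    dot_sub_right, dot_add_right, dot_assoc]
  rw [show ((braidF i).obj (v 1)).dot ((braidF i).obj (v 1)).diff (ζ 1 ![v 0, v 1] ![a 0])
    = 0 from hz]
  simp only [dot_zero_right, dot_entry_entry, gen_supp, Finset.mem_singleton, and_self, if_true,
    slot_vtx, mul_mul_assoc]
  abel

/-! ### Comparison with Hochschild cochains of `𝔅_i⁻` -/

/-- The Hochschild cochain of degree `g` underlying a pre-natural transformation. -/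
def underlying (i : Inner N) (g : ℕ) : Ops k N (Mat k N) →ₗ[k] Ops k N k[X] where
  toFun η d v a := if d = g then proj i (v 0) (v (Fin.last d)) (η d v a) else 0
  map_add' η η' := by
    funext d v a
    simp only [Pi.add_apply, map_add]
    split_ifs <;> simp
  map_smul' c η := by
    funext d v a
    simp only [Pi.smul_apply, map_smul, RingHom.id_apply]
    split_ifs <;> simp

lemma underlying_apply (i : Inner N) (g : ℕ) (η : Ops k N (Mat k N)) (v : Fin (g + 1) → Fin (N + 1))
    (a : Fin g → k[X]) :
    underlying i g η g v a = proj i (v 0) (v (Fin.last g)) (η g v a) := if_pos rfl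

lemma underlying_of_ne (i : Inner N) {g d : ℕ} (h : d ≠ g) (η : Ops k N (Mat k N)) :
    underlying i g η d = 0 := by
  funext v a; exact if_neg h

lemma IsMultilin.linear_comp {M M' : Type*} [AddCommGroup M] [Module k M] [AddCommGroup M']
    [Module k M'] {d : ℕ} {f : (Fin d → k[X]) → M} (hf : IsMultilin k f) (L : M →ₗ[k] M') :
    IsMultilin k (fun a => L (f a)) := by
  obtain ⟨m, rfl⟩ := hf
  exact ⟨L.compMultilinearMap m, rfl⟩

lemma isMultilin_zero {M : Type*} [AddCommGroup M] [Module k M] {d : ℕ} :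
    IsMultilin k (0 : (Fin d → k[X]) → M) := ⟨0, rfl⟩

lemma underlying_mem (i : Inner N) (g : ℕ) {η : Ops k N (Mat k N)}
    (h : η ∈ PreNat idF (braidF i) g) : underlying i g η ∈ BimodCochain k i g := by
  refine ⟨fun d hd => underlying_of_ne i hd η, fun d v => ?_⟩
  by_cases hd : d = g
  · subst hd
    refine ⟨?_, fun a => ?_⟩
    · have := (h d v).1.linear_comp (proj i (v 0) (v (Fin.last d)))
      convert this using 2
      exact underlying_apply i d η v _
    · rw [underlying_apply]
      have := preNat_mem_hom h d v a
      rw [sub_self] at this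
      exact proj_mem_bimod this
  · rw [underlying_of_ne i hd]
    exact ⟨isMultilin_zero, fun a => Submodule.zero_mem _⟩

lemma bimodDiff_two (φ : Ops k N k[X]) (v : Fin 3 → Fin (N + 1)) (a : Fin 2 → k[X]) :
    bimodDiff k N φ 2 v a = mul (v 0) (v 1) (v 2) (φ 1 ![v 1, v 2] ![a 1]) (a 0)
      - φ 1 ![v 0, v 2] ![mul (v 0) (v 1) (v 2) (a 1) (a 0)]
      + mul (v 0) (v 1) (v 2) (a 1) (φ 1 ![v 0, v 1] ![a 0]) := by
  have t1 : Fin.tail v = ![v 1, v 2] := vec2 _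
  have t2 : Fin.tail a = ![a 1] := vec1 _
  have t3 : Fin.init v = ![v 0, v 1] := vec2 _
  have t4 : Fin.init a = ![a 0] := vec1 _
  change bimodDiffFun φ 2 v a = _
  simp only [bimodDiffFun]
  rw [insertMul_two, t1, t2, t3, t4]
  have e : (-1 : k) ^ (1 + 1) = 1 := by ring
  rw [e, one_smul, zero_add, pow_one, neg_one_smul, ← sub_eq_add_neg]
  rfl

lemma bimodDiff_three (φ : Ops k N k[X]) (v : Fin 4 → Fin (N + 1)) (a : Fin 3 → k[X]) :
    bimodDiff k N φ 3 v a = mul (v 0) (v 1) (v 3) (φ 2 ![v 1, v 2, v 3] ![a 1, a 2]) (a 0)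
      - φ 2 ![v 0, v 2, v 3] ![mul (v 0) (v 1) (v 2) (a 1) (a 0), a 2]
      + φ 2 ![v 0, v 1, v 3] ![a 0, mul (v 1) (v 2) (v 3) (a 2) (a 1)]
      - mul (v 0) (v 2) (v 3) (a 2) (φ 2 ![v 0, v 1, v 2] ![a 0, a 1]) := by
  have t1 : Fin.tail v = ![v 1, v 2, v 3] := vec3 _
  have t2 : Fin.tail a = ![a 1, a 2] := vec2 _
  have t3 : Fin.init v = ![v 0, v 1, v 2] := vec3 _
  have t4 : Fin.init a = ![a 0, a 1] := vec2 _
  change bimodDiffFun φ 3 v a = _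
  simp only [bimodDiffFun]
  rw [insertMul_three, t1, t2, t3, t4]
  have e : (-1 : k) ^ (1 + 1) = 1 := by ring
  have e' : (-1 : k) ^ (2 + 1) = -1 := by ring
  rw [e, e', one_smul, zero_add, pow_one, neg_one_smul, neg_one_smul, ← sub_eq_add_neg,
    sub_eq_add_neg, sub_eq_add_neg, ← add_assoc]
  rfl

lemma bimodDiff_eq_zero {φ : Ops k N k[X]} {g : ℕ} (h : ∀ d, d ≠ g → φ d = 0) {d : ℕ}
    (hd : d ≠ g + 1) : bimodDiff k N φ d = 0 := by
  funext v a
  change bimodDiffFun φ d v a = 0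
  cases d with
  | zero => rfl
  | succ d =>
    have e : φ d = 0 := h d (by omega)
    simp [bimodDiffFun, insertMul, e]

/-- Naturality of the counit turns the action of β¹ into left multiplication. Since the image of δ
is the kernel of `proj`, the homotopy equation is solvable exactly when the underlying Hochschild
cochain is a cocycle. -/
lemma proj_homotopyRHS {i : Inner N} {η : Ops k N (Mat k N)}
    (h : ∀ v a, η 2 v a ∈ BHom k i (v 0) (v 2) 0) (v : Fin 4 → Fin (N + 1)) (a : Fin 3 → k[X]) :
    proj i (v 0) (v 3) (homotopyRHS i η v a) = -bimodDiff k N (underlying i 2 η) 3 v a := by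
  rw [bimodDiff_three]
  have e : ∀ v a, underlying i 2 η 2 v a = proj i (v 0) (v 2) (η 2 v a) :=
    underlying_apply i 2 η
  simp only [e, homotopyRHS, map_add, map_sub]
  have h1 : η 2 ![v 0, v 1, v 2] ![a 0, a 1] ∈ BHom k i (v 0) (v 2) 0 :=
    h ![v 0, v 1, v 2] ![a 0, a 1]
  have h2 : η 2 ![v 1, v 2, v 3] ![a 1, a 2] ∈ BHom k i (v 1) (v 3) 0 :=
    h ![v 1, v 2, v 3] ![a 1, a 2]
  rw [proj_braid1 _ _ h1, proj_comp _ _ h2]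
  simp only [Matrix.cons_val]
  ring

lemma homotopyRHS_mem {i : Inner N} {η : Ops k N (Mat k N)}
    (h : ∀ v a, η 2 v a ∈ BHom k i (v 0) (v 2) 0) (v : Fin 4 → Fin (N + 1)) (a : Fin 3 → k[X]) :
    homotopyRHS i η v a ∈ BHom k i (v 0) (v 3) 0 := by
  have h1 : η 2 ![v 0, v 1, v 2] ![a 0, a 1] ∈ BHom k i (v 0) (v 2) 0 :=
    h ![v 0, v 1, v 2] ![a 0, a 1]
  have h2 : η 2 ![v 1, v 2, v 3] ![a 1, a 2] ∈ BHom k i (v 1) (v 3) 0 :=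
    h ![v 1, v 2, v 3] ![a 1, a 2]
  have h3 : entry (slot 0 (v 1)) (slot 0 (v 0)) (a 0) ∈ (gen (k := k) (v 0)).hom (gen (v 1)) 0 :=
    entry_mem (by simp) (by simp) (by simp) _
  have e1 := hom_degree (add_zero 0) (dot_mem (braid1_mem i (v 2) (v 3) (a 2)) h1)
  have e2 := hom_degree (add_zero 0) (dot_mem h2 h3)
  have e3 : η 2 ![v 0, v 2, v 3] ![mul (v 0) (v 1) (v 2) (a 1) (a 0), a 2]
    ∈ BHom k i (v 0) (v 3) 0 := h ![v 0, v 2, v 3] _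
  have e4 : η 2 ![v 0, v 1, v 3] ![a 0, mul (v 1) (v 2) (v 3) (a 2) (a 1)]
    ∈ BHom k i (v 0) (v 3) 0 := h ![v 0, v 1, v 3] _
  unfold homotopyRHS
  exact Submodule.sub_mem _ (Submodule.add_mem _ (Submodule.sub_mem _ e1 e2) e3) e4

/-- The counit annihilates δ, so the contribution of ζ² disappears and only the Hochschild
differential of the projection of ζ¹ is left. -/
lemma underlying_natDiff {i : Inner N} {ζ : Ops k N (Mat k N)}
    (h : ζ ∈ PreNat idF (braidF i) 1) :
    underlying i 2 (natDiff idF (braidF i) 1 ζ) = bimodDiff k N (underlying i 1 ζ) := by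
  have h0 := preNat_eq_zero h 0 (by decide) (by decide)
  funext d v a
  by_cases hd : d = 2
  · subst hd
    have e : ∀ v a, underlying i 1 ζ 1 v a = proj i (v 0) (v 1) (ζ 1 v a) :=
      underlying_apply i 1 ζ
    have h1 : ζ 1 ![v 0, v 1] ![a 0] ∈ BHom k i (v 0) (v 1) 0 :=
      hom_degree (by norm_num) (preNat_mem_hom h 1 ![v 0, v 1] ![a 0])
    have h2 : ζ 1 ![v 1, v 2] ![a 1] ∈ BHom k i (v 1) (v 2) 0 :=
      hom_degree (by norm_num) (preNat_mem_hom h 1 ![v 1, v 2] ![a 1])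
    rw [underlying_apply, bimodDiff_two, natDiff_one_two i h0]
    simp only [e, map_sub, map_add]
    change proj i (v 0) (v 2) _ + proj i (v 0) (v 2) _ - proj i (v 0) (v 2) _
      - proj i (v 0) (v 2) _ = _
    rw [proj_braid1 _ _ h1, proj_comp _ _ h2, proj_delta]
    simp only [Matrix.cons_val]
    ring
  · rw [underlying_of_ne i hd, bimodDiff_eq_zero (fun d hd => underlying_of_ne i hd ζ) hd]

end

section
variable {k : Type*} [Field k] {N : ℕ}

/-! ### Multilinearity in low degrees -/

lemma IsMultilin.sub {M : Type*} [AddCommGroup M] [Module k M] {d : ℕ}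
    {f g : (Fin d → k[X]) → M} (hf : IsMultilin k f) (hg : IsMultilin k g) :
    IsMultilin k (f - g) := by
  obtain ⟨m, rfl⟩ := hf
  obtain ⟨m', rfl⟩ := hg
  exact ⟨m - m', rfl⟩

lemma isMultilin_one {M : Type*} [AddCommGroup M] [Module k M] (L : k[X] →ₗ[k] M) :
    IsMultilin k (fun a : Fin 1 → k[X] => L (a 0)) := by
  refine ⟨⟨fun a => L (a 0), ?_, ?_⟩, rfl⟩
  · intro _ m n x y; fin_cases n; simp
  · intro _ m n c x; fin_cases n; simp

lemma isMultilin_two {M : Type*} [AddCommGroup M] [Module k M] {F : k[X] → k[X] → M}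
    (h0 : ∀ y, IsLinearMap k (F · y)) (h1 : ∀ x, IsLinearMap k (F x ·)) :
    IsMultilin k (fun a : Fin 2 → k[X] => F (a 0) (a 1)) := by
  have e1 : (1 : Fin 2) ≠ 0 := by decide
  refine ⟨⟨fun a => F (a 0) (a 1), ?_, ?_⟩, rfl⟩
  · intro _ m n x y
    obtain rfl | rfl : n = 0 ∨ n = 1 := by omega
    · simpa only [Function.update_self, Function.update_of_ne e1] using (h0 (m 1)).map_add x y
    · simpa only [Function.update_self, Function.update_of_ne e1.symm]
        using (h1 (m 0)).map_add x y
  · intro _ m n c x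
    obtain rfl | rfl : n = 0 ∨ n = 1 := by omega
    · simpa only [Function.update_self, Function.update_of_ne e1] using (h0 (m 1)).map_smul c x
    · simpa only [Function.update_self, Function.update_of_ne e1.symm]
        using (h1 (m 0)).map_smul c x

lemma isMultilin_three {M : Type*} [AddCommGroup M] [Module k M] {F : k[X] → k[X] → k[X] → M}
    (h0 : ∀ y z, IsLinearMap k (F · y z)) (h1 : ∀ x z, IsLinearMap k (F x · z))
    (h2 : ∀ x y, IsLinearMap k (F x y ·)) :
    IsMultilin k (fun a : Fin 3 → k[X] => F (a 0) (a 1) (a 2)) := by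
  have e1 : (1 : Fin 3) ≠ 0 := by decide
  have e2 : (2 : Fin 3) ≠ 0 := by decide
  have e3 : (2 : Fin 3) ≠ 1 := by decide
  refine ⟨⟨fun a => F (a 0) (a 1) (a 2), ?_, ?_⟩, rfl⟩
  · intro _ m n x y
    obtain rfl | rfl | rfl : n = 0 ∨ n = 1 ∨ n = 2 := by omega
    · simpa only [Function.update_self, Function.update_of_ne e1, Function.update_of_ne e2]
        using (h0 (m 1) (m 2)).map_add x y
    · simpa only [Function.update_self, Function.update_of_ne e1.symm, Function.update_of_ne e3]
        using (h1 (m 0) (m 2)).map_add x y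
    · simpa only [Function.update_self, Function.update_of_ne e2.symm,
        Function.update_of_ne e3.symm] using (h2 (m 0) (m 1)).map_add x y
  · intro _ m n c x
    obtain rfl | rfl | rfl : n = 0 ∨ n = 1 ∨ n = 2 := by omega
    · simpa only [Function.update_self, Function.update_of_ne e1, Function.update_of_ne e2]
        using (h0 (m 1) (m 2)).map_smul c x
    · simpa only [Function.update_self, Function.update_of_ne e1.symm, Function.update_of_ne e3]
        using (h1 (m 0) (m 2)).map_smul c x
    · simpa only [Function.update_self, Function.update_of_ne e2.symm,
        Function.update_of_ne e3.symm] using (h2 (m 0) (m 1)).map_smul c x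

lemma IsMultilin.linear_one {M : Type*} [AddCommGroup M] [Module k M] {f : (Fin 1 → k[X]) → M}
    (h : IsMultilin k f) : IsLinearMap k (fun z => f ![z]) := by
  obtain ⟨m, rfl⟩ := h
  have e : ∀ z : k[X], Function.update ![0] 0 z = ![z] := by
    intro z; funext n; fin_cases n; rfl
  constructor
  · intro z z'
    have := m.map_update_add ![0] 0 z z'
    rwa [e, e, e] at this
  · intro c z
    have := m.map_update_smul ![0] 0 c z
    rwa [e, e] at this

lemma IsMultilin.linear_fst {M : Type*} [AddCommGroup M] [Module k M] {f : (Fin 2 → k[X]) → M}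
    (h : IsMultilin k f) (y : k[X]) : IsLinearMap k (fun z => f ![z, y]) := by
  obtain ⟨m, rfl⟩ := h
  have e : ∀ z : k[X], Function.update ![0, y] 0 z = ![z, y] := by
    intro z; funext n; fin_cases n <;> rfl
  constructor
  · intro z z'
    have := m.map_update_add ![0, y] 0 z z'
    rwa [e, e, e] at this
  · intro c z
    have := m.map_update_smul ![0, y] 0 c z
    rwa [e, e] at this

lemma IsMultilin.linear_snd {M : Type*} [AddCommGroup M] [Module k M] {f : (Fin 2 → k[X]) → M}
    (h : IsMultilin k f) (x : k[X]) : IsLinearMap k (fun z => f ![x, z]) := by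
  obtain ⟨m, rfl⟩ := h
  have e : ∀ z : k[X], Function.update ![x, 0] 1 z = ![x, z] := by
    intro z; funext n; fin_cases n <;> rfl
  constructor
  · intro z z'
    have := m.map_update_add ![x, 0] 1 z z'
    rwa [e, e, e] at this
  · intro c z
    have := m.map_update_smul ![x, 0] 1 c z
    rwa [e, e] at this

lemma homotopyRHS_multilin (i : Inner N) {η : Ops k N (Mat k N)}
    (h : ∀ v, IsMultilin k (η 2 v)) (v : Fin 4 → Fin (N + 1)) :
    IsMultilin k (homotopyRHS i η v) := by
  have hf := fun w y => (h w).linear_fst y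
  have hs := fun w x => (h w).linear_snd x
  have fa := fun w y => (hf w y).map_add
  have fc := fun w y => (hf w y).map_smul
  have sa := fun w y => (hs w y).map_add
  have sc := fun w y => (hs w y).map_smul
  unfold homotopyRHS
  refine isMultilin_three (F := fun x y z => 
    ((braidF i).obj (v 2)).dot (braid1 i (v 2) (v 3) z) (η 2 ![v 0, v 1, v 2] ![x, y])
  - (gen (v 1)).dot (η 2 ![v 1, v 2, v 3] ![y, z]) (entry (slot 0 (v 1)) (slot 0 (v 0)) x)
  + η 2 ![v 0, v 2, v 3] ![mul (v 0) (v 1) (v 2) y x, z]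
  - η 2 ![v 0, v 1, v 3] ![x, mul (v 1) (v 2) (v 3) z y]) ?_ ?_ ?_
  · refine fun y z => ⟨fun x x' => ?_, fun c x => ?_⟩
    · simp only [fa, entry_add, dot_add_right, mul_add_right']; abel
    · simp only [fc, entry_smul, dot_smul_right, mul_smul_right', smul_sub, smul_add]
  · refine fun y z => ⟨fun x x' => ?_, fun c x => ?_⟩
    · simp only [fa, sa, dot_add_right, dot_add_left, mul_add_left', mul_add_right']; abel
    · simp only [fc, sc, dot_smul_right, dot_smul_left, mul_smul_left', mul_smul_right', smul_sub,
        smul_add]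
  · refine fun y z => ⟨fun x x' => ?_, fun c x => ?_⟩
    · simp only [sa, braid1_add, dot_add_left, mul_add_left']; abel
    · simp only [sc, braid1_smul, dot_smul_left, mul_smul_left', smul_sub, smul_add]

/-! ### Extending Hochschild 2-cocycles to natural transformations -/

/-- The family with `η²` given by `E`, and `η³` solving the homotopy equation. -/
def extendOps (i : Inner N) (E : (Fin 3 → Fin (N + 1)) → (Fin 2 → k[X]) → Mat k N) :
    Ops k N (Mat k N) :=
  fun d => match d with
    | 2 => E
    -- The right-hand side of the homotopy equation reads only the component of length two, so a
    -- truncated family suffices and no recursion is needed.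
    | 3 => fun v a => deltaInv k i (v 0) (v 3)
        (homotopyRHS i (fun d => match d with | 2 => E | _ => 0) v a)
    | _ => 0

lemma extendOps_three (i : Inner N) (E : (Fin 3 → Fin (N + 1)) → (Fin 2 → k[X]) → Mat k N)
    (v : Fin 4 → Fin (N + 1)) (a : Fin 3 → k[X]) : extendOps i E 3 v a =
      deltaInv k i (v 0) (v 3) (homotopyRHS i (extendOps i E) v a) := rfl

lemma extendOps_of_ne (i : Inner N) (E : (Fin 3 → Fin (N + 1)) → (Fin 2 → k[X]) → Mat k N)
    (d : ℕ) (h2 : d ≠ 2) (h3 : d ≠ 3) : extendOps i E d = 0 := by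
  match d with
  | 0 | 1 => rfl
  | 2 => exact absurd rfl h2
  | 3 => exact absurd rfl h3
  | d + 4 => rfl

lemma extendOps_mem_preNat (i : Inner N)
    {E : (Fin 3 → Fin (N + 1)) → (Fin 2 → k[X]) → Mat k N} (hl : ∀ v, IsMultilin k (E v))
    (hm : ∀ v a, E v a ∈ BHom k i (v 0) (v 2) 0) :
    extendOps i E ∈ PreNat idF (braidF i) 2 := by
  intro d v
  by_cases h2 : d = 2
  · subst h2
    exact ⟨hl v, fun a => hom_degree (by norm_num) (hm v a)⟩
  by_cases h3 : d = 3
  · subst h3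
    refine ⟨?_, fun a => ?_⟩
    · exact (homotopyRHS_multilin i (η := extendOps i E) hl v).linear_comp
        (deltaInv k i (v 0) (v 3))
    · exact hom_degree (by norm_num) (deltaInv_mem i (v 0) (v 3) _)
  · rw [extendOps_of_ne i E d h2 h3]
    exact ⟨isMultilin_zero, fun a => Submodule.zero_mem _⟩

lemma extendOps_delta (i : Inner N)
    {E : (Fin 3 → Fin (N + 1)) → (Fin 2 → k[X]) → Mat k N}
    (hm : ∀ v a, E v a ∈ BHom k i (v 0) (v 2) 0)
    (hc : bimodDiff k N (underlying i 2 (extendOps i E)) 3 = 0) (v : Fin 4 → Fin (N + 1))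
    (a : Fin 3 → k[X]) :
    ((braidF i).obj (v 3)).dot ((braidF i).obj (v 3)).diff (extendOps i E 3 v a) =
      homotopyRHS i (extendOps i E) v a := by
  rw [extendOps_three]
  refine delta_deltaInv (homotopyRHS_mem (η := extendOps i E) hm v a) ?_
  rw [proj_homotopyRHS (η := extendOps i E) hm, hc]
  simp

/-- For degree reasons the differential can be nonzero only in lengths three and four. Length three
is the homotopy equation, solvable because the underlying cochain is a cocycle, and length four
follows from it. -/
lemma extendOps_mem_natTrans (i : Inner N)
    {E : (Fin 3 → Fin (N + 1)) → (Fin 2 → k[X]) → Mat k N} (hl : ∀ v, IsMultilin k (E v))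
    (hm : ∀ v a, E v a ∈ BHom k i (v 0) (v 2) 0)
    (hc : bimodDiff k N (underlying i 2 (extendOps i E)) 3 = 0) :
    extendOps i E ∈ NatTrans idF (braidF i) 2 := by
  have hp := extendOps_mem_preNat i hl hm
  have hδ := extendOps_delta i hm hc
  refine ⟨hp, ?_⟩
  rw [SetLike.mem_coe, LinearMap.mem_ker]
  funext d
  by_cases h3 : d = 3
  · subst h3
    funext v a
    rw [natDiff_two_three i rfl rfl, hδ, sub_self]
    rfl
  by_cases h4 : d = 4
  · subst h4
    exact natDiff_two_four_eq_zero hp hδ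
  · exact natDiff_eq_zero hp d (by omega) (by omega)

/-! ### Coboundaries -/

lemma natTrans_delta {i : Inner N} {η : Ops k N (Mat k N)} (h : η ∈ NatTrans idF (braidF i) 2)
    (v : Fin 4 → Fin (N + 1)) (a : Fin 3 → k[X]) :
    ((braidF i).obj (v 3)).dot ((braidF i).obj (v 3)).diff (η 3 v a) = homotopyRHS i η v a := by
  have h0 := preNat_eq_zero h.1 0 (by decide) (by decide)
  have h1 := preNat_eq_zero h.1 1 (by decide) (by decide)
  have hk : natDiff idF (braidF i) 2 η = 0 := LinearMap.mem_ker.1 h.2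
  have := natDiff_two_three i h0 h1 v a
  rw [hk] at this
  exact (sub_eq_zero.1 this.symm).symm

/-- In both families δ of the component of length three is given by the homotopy equation in terms
of the component of length two, and δ is injective. Agreement in length two is therefore enough. -/
lemma eq_natDiff_of_two {i : Inner N} {η ζ : Ops k N (Mat k N)}
    (h : η ∈ NatTrans idF (braidF i) 2) (hζ : ζ ∈ PreNat idF (braidF i) 1)
    (h2 : natDiff idF (braidF i) 1 ζ 2 = η 2) : natDiff idF (braidF i) 1 ζ = η := by
  funext d
  by_cases d2 : d = 2
  · subst d2; exact h2
  by_cases d3 : d = 3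
  · subst d3
    funext v a
    rw [← sub_eq_zero]
    refine eq_zero_of_delta_eq_zero (i := i) (p := v 0) (l := v 3) (Submodule.sub_mem _
      (hom_degree (by norm_num) (natDiff_mem_hom i 1 (preNat_mem_hom hζ) 3 v a))
      (hom_degree (by norm_num) (preNat_mem_hom h.1 3 v a))) ?_
    rw [dot_sub_right, natTrans_delta h, ← homotopyRHS_natDiff hζ, sub_eq_zero]
    simp only [homotopyRHS, h2]
  · rw [natDiff_eq_zero hζ d (by omega) (by omega), preNat_eq_zero h.1 d (by omega) (by omega)]

lemma natDiff_one_two_sub (i : Inner N) {ζ ζ' : Ops k N (Mat k N)} (h0 : ζ 0 = 0) (h0' : ζ' 0 = 0)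
    (h1 : ζ 1 = ζ' 1) (h2 : ζ' 2 = 0) (v : Fin 3 → Fin (N + 1)) (a : Fin 2 → k[X]) :
    natDiff idF (braidF i) 1 ζ 2 v a = natDiff idF (braidF i) 1 ζ' 2 v a
      - ((braidF i).obj (v 2)).dot ((braidF i).obj (v 2)).diff (ζ 2 v a) := by
  rw [natDiff_one_two i h0, natDiff_one_two i h0', h1, h2]
  simp

/-- The pre-natural transformation of degree one with `ζ¹` the lift of a Hochschild `1`-cochain
and `ζ² = 0`. -/
def liftFst (i : Inner N) (ψ : Ops k N k[X]) : Ops k N (Mat k N) :=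
  fun d => match d with
    | 1 => fun v a => projSection k i (v 0) (v 1) (ψ 1 v a)
    | _ => 0

/-- The correction of `liftFst` by `ζ²` which makes its differential agree with `η` in length two. -/
def liftOps (i : Inner N) (ψ : Ops k N k[X]) (η : Ops k N (Mat k N)) : Ops k N (Mat k N) :=
  fun d => match d with
    | 1 => liftFst i ψ 1
    | 2 => fun v a => deltaInv k i (v 0) (v 2)
        (natDiff idF (braidF i) 1 (liftFst i ψ) 2 v a - η 2 v a)
    | _ => 0

lemma liftOps_two (i : Inner N) (ψ : Ops k N k[X]) (η : Ops k N (Mat k N))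
    (v : Fin 3 → Fin (N + 1)) (a : Fin 2 → k[X]) : liftOps i ψ η 2 v a =
      deltaInv k i (v 0) (v 2) (natDiff idF (braidF i) 1 (liftFst i ψ) 2 v a - η 2 v a) := rfl

lemma liftFst_mem (i : Inner N) {ψ : Ops k N k[X]} (hψ : ψ ∈ BimodCochain k i 1) :
    liftFst i ψ ∈ PreNat idF (braidF i) 1 := by
  intro d v
  match d, v with
  | 0, v => exact ⟨isMultilin_zero, fun a => Submodule.zero_mem _⟩
  | 1, v =>
    exact ⟨((hψ.2 1 v).1).linear_comp (projSection k i (v 0) (v 1)),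
      fun a => hom_degree (by norm_num) (projSection_mem i (v 0) (v 1) _)⟩
  | d + 2, v => exact ⟨isMultilin_zero, fun a => Submodule.zero_mem _⟩

lemma underlying_liftFst (i : Inner N) {ψ : Ops k N k[X]} (hψ : ψ ∈ BimodCochain k i 1) :
    underlying i 1 (liftFst i ψ) = ψ := by
  funext d v a
  by_cases hd : d = 1
  · subst hd
    rw [underlying_apply]
    exact proj_projSection i (v 0) (v 1) ((hψ.2 1 v).2 a)
  · rw [underlying_of_ne i hd, hψ.1 d hd]

lemma natDiff_one_two_multilin (i : Inner N) {ζ : Ops k N (Mat k N)} (h0 : ζ 0 = 0) (h2 : ζ 2 = 0)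
    (h1 : ∀ v, IsMultilin k (ζ 1 v)) (v : Fin 3 → Fin (N + 1)) :
    IsMultilin k (natDiff idF (braidF i) 1 ζ 2 v) := by
  have e : natDiff idF (braidF i) 1 ζ 2 v = fun a =>
      ((braidF i).obj (v 1)).dot (braid1 i (v 1) (v 2) (a 1)) (ζ 1 ![v 0, v 1] ![a 0])
      + (gen (v 1)).dot (ζ 1 ![v 1, v 2] ![a 1]) (entry (slot 0 (v 1)) (slot 0 (v 0)) (a 0))
      - ζ 1 ![v 0, v 2] ![mul (v 0) (v 1) (v 2) (a 1) (a 0)] := by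
    funext a
    rw [natDiff_one_two i h0, h2]
    simp
  have la := fun w => (h1 w).linear_one.map_add
  have lc := fun w => (h1 w).linear_one.map_smul
  rw [e]
  refine isMultilin_two (F := fun x y =>
    ((braidF i).obj (v 1)).dot (braid1 i (v 1) (v 2) y) (ζ 1 ![v 0, v 1] ![x])
      + (gen (v 1)).dot (ζ 1 ![v 1, v 2] ![y]) (entry (slot 0 (v 1)) (slot 0 (v 0)) x)
      - ζ 1 ![v 0, v 2] ![mul (v 0) (v 1) (v 2) y x]) ?_ ?_
  · refine fun y => ⟨fun x x' => ?_, fun c x => ?_⟩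
    · simp only [la, entry_add, dot_add_right, mul_add_right']; abel
    · simp only [lc, entry_smul, dot_smul_right, mul_smul_right', smul_sub, smul_add]
  · refine fun y => ⟨fun x x' => ?_, fun c x => ?_⟩
    · simp only [la, braid1_add, dot_add_left, mul_add_left']; abel
    · simp only [lc, braid1_smul, dot_smul_left, mul_smul_left', smul_sub, smul_add]

lemma liftOps_mem (i : Inner N) {ψ : Ops k N k[X]} (hψ : ψ ∈ BimodCochain k i 1)
    {η : Ops k N (Mat k N)} (h : η ∈ PreNat idF (braidF i) 2) :
    liftOps i ψ η ∈ PreNat idF (braidF i) 1 := by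
  intro d v
  match d, v with
  | 0, v => exact ⟨isMultilin_zero, fun a => Submodule.zero_mem _⟩
  | 1, v => exact liftFst_mem i hψ 1 v
  | 2, v =>
    refine ⟨?_, fun a => hom_degree (by norm_num) (deltaInv_mem i (v 0) (v 2) _)⟩
    exact ((natDiff_one_two_multilin i rfl rfl (fun v => (liftFst_mem i hψ 1 v).1) v).sub
      (h 2 v).1).linear_comp (deltaInv k i (v 0) (v 2))
  | d + 3, v => exact ⟨isMultilin_zero, fun a => Submodule.zero_mem _⟩

/-- The Hochschild primitive is lifted to ζ¹ by a linear section of `proj`. The discrepancy left in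
length two is killed by `proj`, hence lies in the image of δ, and ζ² absorbs it. -/
lemma exists_natDiff_eq {i : Inner N} {η : Ops k N (Mat k N)}
    (h : η ∈ NatTrans idF (braidF i) 2) {ψ : Ops k N k[X]} (hψ : ψ ∈ BimodCochain k i 1)
    (he : underlying i 2 η = bimodDiff k N ψ) :
    ∃ ζ ∈ PreNat idF (braidF i) 1, natDiff idF (braidF i) 1 ζ = η := by
  have hp := liftFst_mem i hψ
  have hζ := liftOps_mem i hψ h.1
  refine ⟨_, hζ, eq_natDiff_of_two h hζ ?_⟩
  funext v a
  have h1 : natDiff idF (braidF i) 1 (liftFst i ψ) 2 v a - η 2 v a ∈ BHom k i (v 0) (v 2) 0 :=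
    Submodule.sub_mem _
      (hom_degree (by norm_num) (natDiff_mem_hom i 1 (preNat_mem_hom hp) 2 v a))
      (hom_degree (by norm_num) (preNat_mem_hom h.1 2 v a))
  have h2 : proj i (v 0) (v 2)
      (natDiff idF (braidF i) 1 (liftFst i ψ) 2 v a - η 2 v a) = 0 := by
    have := congrFun (congrFun (congrFun (underlying_natDiff hp) 2) v) a
    rw [underlying_liftFst i hψ, ← he, underlying_apply, underlying_apply] at this
    rw [map_sub, sub_eq_zero]
    exact this
  rw [natDiff_one_two_sub i (ζ := liftOps i ψ η) (ζ' := liftFst i ψ) rfl rfl rfl rfl, liftOps_two,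
    delta_deltaInv h1 h2, sub_sub_cancel]

end

section
variable {k : Type*} [Field k] {N : ℕ}

/-! ### The coefficients `ℭ` as a coboundary -/

/-- The sequence `2 (ϑ_0 + ⋯ + ϑ_j)`. -/
def tau (t : ℕ → k) (j : ℕ) : k := 2 * ∑ v ∈ Finset.range (j + 1), t v

/-- The sequence `2 (ϑ_0 + ⋯ + ϑ_{j-1}) + ϑ_j`. -/
def sig (t : ℕ → k) (j : ℕ) : k := 2 * ∑ v ∈ Finset.range j, t v + t j

/-- The sum of `tau` over the steps of a descending path from `p` to `q`. -/
def kap (t : ℕ → k) (p q : ℕ) : k := ∑ v ∈ Finset.Ico q p, tau t v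

lemma kap_of_le (t : ℕ → k) {p q : ℕ} (h : p ≤ q) : kap t p q = 0 := by
  rw [kap, Finset.Ico_eq_empty (by omega), Finset.sum_empty]

lemma kap_of_ge (t : ℕ → k) {p q : ℕ} (h : q ≤ p) : kap t p q =
    ∑ v ∈ Finset.range p, tau t v - ∑ v ∈ Finset.range q, tau t v :=
  Finset.sum_Ico_eq_sub _ h

lemma sig_succ (t : ℕ → k) (j : ℕ) : sig t (j + 1) = sig t j + (t (j + 1) + t j) := by
  simp only [sig, Finset.sum_range_succ]; ring

lemma sum_Ioc_eq_sig (t : ℕ → k) {p q : ℕ} (h : p ≤ q) :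
    ∑ v ∈ Finset.Ioc p q, (t v + t (v - 1)) = sig t q - sig t p := by
  induction q, h using Nat.le_induction with
  | base => simp
  | succ q h ih =>
    rw [← Finset.insert_Ioc_right_eq_Ioc_add_one (by omega), Finset.sum_insert (by simp), ih, sig_succ]
    simp; ring

lemma sum_Ico_eq_sig (t : ℕ → k) {p q : ℕ} (h : p ≤ q) :
    ∑ v ∈ Finset.Ico p q, (t v + t (v + 1)) = sig t q - sig t p := by
  induction q, h using Nat.le_induction with
  | base => simp
  | succ q h ih => rw [Finset.sum_Ico_succ_top h, ih, sig_succ]; ring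

lemma sum_down (t : ℕ → k) (β : k) (r n : ℕ) :
    ∑ x ∈ Finset.Icc 1 n, 2 * (β + x) * t (r + n - x) =
      2 * β * (∑ v ∈ Finset.range (r + n), t v - ∑ v ∈ Finset.range r, t v)
      + kap t (r + n) r - 2 * n * ∑ v ∈ Finset.range r, t v := by
  induction n generalizing r with
  | zero => simp [kap]
  | succ n ih =>
    rw [Finset.sum_Icc_succ_top (by omega)]
    have e : r + (n + 1) = r + 1 + n := by ring
    have e' : r + 1 + n - (n + 1) = r := by omega
    rw [e, ih, e', kap_of_ge t (by omega), kap_of_ge t (by omega)]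
    simp only [Finset.sum_range_succ _ r, tau]
    push_cast
    ring

lemma sum_up (t : ℕ → k) (β : k) (q n : ℕ) :
    ∑ x ∈ Finset.Icc 1 n, 2 * (β + x) * t (q + x) =
      2 * β * (∑ v ∈ Finset.range (q + n + 1), t v - ∑ v ∈ Finset.range (q + 1), t v)
      - kap t (q + n) q + 2 * n * ∑ v ∈ Finset.range (q + n + 1), t v := by
  induction n with
  | zero => simp [kap]
  | succ n ih =>
    rw [Finset.sum_Icc_succ_top (by omega), ih, kap_of_ge t (by omega), kap_of_ge t (by omega)]
    simp only [← add_assoc, Finset.sum_range_succ _ (q + n), Finset.sum_range_succ _ (q + n + 1),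
      tau]
    push_cast
    ring

/-- A descending step from `v + 1` to `v` is weighted by `tau v` and an ascending step by 0; `kap`
adds the weights along a path, and `2 sig j` is `tau (j-1) + tau j`, read with `tau (-1) = 0`. In
these terms the seven cases of ℭ become one formula, the one computed for the coboundary of `lam` in
`dlam_eq`. It holds for every sequence, without boundary conditions. -/
lemma coeffC_eq (t : ℕ → k) (β p q r : ℕ) :
    coeffC t β p q r = kap t p r - kap t q r - kap t p q + turn p q r * sig t p
      + β * (sig t p - sig t q) := by
  unfold coeffC
  split_ifs with h1 h2 h3 h4 h5 h6
  · obtain ⟨n, rfl⟩ := Nat.exists_eq_add_of_le h1.2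
    have e : turn p (r + n) r = n := by rw [turn_eq_iff]; omega
    have e1 : Finset.Ioo p r = Finset.Ioc p (r - 1) := by ext; simp; omega
    have e2 : t (r - 1) + sig t (r - 1) = 2 * ∑ v ∈ Finset.range r, t v := by
      obtain ⟨m, rfl⟩ : ∃ m, r = m + 1 := ⟨r - 1, by omega⟩
      simp only [Finset.sum_range_succ, sig, Nat.add_sub_cancel]; ring
    rw [Nat.add_sub_cancel_left, sum_down, e, e1, sum_Ioc_eq_sig t (by omega),
      kap_of_le t (p := p) (by omega), kap_of_le t (p := p) (by omega), ← add_sub_assoc, e2]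
    simp only [sig]
    ring
  · obtain ⟨n, rfl⟩ := Nat.exists_eq_add_of_le h2.1
    have e : turn p q (q + n) = n := by rw [turn_eq_iff]; omega
    have e1 : Finset.Ioo (q + n) p = Finset.Ico (q + n + 1) p := by ext; simp
    rw [Nat.add_sub_cancel_left, sum_up, e, e1, sum_Ico_eq_sig t (by omega),
      kap_of_le t (p := q) (by omega), kap_of_ge t (p := q + n) (by omega),
      kap_of_ge t (p := p) (by omega), kap_of_ge t (p := p) (by omega)]
    simp only [sig, Finset.sum_range_succ _ q]
    ring
  · obtain ⟨n, rfl⟩ := Nat.exists_eq_add_of_le h3.2.le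
    have e : turn p (p + n) r = n := by rw [turn_eq_iff]; omega
    rw [Nat.add_sub_cancel_left, sum_down, e, kap_of_le t (p := p) (q := p + n) (by omega),
      kap_of_ge t (p := p) (by omega), kap_of_ge t (p := p + n) (by omega),
      kap_of_ge t (p := p + n) (by omega)]
    simp only [sig]
    ring
  · obtain ⟨n, rfl⟩ := Nat.exists_eq_add_of_le h4.1.le
    have e : turn (q + n) q r = n := by rw [turn_eq_iff]; omega
    rw [Nat.add_sub_cancel_left, sum_up, e, kap_of_le t (p := q + n) (q := r) (by omega),
      kap_of_le t (p := q) (by omega), kap_of_ge t (p := q + n) (by omega)]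
    simp only [sig, Finset.sum_range_succ _ q, Finset.sum_range_succ _ (q + n)]
    ring
  · have e : turn p q r = 0 := by rw [turn_eq_iff]; omega
    rw [sum_Ioc_eq_sig t (by omega), e, kap_of_le t (by omega), kap_of_le t (by omega),
      kap_of_le t (by omega)]
    push_cast; ring
  · have e : turn p q r = 0 := by rw [turn_eq_iff]; omega
    rw [sum_Ico_eq_sig t (by omega), e, kap_of_ge t (by omega), kap_of_ge t (by omega),
      kap_of_ge t (by omega)]
    push_cast; ring
  · obtain rfl : p = q := by omega
    simp [kap]

/-- The first-order change of the basis morphisms `a_{qp} s^α`, as a `1`-cochain. -/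
def lam (t : ℕ → k) (p q : ℕ) : k[X] →ₗ[k] k[X] :=
  kap t p q • LinearMap.id + sig t p • (LinearMap.mulLeft k X ∘ₗ derivative)

lemma lam_apply (t : ℕ → k) (p q : ℕ) (f : k[X]) :
    lam t p q f = C (kap t p q) * f + C (sig t p) * (X * derivative f) := by
  simp [lam, smul_eq_C_mul]

/-- The coboundary of `lam`, up to sign. -/
def dlam (t : ℕ → k) (p q r : ℕ) (g f : k[X]) : k[X] :=
  lam t p r (mul p q r g f) - mul p q r (lam t q r g) f - mul p q r g (lam t p q f)

/-- The operator `X d/dX` is a derivation and multiplies `X ^ turn` by `turn`, which produces the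
term `turn * sig`. What remains of it is the difference of its scalars at the sources of `f` and
`g`, acting on `g`. -/
lemma dlam_eq (t : ℕ → k) (p q r : ℕ) (g f : k[X]) : dlam t p q r g f =
    X ^ turn p q r * f * (C (kap t p r - kap t q r - kap t p q + turn p q r * sig t p) * g
      + C (sig t p - sig t q) * (X * derivative g)) := by
  have hX : X * derivative (X ^ turn p q r : k[X]) = C ((turn p q r : ℕ) : k) * X ^ turn p q r := by
    rcases Nat.eq_zero_or_pos (turn p q r) with h | h
    · simp [h]
    · rw [derivative_X_pow, ← mul_assoc, mul_comm X, mul_assoc, ← pow_succ',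
        Nat.sub_add_cancel h]
  simp only [dlam, lam_apply, mul, derivative_mul, mul_add, add_mul, map_sub, map_add, map_mul]
  linear_combination (C (sig t p) * g * f) * hX

/-- A turn contributes a factor `X`. Without a turn, `q` lies between `p` and `r`, so `kap` is
additive and only the derivative term survives, which carries its own factor `X`. -/
lemma dlam_coeff_zero (t : ℕ → k) (p q r : ℕ) (g f : k[X]) : (dlam t p q r g f).coeff 0 = 0 := by
  rw [dlam_eq]
  rcases Nat.eq_zero_or_pos (turn p q r) with h | h
  · have e := two_mul_turn p q r
    have : kap t p r - kap t q r - kap t p q = 0 := by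
      rcases le_total p q with h1 | h1
      · rcases le_total q r with h2 | h2
        · rw [kap_of_le t h1, kap_of_le t h2, kap_of_le t (h1.trans h2)]; ring
        · obtain rfl | rfl : p = q ∨ q = r := by omega
          · simp [kap]
          · simp [kap]
      · rcases le_total q r with h2 | h2
        · obtain rfl | rfl : p = q ∨ q = r := by omega
          · simp [kap]
          · simp [kap]
        · rw [kap_of_ge t h1, kap_of_ge t h2, kap_of_ge t (h2.trans h1)]; ring
    rw [this, h]
    simp
  · obtain ⟨n, hn⟩ : ∃ n, turn p q r = n + 1 := ⟨_, (Nat.succ_pred_eq_of_pos h).symm⟩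
    rw [hn, pow_succ', mul_assoc, mul_assoc, mul_coeff_zero, coeff_X_zero, zero_mul]

/-- The Hochschild `2`-cochain with `φ(a_{rq} s^β, a_{qp} s^α) = ℭ · a_{rp} s^{α + β + δ(p,q,r) - 1}`. -/
def phi (t : ℕ → k) (p q r : ℕ) (g f : k[X]) : k[X] := divX (dlam t p q r g f)

lemma X_mul_phi (t : ℕ → k) (p q r : ℕ) (g f : k[X]) :
    X * phi t p q r g f = dlam t p q r g f :=
  X_mul_divX_of_coeff_zero (dlam_coeff_zero t p q r g f)

lemma X_mul_mul (p q r : ℕ) (g f : k[X]) : X * mul p q r g f = mul p q r (X * g) f := by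
  unfold mul; ring

lemma X_mul_mul' (p q r : ℕ) (g f : k[X]) : X * mul p q r g f = mul p q r g (X * f) := by
  unfold mul; ring

/-- After multiplication by `X`, which is injective and commutes with composition, the identity says
that a coboundary is a cocycle. -/
lemma phi_cocycle (t : ℕ → k) (p q r s : ℕ) (h g f : k[X]) :
    mul p q s (phi t q r s h g) f - phi t p r s h (mul p q r g f)
      + phi t p q s (mul q r s h g) f - mul p r s h (phi t p q r g f) = 0 := by
  refine (mul_eq_zero.1 (?_ : X * _ = 0)).resolve_left X_ne_zero
  rw [mul_sub, mul_add, mul_sub, X_mul_mul, X_mul_mul', X_mul_phi, X_mul_phi, X_mul_phi, X_mul_phi]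
  simp only [dlam, mul_sub_left, mul_sub_right, mul_mul_assoc]
  ring

lemma phi_monomial (t : ℕ → k) (p q r α β : ℕ) : phi t p q r (X ^ β) (X ^ α) =
    coeffC t β p q r • X ^ (β + α + turn p q r - 1) := by
  have hX : X * derivative (X ^ β : k[X]) = C (β : k) * X ^ β := by
    rcases Nat.eq_zero_or_pos β with h | h
    · simp [h]
    · rw [derivative_X_pow, ← mul_assoc, mul_comm X, mul_assoc, ← pow_succ',
        Nat.sub_add_cancel h]
  have e : dlam t p q r (X ^ β) (X ^ α) = coeffC t β p q r • X ^ (β + α + turn p q r) := by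
    rw [dlam_eq, coeffC_eq, hX, smul_eq_C_mul, pow_add, pow_add]
    simp only [map_add, map_mul, map_sub]
    ring
  have h0 := dlam_coeff_zero t p q r (X ^ β) (X ^ α)
  rw [phi, e, divX_smul', divX_X_pow]
  -- If the exponent is zero, `divX` gives 0 while the truncated exponent gives 1. The two agree
  -- only because the coefficient vanishes, as the absence of a constant term in `dlam` shows.
  split_ifs with h
  · rw [e, h] at h0
    simp at h0
    rw [h0, zero_smul, zero_smul]
  · rfl

end

section
variable {k : Type*} [Field k]

/-! ### Trivialization of Hochschild `2`-cocycles -/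

/-- Hochschild `2`-cocycles of the category with objects `0, …, N`, in terms of bilinear maps
`B p q r g f`, where `f : p → q` and `g : q → r`. -/
structure IsCocycle (N : ℕ) (B : ℕ → ℕ → ℕ → k[X] → k[X] → k[X]) : Prop where
  linear_fst : ∀ p q r g, IsLinearMap k (fun f => B p q r g f)
  linear_snd : ∀ p q r f, IsLinearMap k (fun g => B p q r g f)
  cocycle : ∀ p q r s, p ≤ N → q ≤ N → r ≤ N → s ≤ N → ∀ h g f,
    mul p q s (B q r s h g) f - B p r s h (mul p q r g f)
      + B p q s (mul q r s h g) f - mul p r s h (B p q r g f) = 0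

/-- `r` and `r'` are joined by an arrow. -/
def Adjacent (r r' : ℕ) : Prop := r' = r + 1 ∨ r = r' + 1

lemma isLinearMap_eq_zero {L : k[X] → k[X]} (hL : IsLinearMap k L) (h : ∀ n, L (X ^ n) = 0)
    (f : k[X]) : L f = 0 := by
  induction f using Polynomial.induction_on' with
  | add f g hf hg => rw [hL.map_add, hf, hg, add_zero]
  | monomial n a => rw [← C_mul_X_pow_eq_monomial, ← smul_eq_C_mul, hL.map_smul, h, smul_zero]

/-- A cocycle vanishes if it vanishes on pairs whose outer member is an arrow, and is normalized. -/
lemma IsCocycle.eq_zero {N : ℕ} (hN : 0 < N) {B : ℕ → ℕ → ℕ → k[X] → k[X] → k[X]}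
    (hB : IsCocycle N B) (h1 : ∀ p, p ≤ N → B p p p 1 1 = 0)
    (ha : ∀ p r r', p ≤ N → r ≤ N → r' ≤ N → Adjacent r r' → ∀ f, B p r r' 1 f = 0)
    {p q r : ℕ} (hp : p ≤ N) (hq : q ≤ N) (hr : r ≤ N) (g f : k[X]) : B p q r g f = 0 := by
  -- By the cocycle identity, the outer morphisms on which `B` vanishes against everything are
  -- closed under composition.
  have comp : ∀ q r s, q ≤ N → r ≤ N → s ≤ N → ∀ h g, (∀ p, p ≤ N → ∀ f, B p q r g f = 0) →
      (∀ p, p ≤ N → ∀ f, B p r s h f = 0) → ∀ p, p ≤ N → ∀ f, B p q s (mul q r s h g) f = 0 := by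
    intro q r s hq hr hs h g hg hh p hp f
    have := hB.cocycle p q r s hp hq hr hs h g f
    rw [hh p hp, hh q hq, hg p hp] at this
    simpa using this
  have unit : ∀ q, q ≤ N → ∀ p, p ≤ N → ∀ f, B p q q 1 f = 0 := by
    intro q hq p hp f
    have := hB.cocycle p q q q hp hq hq hq 1 1 f
    rw [h1 q hq] at this
    simpa using this
  -- A morphism `a_{rq} s^β` is `s_q^β` followed by a straight path of arrows from `q` to `r`, and
  -- no turn occurs on the way.
  have extend : ∀ β, (∀ q, q ≤ N → ∀ p, p ≤ N → ∀ f, B p q q (X ^ β) f = 0) →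
      ∀ n q r, q ≤ N → r ≤ N → (q - r) + (r - q) = n → ∀ p, p ≤ N → ∀ f,
        B p q r (X ^ β) f = 0 := by
    intro β h n
    induction n with
    | zero =>
      intro q r hq hr hn
      obtain rfl : q = r := by omega
      exact h q hq
    | succ n ih =>
      intro q r hq hr hn
      obtain ⟨s, hs, hsr, hd⟩ : ∃ s, s ≤ N ∧ Adjacent s r ∧ (q - s) + (s - q) = n := by
        rcases lt_or_ge q r with h | h
        · exact ⟨r - 1, by omega, Or.inl (by omega), by omega⟩
        · exact ⟨r + 1, by omega, Or.inr rfl, by omega⟩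
      have e := comp q s r hq hs hr 1 (X ^ β) (ih q s hq hs hd)
        (fun p hp f => ha p s r hp hs hr hsr f)
      have t : turn q s r = 0 := by
        rw [turn_eq_iff]; rcases hsr with h | h <;> omega
      simpa [mul, t] using e
  have mono : ∀ β q r, q ≤ N → r ≤ N → ∀ p, p ≤ N → ∀ f, B p q r (X ^ β) f = 0 := by
    intro β
    induction β with
    | zero =>
      intro q r hq hr
      exact extend 0 (by simpa using unit) _ q r hq hr rfl
    | succ β ih =>
      intro q r hq hr
      refine extend (β + 1) (fun q hq => ?_) _ q r hq hr rfl
      -- One more dot at `q` is gained by going to a neighbour, which exists because `N > 0`, and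
      -- returning along an arrow.
      obtain ⟨s, hs, hsq⟩ : ∃ s, s ≤ N ∧ Adjacent s q := by
        rcases Nat.eq_zero_or_pos q with h | h
        · exact ⟨1, hN, Or.inr (by omega)⟩
        · exact ⟨q - 1, by omega, Or.inl (by omega)⟩
      have e := comp q s q hq hs hq 1 (X ^ β) (ih q s hq hs)
        (fun p hp f => ha p s q hp hs hq hsq f)
      have t : turn q s q = 1 := by
        rw [turn_eq_iff]; rcases hsq with h | h <;> omega
      simpa [mul, t, pow_succ'] using e
  exact isLinearMap_eq_zero (hB.linear_snd p q r f) (fun β => mono β q r hq hr p hp f) g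

/-- The coboundary of a `1`-cochain. -/
def cobdry (ζ : ℕ → ℕ → k[X] →ₗ[k] k[X]) (p q r : ℕ) (g f : k[X]) : k[X] :=
  mul p q r (ζ q r g) f - ζ p r (mul p q r g f) + mul p q r g (ζ p q f)

lemma isCocycle_sub_cobdry {N : ℕ} {B : ℕ → ℕ → ℕ → k[X] → k[X] → k[X]} (hB : IsCocycle N B)
    (ζ : ℕ → ℕ → k[X] →ₗ[k] k[X]) :
    IsCocycle N (fun p q r g f => B p q r g f - cobdry ζ p q r g f) := by
  refine ⟨fun p q r g => ⟨?_, ?_⟩, fun p q r f => ⟨?_, ?_⟩, ?_⟩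
  · intro x y
    simp only [(hB.linear_fst p q r g).map_add, cobdry, mul_add_right', map_add]; ring
  · intro c x
    simp only [(hB.linear_fst p q r g).map_smul, cobdry, mul_smul_right', map_smul, smul_sub,
      smul_add]
  · intro x y
    simp only [(hB.linear_snd p q r f).map_add, cobdry, mul_add_left', map_add]; ring
  · intro c x
    simp only [(hB.linear_snd p q r f).map_smul, cobdry, mul_smul_left', map_smul, smul_sub,
      smul_add]
  · intro p q r s hp hq hr hs h g f
    simp only [cobdry, mul_sub_left, mul_sub_right, mul_add_left', mul_add_right', mul_mul_assoc]
    linear_combination hB.cocycle p q r s hp hq hr hs h g f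

section
variable (N : ℕ) (B : ℕ → ℕ → ℕ → k[X] → k[X] → k[X])

/-- The values on the arrows `T_r → T_{r+1}` of a trivializing cochain. -/
def arrowVal : ℕ → k[X]
  | 0 => 0
  -- The two loops at `T_{r+1}` are the same morphism, so the values on it computed through
  -- `T_{r+2}` and through `T_r` must agree. With descending arrows sent to 0, this fixes `X` times
  -- the increment, and divisibility by `X` is the obstruction.
  | r + 1 => arrowVal r + divX (B (r + 1) (r + 2) (r + 1) 1 1 - B (r + 1) r (r + 1) 1 1)

/-- The values on all arrows. -/
def arrowVal' (r r' : ℕ) : k[X] := if r' = r + 1 then arrowVal B r else 0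

/-- The value on `x · w` in terms of the value `m` on `w = a_{rp} s^α`, for the arrow
`x : T_r → T_{r'}`. -/
def arrowStep (p r r' : ℕ) (m : k[X]) (α : ℕ) : k[X] :=
  X ^ turn p r r' * (m + arrowVal' B r r' * X ^ α) - B p r r' 1 (X ^ α)

/-- The contribution of a loop `T_r → T_{r±1} → T_r`. -/
def loopVal (r : ℕ) : k[X] :=
  if r < N then X * arrowVal B r - B r (r + 1) r 1 1
  else X * arrowVal B (r - 1) - B r (r - 1) r 1 1

/-- The value on `s · w` in terms of the value `m` on `w = a_{rp} s^α`. -/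
def loopStep (p r : ℕ) (m : k[X]) (α : ℕ) : k[X] :=
  X * m + loopVal N B r * X ^ α - B p r r X (X ^ α)

/-- The values on `s_p^α`. -/
def baseVal (p : ℕ) : ℕ → k[X]
  | 0 => B p p p 1 1
  | α + 1 => loopStep N B p p (baseVal p α) α

/-- The neighbour of `r` in the direction of `p`. -/
def closer (p r : ℕ) : ℕ := if p < r then r - 1 else r + 1

/-- The values on `a_{rp} s^α`, by recursion on the distance `n` of `p` and `r`. -/
def pathVal (p : ℕ) : ℕ → ℕ → ℕ → k[X]
  | 0, _, α => baseVal N B p α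
  | n + 1, r, α => arrowStep B p (closer p r) r (pathVal p n (closer p r) α) α

/-- The values on `a_{rp} s^α`. -/
def trivVal (p r α : ℕ) : k[X] := pathVal N B p ((p - r) + (r - p)) r α

end

/-! ### Consistency of the trivializing cochain -/

section
variable {N : ℕ} {B : ℕ → ℕ → ℕ → k[X] → k[X] → k[X]}

/-- The value forced on `s_r` does not depend on the neighbour through which the loop runs. Only an
inner vertex has two neighbours, and there the choice of `arrowVal` makes them agree. -/
lemma loopVal_eq (hc : ∀ r, 0 < r → r < N →
      (B r (r + 1) r 1 1 - B r (r - 1) r 1 1).coeff 0 = 0)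
    {r r' : ℕ} (hr : r ≤ N) (hr' : r' ≤ N) (ha : Adjacent r r') :
    X * (arrowVal' B r r' + arrowVal' B r' r) - B r r' r 1 1 = loopVal N B r := by
  unfold arrowVal' loopVal
  rcases ha with rfl | rfl
  · rw [if_pos rfl, if_neg (by omega), if_pos (by omega), add_zero]
  · rw [if_neg (by omega), if_pos rfl, zero_add]
    split_ifs with h
    · have := X_mul_divX_of_coeff_zero (hc (r' + 1) (by omega) h)
      rw [Nat.add_sub_cancel] at this
      simp only [arrowVal, mul_add]
      rw [this]
      ring
    · simp

/-- Going out along an arrow and back multiplies by one dot. The cocycle identity for the two arrows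
and `s^α` matches the two-step rule with the one-step rule for the loop. Exactly one of the two
steps makes a turn with respect to `p`. -/
lemma arrowStep_arrowStep (hB : IsCocycle N B) (hc : ∀ r, 0 < r → r < N →
      (B r (r + 1) r 1 1 - B r (r - 1) r 1 1).coeff 0 = 0)
    {p r r' : ℕ} (hp : p ≤ N) (hr : r ≤ N) (hr' : r' ≤ N) (ha : Adjacent r r') (m : k[X])
    (α : ℕ) : arrowStep B p r' r (arrowStep B p r r' m α) (α + turn p r r') =
      loopStep N B p r m α := by
  have h := hB.cocycle p r r' r hp hr hr' hr 1 1 (X ^ α)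
  have t : turn r r' r = 1 := by rw [turn_eq_iff]; rcases ha with h | h <;> omega
  have t' : X ^ turn p r' r * X ^ turn p r r' = (X : k[X]) := by
    rw [← pow_add]
    have : turn p r' r + turn p r r' = 1 := by
      have h1 := two_mul_turn p r' r
      have h2 := two_mul_turn p r r'
      rcases ha with h | h <;> omega
    rw [this, pow_one]
  have e : mul p r r' 1 (X ^ α) = (X ^ (α + turn p r r') : k[X]) := by
    unfold mul; rw [pow_add]; ring
  rw [e] at h
  simp only [mul, t, mul_one, pow_one, turn_self_right, pow_zero, one_mul] at h
  unfold arrowStep loopStep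
  rw [← loopVal_eq hc hr hr' ha]
  have hp' : (X ^ (α + turn p r r') : k[X]) = X ^ α * X ^ turn p r r' := pow_add _ _ _
  linear_combination h + (m + (arrowVal' B r r' + arrowVal' B r' r) * X ^ α) * t'
    + X ^ turn p r' r * arrowVal' B r' r * hp'

lemma trivVal_self (p α : ℕ) : trivVal N B p p α = baseVal N B p α := by
  simp [trivVal, pathVal]

lemma trivVal_away {p r r' : ℕ} (ha : Adjacent r r')
    (hd : (p - r') + (r' - p) = (p - r) + (r - p) + 1) (α : ℕ) :
    trivVal N B p r' α = arrowStep B p r r' (trivVal N B p r α) α := by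
  have e : closer p r' = r := by
    unfold closer
    rcases ha with h | h <;> split_ifs <;> omega
  unfold trivVal
  rw [hd, pathVal, e]

lemma trivVal_loop (hB : IsCocycle N B) (hc : ∀ r, 0 < r → r < N →
      (B r (r + 1) r 1 1 - B r (r - 1) r 1 1).coeff 0 = 0) {p : ℕ} (hp : p ≤ N) (n : ℕ) :
    ∀ r, r ≤ N → (p - r) + (r - p) = n → ∀ α,
      trivVal N B p r (α + 1) = loopStep N B p r (trivVal N B p r α) α := by
  induction n with
  | zero =>
    intro r hr hn α
    obtain rfl : p = r := by omega
    simp [trivVal_self, baseVal]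
  | succ n ih =>
    intro r hr hn α
    obtain ⟨s, hs, ha, hd⟩ : ∃ s, s ≤ N ∧ Adjacent s r ∧ (p - s) + (s - p) = n := by
      rcases lt_or_ge p r with h | h
      · exact ⟨r - 1, by omega, Or.inl (by omega), by omega⟩
      · exact ⟨r + 1, by omega, Or.inr rfl, by omega⟩
    have t : turn p s r = 0 := by rw [turn_eq_iff]; rcases ha with h | h <;> omega
    have t' : turn p r s = 1 := by rw [turn_eq_iff]; rcases ha with h | h <;> omega
    -- With `s` the neighbour of `r` closer to `p`, the induction hypothesis at `s` says that
    -- stepping out to `r` and back to `s` adds a dot there. Stepping out once more gives the loop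
    -- at `r`.
    have e := arrowStep_arrowStep hB hc hp hs hr ha (trivVal N B p s α) α
    have e' := arrowStep_arrowStep hB hc hp hr hs ha.symm (trivVal N B p r α) α
    rw [t, add_zero, ← trivVal_away ha (by omega), ← ih s hs hd] at e
    rw [t', e, ← trivVal_away ha (by omega)] at e'
    exact e'

/-- Away from `p` this is the recursive definition. Towards `p`, the morphism at `r` is reached from
`r'` by an outward step, so the inward step closes a loop at `r'`, where the rule for loops applies.
-/
lemma trivVal_arrow (hB : IsCocycle N B) (hc : ∀ r, 0 < r → r < N →
      (B r (r + 1) r 1 1 - B r (r - 1) r 1 1).coeff 0 = 0) {p r r' : ℕ} (hp : p ≤ N) (hr : r ≤ N)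
    (hr' : r' ≤ N) (ha : Adjacent r r') (α : ℕ) :
    trivVal N B p r' (α + turn p r r') = arrowStep B p r r' (trivVal N B p r α) α := by
  by_cases hd : (p - r') + (r' - p) = (p - r) + (r - p) + 1
  · have t : turn p r r' = 0 := by rw [turn_eq_iff]; rcases ha with h | h <;> omega
    rw [t, add_zero, trivVal_away ha hd]
  · have t : turn p r r' = 1 := by rw [turn_eq_iff]; rcases ha with h | h <;> omega
    have t' : turn p r' r = 0 := by rw [turn_eq_iff]; rcases ha with h | h <;> omega
    have e := arrowStep_arrowStep hB hc hp hr' hr ha.symm (trivVal N B p r' α) α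
    rw [t', add_zero, ← trivVal_away ha.symm (by rcases ha with h | h <;> omega),
      ← trivVal_loop hB hc hp _ r' hr' rfl] at e
    rw [t, e]

/-- The trivializing `1`-cochain. -/
def trivCochain (N : ℕ) (B : ℕ → ℕ → ℕ → k[X] → k[X] → k[X]) (p r : ℕ) : k[X] →ₗ[k] k[X] :=
  (Polynomial.basisMonomials k).constr k (trivVal N B p r)

lemma trivCochain_X_pow (p r α : ℕ) : trivCochain N B p r (X ^ α) = trivVal N B p r α := by
  have := (Polynomial.basisMonomials k).constr_basis k (trivVal N B p r) α
  rw [coe_basisMonomials] at this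
  rwa [X_pow_eq_monomial]

/-- A `2`-cocycle without constant terms on the relations of the inner vertices is a coboundary. -/
theorem IsCocycle.eq_cobdry (hN : 0 < N) (hB : IsCocycle N B) (hc : ∀ r, 0 < r → r < N →
      (B r (r + 1) r 1 1 - B r (r - 1) r 1 1).coeff 0 = 0) {p q r : ℕ} (hp : p ≤ N) (hq : q ≤ N)
    (hr : r ≤ N) (g f : k[X]) : B p q r g f = cobdry (trivCochain N B) p q r g f := by
  have hC := isCocycle_sub_cobdry hB (trivCochain N B)
  have one : ∀ p r, trivCochain N B p r 1 = trivVal N B p r 0 := fun p r => by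
    rw [← trivCochain_X_pow, pow_zero]
  -- The difference from the coboundary is again a cocycle, so agreement on identities and on pairs
  -- with an outer arrow suffices.
  refine sub_eq_zero.1 (hC.eq_zero hN ?_ ?_ hp hq hr g f)
  · intro p hp
    simp [cobdry, one, trivVal_self, baseVal]
  · intro p r r' hp hr hr' ha
    refine isLinearMap_eq_zero (hC.linear_fst p r r' 1) fun α => ?_
    have e1 : mul p r r' 1 (X ^ α) = (X ^ (α + turn p r r') : k[X]) := by
      unfold mul; rw [pow_add]; ring
    -- The recursion starts from `B r r r 1 1` on the identity. The cocycle identity equates this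
    -- with `B r r r' 1 1`, so the two corrections cancel.
    have e2 : trivVal N B r r' 0 = arrowVal' B r r' := by
      have h1 := trivVal_arrow hB hc hr hr hr' ha 0
      have h2 := hB.cocycle r r r r' hr hr hr hr' 1 1 1
      simp only [turn_self_left, mul_one_right, sub_add_cancel, add_zero, arrowStep,
        pow_zero, one_mul, mul_one, trivVal_self, baseVal] at h1 h2
      have e : mul r r r' 1 (B r r r 1 1) = B r r r 1 1 := by simp [mul]
      rw [e] at h2
      rw [h1]
      linear_combination -h2
    simp only [cobdry]
    rw [e1, one, e2, trivCochain_X_pow, trivCochain_X_pow, trivVal_arrow hB hc hp hr hr' ha]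
    simp only [arrowStep, mul]
    ring

end
end

section
variable {k : Type*} [Field k] {N : ℕ}

/-! ### Hochschild classes of degree two -/

lemma ofNat_val {p : ℕ} (h : p ≤ N) : (Fin.ofNat (N + 1) p : ℕ) = p := by
  rw [Fin.val_ofNat, Nat.mod_eq_of_lt (by omega)]

lemma ofNat_fin (v : Fin (N + 1)) : Fin.ofNat (N + 1) (v : ℕ) = v :=
  Fin.ext (ofNat_val (by omega))

/-- A Hochschild `2`-cochain as a family of functions of two morphisms, indexed by naturals. -/
def curried (φ : Ops k N k[X]) (p q r : ℕ) (g f : k[X]) : k[X] :=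
  φ 2 ![Fin.ofNat (N + 1) p, Fin.ofNat (N + 1) q, Fin.ofNat (N + 1) r] ![f, g]

lemma curried_isCocycle {i : Inner N} {φ : Ops k N k[X]} (h : φ ∈ BimodCocycle k i 2) :
    IsCocycle N (curried φ) := by
  refine ⟨fun p q r g => (h.1.2 2 _).1.linear_fst g, fun p q r f => (h.1.2 2 _).1.linear_snd f, ?_⟩
  intro p q r s hp hq hr hs c b a
  have hk : bimodDiff k N φ = 0 := LinearMap.mem_ker.1 h.2
  have := bimodDiff_three φ ![Fin.ofNat (N + 1) p, Fin.ofNat (N + 1) q, Fin.ofNat (N + 1) r,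
    Fin.ofNat (N + 1) s] ![a, b, c]
  rw [hk] at this
  simp only [Matrix.cons_val, ofNat_val hp, ofNat_val hq, ofNat_val hr, ofNat_val hs] at this
  exact this.symm

/-- The constant terms of a Hochschild `2`-cochain on the relations of the inner vertices `j ≠ i`,
which determine the class of a cocycle. -/
def relClass (i : Inner N) : Ops k N k[X] →ₗ[k] Param k i where
  toFun φ j := (curried φ j (j + 1) j 1 1 - curried φ j (j - 1) j 1 1).coeff 0
  map_add' φ φ' := by
    funext j
    simp only [curried, Pi.add_apply, coeff_sub, coeff_add]; ring
  map_smul' c φ := by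
    funext j
    simp only [curried, Pi.smul_apply, coeff_sub, coeff_smul, RingHom.id_apply, smul_sub]

lemma relClass_apply (i : Inner N) (φ : Ops k N k[X]) (j : {j : ℕ // 0 < j ∧ j < N ∧ j ≠ i.val}) :
    relClass i φ j = (curried φ j (j + 1) j 1 1 - curried φ j (j - 1) j 1 1).coeff 0 := rfl

lemma mul_coeff_zero_of_ne {p q : ℕ} (h : p ≠ q) (g f : k[X]) : (mul p q p g f).coeff 0 = 0 := by
  obtain ⟨n, hn⟩ : ∃ n, turn p q p = n + 1 := by
    refine ⟨turn p q p - 1, ?_⟩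
    have := two_mul_turn p q p
    omega
  rw [mul, hn, pow_succ', mul_assoc, mul_assoc, mul_coeff_zero, coeff_X_zero, zero_mul]

/-- Both loops at `j` contribute the same value of the 1-cochain on `s_j`, which cancels in the
difference. All other terms contain a dot from the turn. -/
lemma relClass_bimodDiff (i : Inner N) (ψ : Ops k N k[X]) : relClass i (bimodDiff k N ψ) = 0 := by
  funext ⟨j, h0, hN, hi⟩
  rw [relClass_apply, curried, curried, bimodDiff_two, bimodDiff_two]
  have t : turn j (j + 1) j = 1 := by rw [turn_eq_iff]; omega
  have t' : turn j (j - 1) j = 1 := by rw [turn_eq_iff]; omega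
  simp only [Matrix.cons_val, ofNat_val hN.le, ofNat_val (Nat.succ_le_of_lt hN),
    ofNat_val (show j - 1 ≤ N by omega), coeff_sub, coeff_add,
    mul_coeff_zero_of_ne (show j ≠ j + 1 by omega), mul_coeff_zero_of_ne (show j ≠ j - 1 by omega)]
  simp [mul, t, t']

/-- The Hochschild `1`-cochain given by a family of linear maps. -/
def ofLinear (ζ : ℕ → ℕ → k[X] →ₗ[k] k[X]) : Ops k N k[X] :=
  fun d => match d with
    | 1 => fun v a => ζ (v 0) (v 1) (a 0)
    | _ => 0

/-- The trivialization is built in the diagonal bimodule, and this shows that it takes values in 𝔅.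
The condition at (1, 1) handles `e_i`; a multiple of `s_i` factors through `T_{i+1}`, and all terms
of the coboundary except the one in question then carry a dot. -/
lemma cobdry_mem {i : Inner N} {ζ : ℕ → ℕ → k[X] →ₗ[k] k[X]}
    (h : ∀ q, q ≤ N → ∀ g f, (cobdry ζ i.val q i.val g f).coeff 0 = 0) (f : k[X]) :
    (ζ i.val i.val f).coeff 0 = 0 := by
  have hi := i.lt
  have h1 : (ζ i.val i.val 1).coeff 0 = 0 := by
    simpa [cobdry] using h i.val hi.le 1 1
  have hX : ∀ f, (ζ i.val i.val (X * f)).coeff 0 = 0 := by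
    intro f
    have t : turn i.val (i.val + 1) i.val = 1 := by rw [turn_eq_iff]; omega
    have e := h (i.val + 1) hi 1 f
    have e' : mul i.val (i.val + 1) i.val 1 f = X * f := by simp [mul, t]
    simp only [cobdry, coeff_add, coeff_sub, mul_coeff_zero_of_ne (show i.val ≠ i.val + 1 by omega),
      e'] at e
    simpa using e
  rw [← X_mul_divX_add f, map_add, coeff_add, hX, ← mul_one (C (f.coeff 0)), ← smul_eq_C_mul,
    map_smul, coeff_smul, h1]
  simp

/-- At an inner vertex other than `i` the obstruction is a coordinate of `relClass`. At `i` it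
vanishes by itself, as values of the cocycle on loops lie in 𝔅. -/
lemma exists_bimodDiff_eq {i : Inner N} {φ : Ops k N k[X]} (h : φ ∈ BimodCocycle k i 2)
    (hr : relClass i φ = 0) : ∃ ψ ∈ BimodCochain k i 1, bimodDiff k N ψ = φ := by
  have hB := curried_isCocycle h
  have hi : ∀ q g f, (curried φ i.val q i.val g f).coeff 0 = 0 := fun q g f =>
    (h.1.2 2 _).2 _ (ofNat_fin i.mid) (ofNat_fin i.mid)
  have hc : ∀ r, 0 < r → r < N →
      (curried φ r (r + 1) r 1 1 - curried φ r (r - 1) r 1 1).coeff 0 = 0 := by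
    intro r h0 hN
    by_cases hri : r = i.val
    · subst hri
      rw [coeff_sub, hi, hi, sub_zero]
    · exact congrFun hr ⟨r, h0, hN, hri⟩
  have hpos : 0 < N := i.pos.trans i.lt
  have hζ := fun p q r hp hq hr g f =>
    hB.eq_cobdry hpos hc (p := p) (q := q) (r := r) hp hq hr g f
  set ζ := trivCochain N (curried φ)
  have hz : ∀ d, d ≠ 1 → (ofLinear ζ : Ops k N k[X]) d = 0 := by
    intro d hd
    match d with
    | 0 => rfl
    | 1 => exact absurd rfl hd
    | d + 2 => rfl
  refine ⟨ofLinear ζ, ⟨hz, fun d v => ?_⟩, ?_⟩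
  · by_cases hd : d = 1
    · subst hd
      refine ⟨isMultilin_one (ζ (v 0) (v 1)), fun a h0 h1 => ?_⟩
      change (ζ (v 0) (v 1) (a 0)).coeff 0 = 0
      have h1' : v 1 = i.mid := h1
      rw [h0, h1']
      refine cobdry_mem (i := i) (fun q hq g f => ?_) _
      rw [← hζ _ _ _ i.lt.le hq i.lt.le]
      exact hi q g f
    · rw [hz d hd]
      exact ⟨isMultilin_zero, fun a => Submodule.zero_mem _⟩
  · funext d
    by_cases hd : d = 2
    · subst hd
      funext v a
      have e := hζ (v 0) (v 1) (v 2) (by omega) (by omega) (by omega) (a 1) (a 0)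
      rw [curried, ofNat_fin, ofNat_fin, ofNat_fin, ← vec3 v, ← vec2 a] at e
      rw [bimodDiff_two, e]
      rfl
    · rw [bimodDiff_eq_zero hz hd, h.1.1 d hd]

end

section
variable {k : Type*} [Field k] {N : ℕ}

/-! ### The natural transformations `η_ϑ` -/

lemma lam_add (t t' : ℕ → k) (p q : ℕ) : lam (t + t') p q = lam t p q + lam t' p q := by
  have e1 : kap (t + t') p q = kap t p q + kap t' p q := by
    simp only [kap, tau, Pi.add_apply, Finset.sum_add_distrib, mul_add]
  have e2 : sig (t + t') p = sig t p + sig t' p := by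
    simp only [sig, Pi.add_apply, Finset.sum_add_distrib]; ring
  simp only [lam, e1, e2, add_smul]; abel

lemma lam_smul (c : k) (t : ℕ → k) (p q : ℕ) : lam (c • t) p q = c • lam t p q := by
  have e1 : kap (c • t) p q = c * kap t p q := by
    simp only [kap, tau, Pi.smul_apply, smul_eq_mul, ← Finset.mul_sum]
    ring
  have e2 : sig (c • t) p = c * sig t p := by
    simp only [sig, Pi.smul_apply, smul_eq_mul, ← Finset.mul_sum]; ring
  simp only [lam, e1, e2, mul_smul, smul_add]

lemma phi_add (t t' : ℕ → k) (p q r : ℕ) (g f : k[X]) :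
    phi (t + t') p q r g f = phi t p q r g f + phi t' p q r g f := by
  unfold phi dlam
  rw [← divX_add]
  refine congrArg divX ?_
  simp only [lam_add, LinearMap.add_apply, mul_add_left', mul_add_right']; ring

lemma phi_smul (c : k) (t : ℕ → k) (p q r : ℕ) (g f : k[X]) :
    phi (c • t) p q r g f = c • phi t p q r g f := by
  unfold phi dlam
  rw [← divX_smul']
  refine congrArg divX ?_
  simp only [lam_smul, LinearMap.smul_apply, mul_smul_left', mul_smul_right', smul_sub]

lemma phi_linear_fst (t : ℕ → k) (p q r : ℕ) (g : k[X]) :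
    IsLinearMap k (fun f => phi t p q r g f) := by
  constructor
  · intro f f'
    unfold phi dlam
    rw [← divX_add]
    refine congrArg divX ?_
    simp only [map_add, mul_add_right']; ring
  · intro c f
    unfold phi dlam
    rw [← divX_smul']
    refine congrArg divX ?_
    simp only [map_smul, mul_smul_right', smul_sub]

lemma phi_linear_snd (t : ℕ → k) (p q r : ℕ) (f : k[X]) :
    IsLinearMap k (fun g => phi t p q r g f) := by
  constructor
  · intro g g'
    unfold phi dlam
    rw [← divX_add]
    refine congrArg divX ?_
    simp only [map_add, mul_add_left']; ring
  · intro c g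
    unfold phi dlam
    rw [← divX_smul']
    refine congrArg divX ?_
    simp only [map_smul, mul_smul_left', smul_sub]

/-- This is where ϑ_i = 0 is needed: the coefficients of the short loops through `i + 1` and `i - 1`
are -ϑ_i and ϑ_i. A longer loop creates at least two dots, so one survives the division by `X`. -/
lemma phi_coeff_zero {t : ℕ → k} {i : ℕ} (ht : t i = 0) (q : ℕ) (g f : k[X]) :
    (phi t i q i g f).coeff 0 = 0 := by
  rw [phi, coeff_divX, dlam_eq]
  have e := two_mul_turn i q i
  rcases Nat.lt_or_ge 1 (turn i q i) with h | h
  · obtain ⟨n, hn⟩ : ∃ n, turn i q i = n + 2 := ⟨turn i q i - 2, by omega⟩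
    rw [hn, pow_succ', pow_succ', mul_assoc, mul_assoc, mul_assoc, coeff_X_mul, mul_coeff_zero,
      coeff_X_zero, zero_mul]
  · have e0 : kap t i i - kap t q i - kap t i q + turn i q i * sig t i = 0 := by
      obtain rfl | rfl | rfl : q = i ∨ q = i + 1 ∨ i = q + 1 := by omega
      · simp [kap]
      · have : turn i (i + 1) i = 1 := by omega
        rw [this, kap_of_le t le_rfl, kap_of_le t (p := i) (by omega)]
        simp [kap, tau, sig, Finset.sum_range_succ, ht]
      · have : turn (q + 1) q (q + 1) = 1 := by omega
        rw [this, kap_of_le t le_rfl, kap_of_le t (p := q) (by omega)]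
        simp [kap, tau, sig, ht]
    rw [e0, map_zero, zero_mul, zero_add]
    rcases Nat.eq_zero_or_pos (turn i q i) with h0 | h0
    · obtain rfl : q = i := by omega
      simp
    · have h1 : turn i q i = 1 := by omega
      rw [h1, pow_one, mul_assoc, coeff_X_mul]
      simp [mul_coeff_zero]

/-- The degree zero morphism `T_p → β_i⁻ T_r` over an element of the diagonal bimodule: it has one
component, except for `p = r = i`, where it has two equal ones. -/
def spread (k : Type*) [Field k] (i : Inner N) (p r : Fin (N + 1)) : k[X] →ₗ[k] Mat k N where
  toFun f :=
    if r ≠ i.mid then entry (slot 0 r) (slot 0 p) f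
    else if p ≠ i.mid then entry (slot 0 (i.toward p)) (slot 0 p) f
    else entry (slot 0 i.left) (slot 0 p) ((1 / 2 : k) • divX f)
      + entry (slot 0 i.right) (slot 0 p) ((1 / 2 : k) • divX f)
  map_add' f g := by
    split_ifs <;> simp only [entry_add, divX_add, smul_add]
    abel
  map_smul' c f := by
    split_ifs <;> simp only [entry_smul, divX_smul', smul_add, RingHom.id_apply, smul_comm c]

lemma spread_of_ne {i : Inner N} (p : Fin (N + 1)) {r : Fin (N + 1)} (hr : r ≠ i.mid) (f : k[X]) :
    spread k i p r f = entry (slot 0 r) (slot 0 p) f := by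
  simp [spread, hr]

lemma spread_to_mid {i : Inner N} {p : Fin (N + 1)} (hp : p ≠ i.mid) (f : k[X]) :
    spread k i p i.mid f = entry (slot 0 (i.toward p)) (slot 0 p) f := by
  simp [spread, hp]

lemma spread_mid (i : Inner N) (f : k[X]) : spread k i i.mid i.mid f =
    entry (slot 0 i.left) (slot 0 i.mid) ((1 / 2 : k) • divX f)
      + entry (slot 0 i.right) (slot 0 i.mid) ((1 / 2 : k) • divX f) := by
  simp [spread]

lemma spread_mem (i : Inner N) (p r : Fin (N + 1)) (f : k[X]) :
    spread k i p r f ∈ BHom k i p r 0 := by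
  by_cases hr : r = i.mid
  · subst hr
    unfold BHom
    rw [braidF_obj_mid]
    rcases i.trichotomy p with ⟨hp, hp'⟩ | rfl | ⟨hp, hp'⟩
    · rw [spread_to_mid hp', i.toward_of_lt hp]
      apply entry_mem <;> simp
    · rw [spread_mid]
      apply Submodule.add_mem <;> apply entry_mem <;> simp
    · rw [spread_to_mid hp', i.toward_of_gt hp]
      apply entry_mem <;> simp
  · unfold BHom
    rw [spread_of_ne p hr, braidF_obj_of_ne i hr]
    apply entry_mem <;> simp

lemma proj_spread (h2 : (2 : k) ≠ 0) (i : Inner N) (p r : Fin (N + 1)) {f : k[X]}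
    (hf : p = i.mid → r = i.mid → f.coeff 0 = 0) : proj i p r (spread k i p r f) = f := by
  by_cases hr : r = i.mid
  · subst hr
    rcases i.trichotomy p with ⟨hp, hp'⟩ | rfl | ⟨hp, hp'⟩
    · rw [spread_to_mid hp', i.toward_of_lt hp, proj_left, turn_left_of_le i hp]
      simp
    · rw [spread_mid, map_add, proj_left, proj_right, i.mid_val, turn_left_of_ge i le_rfl,
        turn_right_of_le i le_rfl, pow_one, ← mul_add, ← add_smul]
      rw [show (1 / 2 + 1 / 2 : k) = 1 by field_simp; norm_num, one_smul]
      exact X_mul_divX_of_coeff_zero (hf rfl rfl)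
    · rw [spread_to_mid hp', i.toward_of_gt hp, proj_right, turn_right_of_ge i hp]
      simp
  · rw [spread_of_ne p hr, proj_of_ne p hr]

/-- The component `η²_ϑ`. -/
def etaTwo (i : Inner N) (ϑ : Param k i) (v : Fin 3 → Fin (N + 1)) (a : Fin 2 → k[X]) : Mat k N :=
  spread k i (v 0) (v 2) (phi ϑ.ext (v 0) (v 1) (v 2) (a 1) (a 0))

lemma etaTwo_multilin (i : Inner N) (ϑ : Param k i) (v : Fin 3 → Fin (N + 1)) :
    IsMultilin k (etaTwo i ϑ v) :=
  (isMultilin_two (F := fun x y => phi ϑ.ext (v 0) (v 1) (v 2) y x)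
    (fun y => phi_linear_fst _ _ _ _ y) (fun x => phi_linear_snd _ _ _ _ x)).linear_comp
    (spread k i (v 0) (v 2))

lemma etaTwo_mem (i : Inner N) (ϑ : Param k i) (v : Fin 3 → Fin (N + 1)) (a : Fin 2 → k[X]) :
    etaTwo i ϑ v a ∈ BHom k i (v 0) (v 2) 0 := spread_mem i _ _ _

lemma ext_mid {i : Inner N} (ϑ : Param k i) : ϑ.ext i.val = 0 := by simp [Param.ext]

lemma ext_zero {i : Inner N} (ϑ : Param k i) : ϑ.ext 0 = 0 := by simp [Param.ext]

lemma ext_add {i : Inner N} (ϑ ϑ' : Param k i) : (ϑ + ϑ').ext = ϑ.ext + ϑ'.ext := by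
  funext j
  simp only [Param.ext, Pi.add_apply]
  split_ifs <;> simp

lemma ext_smul {i : Inner N} (c : k) (ϑ : Param k i) : (c • ϑ).ext = c • ϑ.ext := by
  funext j
  simp only [Param.ext, Pi.smul_apply]
  split_ifs <;> simp

lemma underlying_etaTwo (h2 : (2 : k) ≠ 0) (i : Inner N) (ϑ : Param k i)
    (v : Fin 3 → Fin (N + 1)) (a : Fin 2 → k[X]) :
    underlying i 2 (extendOps i (etaTwo i ϑ)) 2 v a =
      phi ϑ.ext (v 0) (v 1) (v 2) (a 1) (a 0) := by
  rw [underlying_apply]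
  refine proj_spread h2 i (v 0) (v 2) fun h0 h2 => ?_
  rw [h0, h2]
  exact phi_coeff_zero (ext_mid ϑ) _ _ _

lemma bimodDiff_etaTwo (h2 : (2 : k) ≠ 0) (i : Inner N) (ϑ : Param k i) :
    bimodDiff k N (underlying i 2 (extendOps i (etaTwo i ϑ))) 3 = 0 := by
  funext v a
  rw [bimodDiff_three]
  simp only [underlying_etaTwo h2, Matrix.cons_val]
  exact phi_cocycle _ _ _ _ _ _ _ _

lemma homotopyRHS_add (i : Inner N) (η η' : Ops k N (Mat k N)) :
    homotopyRHS i (η + η') = homotopyRHS i η + homotopyRHS i η' := by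
  funext v a
  simp only [homotopyRHS, Pi.add_apply, dot_add_left, dot_add_right]
  abel

lemma homotopyRHS_smul (i : Inner N) (c : k) (η : Ops k N (Mat k N)) :
    homotopyRHS i (c • η) = c • homotopyRHS i η := by
  funext v a
  simp only [homotopyRHS, Pi.smul_apply, dot_smul_left, dot_smul_right, smul_add, smul_sub]

lemma homotopyRHS_congr (i : Inner N) {η η' : Ops k N (Mat k N)} (h : η 2 = η' 2) :
    homotopyRHS i η = homotopyRHS i η' := by
  funext v a
  simp only [homotopyRHS, h]

lemma extendOps_add (i : Inner N) (E E' : (Fin 3 → Fin (N + 1)) → (Fin 2 → k[X]) → Mat k N) :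
    extendOps i (E + E') = extendOps i E + extendOps i E' := by
  funext d
  by_cases h2 : d = 2
  · subst h2; rfl
  by_cases h3 : d = 3
  · subst h3
    funext v a
    simp only [Pi.add_apply]
    rw [extendOps_three, extendOps_three, extendOps_three, ← map_add,
      homotopyRHS_congr i (η := extendOps i (E + E')) (η' := extendOps i E + extendOps i E') rfl, homotopyRHS_add]
    rfl
  · rw [Pi.add_apply, extendOps_of_ne i _ d h2 h3, extendOps_of_ne i _ d h2 h3,
      extendOps_of_ne i _ d h2 h3, add_zero]

lemma extendOps_smul (i : Inner N) (c : k)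
    (E : (Fin 3 → Fin (N + 1)) → (Fin 2 → k[X]) → Mat k N) :
    extendOps i (c • E) = c • extendOps i E := by
  funext d
  by_cases h2 : d = 2
  · subst h2; rfl
  by_cases h3 : d = 3
  · subst h3
    funext v a
    simp only [Pi.smul_apply]
    rw [extendOps_three, extendOps_three, ← map_smul,
      homotopyRHS_congr i (η := extendOps i (c • E)) (η' := c • extendOps i E) rfl, homotopyRHS_smul]
    rfl
  · rw [Pi.smul_apply, extendOps_of_ne i _ d h2 h3, extendOps_of_ne i _ d h2 h3, smul_zero]

/-- The natural transformations `η_ϑ`. -/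
def eta (h2 : (2 : k) ≠ 0) (i : Inner N) :
    Param k i →ₗ[k] NatTrans (idF (k := k)) (braidF i) 2 where
  toFun ϑ := ⟨extendOps i (etaTwo i ϑ), extendOps_mem_natTrans i (etaTwo_multilin i ϑ)
    (etaTwo_mem i ϑ) (bimodDiff_etaTwo h2 i ϑ)⟩
  map_add' ϑ ϑ' := by
    apply Subtype.ext
    change extendOps i _ = extendOps i _ + extendOps i _
    rw [← extendOps_add]
    refine congrArg (extendOps i) ?_
    funext v a
    simp only [etaTwo, ext_add, phi_add, map_add, Pi.add_apply]
  map_smul' c ϑ := by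
    apply Subtype.ext
    change extendOps i _ = c • extendOps i _
    rw [← extendOps_smul]
    refine congrArg (extendOps i) ?_
    funext v a
    simp only [etaTwo, ext_smul, phi_smul, map_smul, Pi.smul_apply]

lemma eta_coe (h2 : (2 : k) ≠ 0) (i : Inner N) (ϑ : Param k i) :
    (eta h2 i ϑ : Ops k N (Mat k N)) = extendOps i (etaTwo i ϑ) := rfl

lemma eta_hasComponents (h2 : (2 : k) ≠ 0) (i : Inner N) (ϑ : Param k i) :
    HasComponents i ϑ (eta h2 i ϑ) := by
  rw [eta_coe]
  refine ⟨fun d hd hd' => extendOps_of_ne i _ d hd hd', fun v α β => ?_, fun v a hv => ?_,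
    fun v a hv => ?_⟩
  · change spread k i (v 0) (v 2) (phi ϑ.ext (v 0) (v 1) (v 2) (X ^ β) (X ^ α)) = _
    rw [phi_monomial]
    unfold eta2
    dsimp only
    by_cases hr : v 2 = i.mid
    · rw [if_neg (not_not.2 hr), hr]
      by_cases hp : v 0 = i.mid
      · rw [if_neg (not_not.2 hp), hp, spread_mid, divX_smul', divX_X_pow, smul_smul,
          one_div_mul_eq_div]
        -- When the exponent of `X` in `phi` is zero, `divX` gives 0 but the truncated exponent in
        -- `eta2` gives 1. The coefficient is then zero, since `phi` has no constant term on loops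
        -- at `i`.
        split_ifs with h
        · rw [i.mid_val] at h ⊢
          have h0 := phi_coeff_zero (ext_mid ϑ) (v 1) (X ^ β) (X ^ α)
          rw [phi_monomial, h, pow_zero, coeff_smul, coeff_one_zero, smul_eq_mul, mul_one] at h0
          rw [h0]
          simp
        · rfl
      · rw [if_pos hp, spread_to_mid hp]
    · rw [if_pos hr, spread_of_ne _ hr]
  · rw [extendOps_three, deltaInv_of_ne i _ hv]
  · have := extendOps_delta i (etaTwo_mem i ϑ) (bimodDiff_etaTwo h2 i ϑ) v a
    rw [hv, braidF_obj_mid] at this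
    exact this

end

section
variable {k : Type*} [Field k] {N : ℕ}

/-! ### The third component is nontrivial -/

lemma eval_one_mul (p q r : ℕ) (g f : k[X]) : (mul p q r g f).eval 1 = g.eval 1 * f.eval 1 := by
  simp [mul]

lemma eval_one_phi (t : ℕ → k) (p q r β α : ℕ) :
    (phi t p q r (X ^ β) (X ^ α)).eval 1 = coeffC t β p q r := by
  rw [phi_monomial]; simp

lemma spread_to_mid_apply {i : Inner N} {p : Fin (N + 1)} (hp : p ≠ i.mid) {r : Fin (N + 1)}
    (hr : i.toward p ≠ r) (f : k[X]) : spread k i p i.mid f (slot 0 r) (slot 0 p) = 0 := by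
  rw [spread_to_mid hp, entry_apply, if_neg]
  rintro ⟨h, -⟩
  exact hr (slot_inj.1 h).2

lemma toward_left (i : Inner N) : i.toward i.left = i.left :=
  i.toward_of_lt (by have := i.pos; simp; omega)

lemma toward_right (i : Inner N) : i.toward i.right = i.right :=
  i.toward_of_gt (by simp)

lemma toward_eq (i : Inner N) (p : Fin (N + 1)) : i.toward p = i.left ∨ i.toward p = i.right := by
  unfold Inner.toward
  split_ifs <;> simp

/-- With `p` and `q` on opposite sides of `i`, the two terms of η² that start at `p` and end at
`T_i` lie in the summand on the side of `p`. The summand on the side of `q` therefore sees at most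
the two products. Evaluating at 1 forgets the powers of `X` and leaves the coefficients. -/
lemma homotopyRHS_etaTwo (i : Inner N) (ϑ : Param k i) {p q : Fin (N + 1)}
    (hp : p ≠ i.mid) (hq : q ≠ i.mid) (hpq : i.toward p ≠ i.toward q) (l : Fin (N + 1))
    (b c : ℕ) :
    (homotopyRHS i (extendOps i (etaTwo i ϑ)) ![p, q, l, i.mid] ![X ^ 0, X ^ b, X ^ c]
      (slot 0 (i.toward q)) (slot 0 p)).eval 1 =
      (if l ≠ i.mid ∧ i.toward l = i.toward q then coeffC ϑ.ext b p q l else 0)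
        - coeffC ϑ.ext c q l i.val := by
  change ((((braidF i).obj l).dot (braid1 i l i.mid (X ^ c))
      (spread k i p l (phi ϑ.ext p q l (X ^ b) (X ^ 0)))
    - (gen q).dot (spread k i q i.mid (phi ϑ.ext q l i.mid (X ^ c) (X ^ b)))
      (entry (slot 0 q) (slot 0 p) (X ^ 0))
    + spread k i p i.mid (phi ϑ.ext p l i.mid (X ^ c) (mul p q l (X ^ b) (X ^ 0)))
    - spread k i p i.mid (phi ϑ.ext p q i.mid (mul q l i.mid (X ^ c) (X ^ b)) (X ^ 0)))
      (slot 0 (i.toward q)) (slot 0 p)).eval 1 = _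
  rw [Matrix.sub_apply, Matrix.add_apply, Matrix.sub_apply, spread_to_mid_apply hp hpq,
    spread_to_mid_apply hp hpq, add_zero, sub_zero, eval_sub]
  congr 1
  · by_cases hl : l = i.mid
    · subst hl
      rw [if_neg (fun h => h.1 rfl), spread_to_mid hp, braid1_mid, braidF_obj_mid]
      have hne := i.left_ne_right
      rcases toward_eq i p with h | h
      · rw [h] at hpq
        simp [h, dot_add_left, dot_entry_entry, entry_apply, hpq, hne.symm]
      · rw [h] at hpq
        simp [h, dot_add_left, dot_entry_entry, entry_apply, hpq, hne]
    · rw [spread_of_ne _ hl, braid1_to_mid _ hl, braidF_obj_of_ne i hl, dot_entry_entry,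
        if_pos ⟨rfl, by simp⟩, entry_apply]
      by_cases ht : i.toward l = i.toward q
      · rw [if_pos ⟨by rw [ht], rfl⟩, if_pos ⟨hl, ht⟩, eval_one_mul, eval_one_phi]
        simp
      · rw [if_neg (fun h => ht (slot_inj.1 h.1).2), if_neg (fun h => ht h.2), eval_zero]
  · rw [spread_to_mid hq, dot_entry_entry]
    rw [if_pos ⟨rfl, by simp⟩, entry_apply, if_pos ⟨rfl, rfl⟩, eval_one_mul, eval_one_phi]
    simp

/-- The system is triangular: `sig j` is ϑ_j plus twice the sum of the earlier terms. The equation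
missing at `i` is replaced by ϑ_i = 0. -/
lemma eq_zero_of_sig {i : Inner N} {ϑ : Param k i}
    (h : ∀ v, v ≤ N → v ≠ i.val → sig ϑ.ext v = 0) : ϑ = 0 := by
  have key : ∀ j, j ≤ N → ϑ.ext j = 0 := by
    intro j
    induction j using Nat.strong_induction_on with
    | _ j ih =>
      intro hj
      by_cases hji : j = i.val
      · rw [hji, ext_mid]
      · have e := h j hj hji
        rwa [sig, Finset.sum_eq_zero fun v hv => ih v (Finset.mem_range.1 hv)
          ((Finset.mem_range.1 hv).le.trans hj), mul_zero, zero_add] at e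
  funext ⟨j, hj⟩
  have := key j hj.2.1.le
  rwa [Param.ext, dif_pos hj] at this

lemma sig_zero {i : Inner N} (ϑ : Param k i) : sig ϑ.ext 0 = 0 := by simp [sig, ext_zero]

/-- Some vertex on the other side of the vertex `i`. -/
lemma exists_opposite (i : Inner N) (p : Fin (N + 1)) :
    ∃ q, q ≠ i.mid ∧ i.toward p ≠ i.toward q := by
  rcases toward_eq i p with h | h
  · exact ⟨i.right, by simp [Fin.ext_iff], by rw [h, toward_right]; exact i.left_ne_right⟩
  · exact ⟨i.left, by have := i.pos; simp [Fin.ext_iff]; omega,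
      by rw [h, toward_left]; exact i.left_ne_right.symm⟩

/-- By `coeffC_eq`, ℭ is affine in the number of dots on the outer morphism, with slope a difference
of two values of `sig`. Comparing zero dots with one dot makes `sig` constant away from `i`, and its
value at the vertex 0 is zero. -/
lemma eq_zero_of_homotopyRHS {i : Inner N} {ϑ : Param k i} {l : Fin (N + 1)}
    (h : ∀ v a, v 2 = l → v 3 = i.mid → homotopyRHS i (extendOps i (etaTwo i ϑ)) v a = 0) :
    ϑ = 0 := by
  have key : ∀ p q, p ≠ i.mid → q ≠ i.mid → i.toward p ≠ i.toward q → ∀ b c : ℕ,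
      (if l ≠ i.mid ∧ i.toward l = i.toward q then coeffC ϑ.ext b p q l else 0)
        = coeffC ϑ.ext c q l i.val := by
    intro p q hp hq hpq b c
    rw [← sub_eq_zero, ← homotopyRHS_etaTwo i ϑ hp hq hpq l b c, h _ _ rfl rfl]
    simp
  -- For `l = i` only the second coefficient survives, and varying `c` gives `sig q = sig i`. For
  -- other `l`, varying `b` relates any `p` on the far side of `i` to any `q` on the side of `l`.
  -- Vertices on the side of `l` are then compared through one vertex on the far side.
  have hs : ∃ s, ∀ v : Fin (N + 1), v ≠ i.mid → sig ϑ.ext v = s := by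
    by_cases hl : l = i.mid
    · refine ⟨sig ϑ.ext i.val, fun q hq => ?_⟩
      obtain ⟨p, hp, hpq⟩ := exists_opposite i q
      have e0 := key p q hp hq hpq.symm 0 0
      have e1 := key p q hp hq hpq.symm 0 1
      rw [if_neg (fun h => h.1 hl), coeffC_eq, hl, i.mid_val] at e0 e1
      push_cast at e0 e1
      linear_combination e0 - e1
    · have step : ∀ p q, p ≠ i.mid → q ≠ i.mid → i.toward p ≠ i.toward q →
          i.toward l = i.toward q → sig ϑ.ext p = sig ϑ.ext q := by
        intro p q hp hq hpq hlq
        have e0 := key p q hp hq hpq 0 0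
        have e1 := key p q hp hq hpq 1 0
        rw [if_pos ⟨hl, hlq⟩, coeffC_eq] at e0 e1
        push_cast at e0 e1
        linear_combination e1 - e0
      obtain ⟨p, hp, hlp⟩ := exists_opposite i l
      refine ⟨sig ϑ.ext l, fun v hv => ?_⟩
      by_cases hlv : i.toward l = i.toward v
      · rw [← step p v hp hv (fun e => hlp (hlv.trans e.symm)) hlv, step p l hp hl hlp.symm rfl]
      · exact step v l hv hl (Ne.symm hlv) rfl
  obtain ⟨s, hs⟩ := hs
  have h0 : s = 0 := by
    rw [← hs 0 (fun e => i.pos.ne (congrArg Fin.val e)), ← sig_zero ϑ]; rfl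
  refine eq_zero_of_sig fun v hv hvi => ?_
  rw [← h0, ← hs ⟨v, by omega⟩ (fun e => hvi (congrArg Fin.val e))]

/-! ### Cohomology classes -/

lemma underlying_cocycle {i : Inner N} {η : Ops k N (Mat k N)}
    (h : η ∈ NatTrans idF (braidF i) 2) : underlying i 2 η ∈ BimodCocycle k i 2 := by
  refine ⟨underlying_mem i 2 h.1, ?_⟩
  rw [SetLike.mem_coe, LinearMap.mem_ker]
  funext d
  by_cases hd : d = 3
  · subst hd
    funext v a
    have hm : ∀ v a, η 2 v a ∈ BHom k i (v 0) (v 2) 0 := fun v a =>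
      hom_degree (by norm_num) (preNat_mem_hom h.1 2 v a)
    have e := proj_homotopyRHS hm v a
    rw [← natTrans_delta h, proj_delta] at e
    exact neg_eq_zero.1 e.symm
  · exact bimodDiff_eq_zero (fun d hd => underlying_of_ne i hd η) hd

/-- The loops at `j` through `j + 1` and `j - 1` have coefficients `sig j - tau j = -ϑ_j` and `sig j
- tau (j-1) = ϑ_j`. -/
lemma relClass_etaTwo (h2 : (2 : k) ≠ 0) (i : Inner N) (ϑ : Param k i) :
    relClass i (underlying i 2 (extendOps i (etaTwo i ϑ))) = (-2 : k) • ϑ := by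
  funext ⟨j, h0, hN, hi⟩
  rw [relClass_apply, curried, curried, underlying_etaTwo h2, underlying_etaTwo h2]
  simp only [Matrix.cons_val, ofNat_val hN.le, ofNat_val (Nat.succ_le_of_lt hN),
    ofNat_val (show j - 1 ≤ N by omega)]
  have t : turn j (j + 1) j = 1 := by rw [turn_eq_iff]; omega
  have t' : turn j (j - 1) j = 1 := by rw [turn_eq_iff]; omega
  have e := phi_monomial ϑ.ext j (j + 1) j 0 0
  have e' := phi_monomial ϑ.ext j (j - 1) j 0 0
  simp only [t, t', pow_zero] at e e'
  obtain ⟨m, rfl⟩ : ∃ m, j = m + 1 := ⟨j - 1, by omega⟩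
  have hϑ : ϑ.ext (m + 1) = ϑ ⟨m + 1, h0, hN, hi⟩ := dif_pos ⟨h0, hN, hi⟩
  simp only [Nat.add_sub_cancel] at e' t' ⊢
  rw [e, e', coeffC_eq, coeffC_eq, t, t', kap_of_le _ le_rfl,
    kap_of_le _ (show m ≤ m + 1 by omega), kap_of_le _ (show m + 1 ≤ m + 1 + 1 by omega)]
  simp [kap, tau, sig, ← hϑ, Finset.sum_range_succ _ (m + 1)]
  ring

/-- One direction is the invariance of `relClass` under Hochschild coboundaries. For the other, the
underlying cocycle is trivialized in 𝔅 and the trivialization is lifted to transformations. -/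
lemma mem_natBoundary_iff {i : Inner N} (x : NatTrans (idF (k := k)) (braidF i) 2) :
    x ∈ NatBoundary idF (braidF i) 2 ↔ relClass i (underlying i 2 (x : Ops k N (Mat k N))) = 0 := by
  constructor
  · rintro ⟨ζ, hζ, e⟩
    have hζ' : ζ ∈ PreNat idF (braidF i) 1 := hζ
    have e' : natDiff idF (braidF i) 1 ζ = x := e
    rw [← e', underlying_natDiff hζ', relClass_bimodDiff]
  · intro h
    obtain ⟨ψ, hψ, e⟩ := exists_bimodDiff_eq (underlying_cocycle x.2) h
    obtain ⟨ζ, hζ, e'⟩ := exists_natDiff_eq x.2 hψ e.symm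
    exact ⟨ζ, hζ, e'⟩

lemma relClass_eta (h2 : (2 : k) ≠ 0) (i : Inner N) (ϑ : Param k i) :
    relClass i (underlying i 2 (eta h2 i ϑ)) = (-2 : k) • ϑ := relClass_etaTwo h2 i ϑ

lemma bijective_mk_eta (h2 : (2 : k) ≠ 0) (i : Inner N) :
    Function.Bijective (fun ϑ => HNat.mk idF (braidF i) 2 (eta h2 i ϑ)) := by
  have h2' : (-2 : k) ≠ 0 := neg_ne_zero.2 h2
  constructor
  · intro ϑ ϑ' h
    have h' : eta h2 i ϑ - eta h2 i ϑ' ∈ NatBoundary idF (braidF i) 2 :=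
      (Submodule.Quotient.eq _).1 h
    rw [← map_sub, mem_natBoundary_iff, relClass_eta, smul_eq_zero] at h'
    exact sub_eq_zero.1 (h'.resolve_left h2')
  · intro c
    obtain ⟨y, rfl⟩ := Submodule.Quotient.mk_surjective _ c
    -- The factor inverts the -2 by which `relClass` multiplies ϑ, so the difference has invariant
    -- zero and is a coboundary.
    refine ⟨(-2 : k)⁻¹ • relClass i (underlying i 2 y), ?_⟩
    refine (Submodule.Quotient.eq _).2 ?_
    rw [mem_natBoundary_iff, Submodule.coe_sub, map_sub, map_sub, relClass_eta,
      smul_inv_smul₀ h2', sub_self]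

lemma card_param (i : Inner N) [Fintype {j : ℕ // 0 < j ∧ j < N ∧ j ≠ i.val}] :
    Fintype.card {j : ℕ // 0 < j ∧ j < N ∧ j ≠ i.val} = N - 2 := by
  have e : ∀ j, j ∈ (Finset.Ioo 0 N).erase i.val ↔ 0 < j ∧ j < N ∧ j ≠ i.val := by
    intro j; simp; tauto
  have := i.pos
  have := i.lt
  rw [Fintype.card_of_subtype _ e, Finset.card_erase_of_mem (by simp; omega), Nat.card_Ioo]
  omega

lemma nonempty_linearEquiv_hhBimod (h2 : (2 : k) ≠ 0) (i : Inner N) :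
    Nonempty ((Fin (N - 2) → k) ≃ₗ[k] HHBimod k i 1) := by
  let L : BimodCocycle k i (1 + 1) →ₗ[k] Param k i :=
    (relClass i).comp (BimodCocycle k i (1 + 1)).subtype
  have hker : ((BimodCochain k i 1).map (bimodDiff k N)).comap
      (BimodCocycle k i (1 + 1)).subtype = LinearMap.ker L := by
    ext x
    rw [LinearMap.mem_ker]
    constructor
    · rintro ⟨ψ, -, e⟩
      change relClass i (x : Ops k N k[X]) = 0
      have e' : bimodDiff k N ψ = x := e
      rw [← e', relClass_bimodDiff]
    · intro h
      obtain ⟨ψ, hψ, e⟩ := exists_bimodDiff_eq x.2 h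
      exact ⟨ψ, hψ, e⟩
  have hsurj : Function.Surjective L := by
    intro ϑ
    refine ⟨⟨underlying i 2 (eta h2 i ((-2 : k)⁻¹ • ϑ)), underlying_cocycle (Subtype.prop _)⟩, ?_⟩
    change relClass i (underlying i 2 (eta h2 i ((-2 : k)⁻¹ • ϑ))) = ϑ
    rw [relClass_eta, smul_inv_smul₀ (neg_ne_zero.2 h2)]
  have : Finite {j : ℕ // 0 < j ∧ j < N ∧ j ≠ i.val} :=
    (Set.finite_Ioo 0 N).subset fun j hj => ⟨hj.1, hj.2.1⟩
  have := Fintype.ofFinite {j : ℕ // 0 < j ∧ j < N ∧ j ≠ i.val}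
  exact ⟨((LinearEquiv.funCongrLeft k k (Fintype.equivFinOfCardEq (card_param i))).trans
    (LinearMap.quotKerEquivOfSurjective L hsurj).symm).trans
      (Submodule.quotEquivOfEq _ _ hker).symm⟩

end

end KLRW
end

theorem mainTheorem9 {k : Type*} [Field k] (h2 : (2 : k) ≠ 0) (N : ℕ) (i : KLRW.Inner N) :
    ∃ η : KLRW.Param k i →ₗ[k] KLRW.NatTrans (KLRW.idF (k := k)) (KLRW.braidF i) 2,
      -- the components of the natural transformations `η_ϑ`
      (∀ ϑ, KLRW.HasComponents i ϑ (η ϑ)) ∧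
      -- the homotopy equation has no other solution of degree `-1`, so it determines `η³`
      (∀ ϑ v a, v 3 = i.mid → ∀ m ∈ (KLRW.gen (k := k) (v 0)).hom (KLRW.braidObj i) (-1),
        (KLRW.braidObj i).dot (KLRW.braidDelta i) m = KLRW.homotopyRHS i (η ϑ) v a →
          m = (η ϑ : KLRW.Ops k N (KLRW.Mat k N)) 3 v a) ∧
      -- if `ϑ ≠ 0`, then `η³` is nontrivial on triples with `a₃ ∈ Hom(T_l, T_i)`, for every `l`
      (∀ ϑ, ϑ ≠ 0 → ∀ l, ∃ v a, v 2 = l ∧ v 3 = i.mid ∧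
        (η ϑ : KLRW.Ops k N (KLRW.Mat k N)) 3 v a ≠ 0) ∧
      -- the classes of the `η_ϑ` parametrize `H² Hom(id, β_i⁻)`
      Function.Bijective (fun ϑ => KLRW.HNat.mk KLRW.idF (KLRW.braidF i) 2 (η ϑ)) ∧
      -- `HH²(𝔅_i⁻) ≅ k^{N-2}`
      Nonempty ((Fin (N - 2) → k) ≃ₗ[k] KLRW.HHBimod k i 1) := by
  refine ⟨KLRW.eta h2 i, KLRW.eta_hasComponents h2 i, fun ϑ v a hv m hm h => ?_,
    fun ϑ hϑ l => ?_, KLRW.bijective_mk_eta h2 i, KLRW.nonempty_linearEquiv_hhBimod h2 i⟩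
  · have hδ := (KLRW.eta_hasComponents h2 i ϑ).eta_three v a hv
    have hη := KLRW.hom_degree (show (2 : ℤ) - (3 : ℕ) = -1 by norm_num)
      (KLRW.preNat_mem_hom (KLRW.eta h2 i ϑ).2.1 3 v a)
    have hl : v (Fin.last 3) = i.mid := hv
    rw [hl] at hη
    -- Two solutions differ by an element of degree -1 annihilated by δ, and δ is injective there.
    refine sub_eq_zero.1 (KLRW.eq_zero_of_delta_eq_zero (i := i) (p := v 0) (l := i.mid) ?_ ?_)
    · refine Submodule.sub_mem _ ?_ hη
      unfold KLRW.BHom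
      rwa [KLRW.braidF_obj_mid]
    · rw [KLRW.braidF_obj_mid]
      change (KLRW.braidObj i).dot (KLRW.braidDelta i) _ = 0
      rw [sub_eq_add_neg, KLRW.dot_add_right, KLRW.dot_neg_right, h, hδ, add_neg_cancel]
  -- If η³ vanished on all these triples, the homotopy equation would make its right-hand side
  -- vanish on them, which forces ϑ = 0.
  · by_contra! hc
    refine hϑ (KLRW.eq_zero_of_homotopyRHS (l := l) fun v a hl hv => ?_)
    have hδ := (KLRW.eta_hasComponents h2 i ϑ).eta_three v a hv
    rw [hc v a hl hv, KLRW.dot_zero_right] at hδ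
    exact hδ.symm
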